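/- **Setting.** Let $X$ be a locally compact, paracompact Hausdorff space. Locally convex spaces are complex and Hausdorff, and $\mathcal L(E,F)$ is the space of continuous linear maps. A *locally convex sheaf* $E$ on $X$ is a sheaf of locally convex spaces $E(U)$ ($U\subseteq X$ open) with continuous linear restriction maps $\rho_{V,U}$ such that, for every open covering $(U_i)_i$ of an open $U$, the topology of $E(U)$ is the projective topology with respect to the maps $\rho_{U_i,U}$; morphisms of locally convex sheaves consist of continuous linear maps. A *test pair of sheaves* $(E,F)$ consists of locally convex sheaves such that $F$ is a subsheaf of $E$, each $F(U)$ has a topology finer than the one induced by $E(U)$, and for every open $U$ and every open covering $(U_i)_i$ of $U$ there is a partition of unity $(\eta^i)_i\subset\operatorname{Hom}(E|_U,E|_U)$ subordinate to $(U_i)_i$ (that is, the supports of the $\eta^i$ form a locally finite family, $\operatorname{supp}\eta^i\subseteq U_i$, and $\sum_i\eta^i=\mathrm{id}$) with $\eta^i|_F\in\operatorname{Hom}(F|_U,F|_U)$ for all $i$. Write $V\Subset U$ if $\overline V$ is compact and contained in $U$. Let $I=(0,1]$ and let $\mathcal S=(\mathcal A,\mathcal I)$ be an admissible pair of scales, that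 is, $\mathcal A,\mathcal I\subseteq[0,\infty)^I$ and, with $O$ understood for $\varepsilon\to0^+$: for all $\lambda,\mu\in\mathcal A$ there are $\nu,\nu'\in\mathcal A$ with $\lambda+\mu=O(\nu)$ and $\lambda\mu=O(\nu')$; some $\lambda\in\mathcal A$ has $\liminf_{\varepsilon\to0^+}\lambda_\varepsilon>0$; for all $\lambda\in\mathcal I$ there are $\mu,\nu,\mu',\nu'\in\mathcal I$ with $\mu+\nu=O(\lambda)$ and $\mu'\nu'=O(\lambda)$; some $\lambda\in\mathcal I$ tends to $0$; for all $\lambda\in\mathcal I$, $\mu\in\mathcal A$ there is $\nu\in\mathcal I$ with $\mu\nu=O(\lambda)$; and there are $\lambda\in\mathcal A$, $\mu\in\mathcal I$ with $\mu=O(\lambda)$. For $U$ open let $\mathrm{RO}(U)=\mathcal L(E(U),F(U))$ with the topology of bounded convergence; a subscript $\sigma$ on $\mathcal L$ denotes the topology of pointwise convergence. A net $(\Phi_\varepsilon)_\varepsilon\in\mathrm{RO}(U)^I$ is *localizing* if for all open $V\Subset V_0\Subset U$ and all sufficiently small $\varepsilon$ we have, for all $u\in E(U)$, that $\rho_{V_0,U}(u)=0$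 implies $\rho_{V,U}(\Phi_\varepsilon(u))=0$. $\mathrm{TO}_{\rm loc}(U)$ is the set of localizing nets such that (1) for every continuous seminorm $p$ on $\mathcal L_\sigma(E(U),F(U))$ there is $\lambda\in\mathcal A$ with $p(\Phi_\varepsilon)=O(\lambda_\varepsilon)$; (2) $p(\Phi_\varepsilon|_{F(U)}-\mathrm{id})=O(\lambda_\varepsilon)$ for every continuous seminorm $p$ on $\mathcal L_\sigma(F(U),F(U))$ and every $\lambda\in\mathcal I$; (3) $\Phi_\varepsilon\to\mathrm{id}$ in $\mathcal L_\sigma(E(U),E(U))$. $\mathrm{TO}^0_{\rm loc}(U)$ is defined in the same way with $\mathrm{id}$ replaced by $0$ in (2) and (3). Assume that $\mathrm{TO}_{\rm loc}(U)\neq\emptyset$ for every open $U\subseteq X$. Let $\mathcal E_{\rm loc}(U)$ be the space of maps $R\colon\mathrm{RO}(U)\to F(U)$ that are smooth in the sense of convenient calculus (they map smooth curves to smooth curves) and *local*: for every open $V\subseteq U$, $\rho_{V,U}\circ\Phi_1=\rho_{V,U}\circ\Phi_2$ implies $\rho_{V,U}(R(\Phi_1))=\rho_{V,U}(R(\Phi_2))$.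 Such an $R$ is *moderate* (resp. *negligible*) if for all continuous seminorms $p$ on $F(U)$, all $l\in\mathbb N$, all $(\Phi_\varepsilon)_\varepsilon\in\mathrm{TO}_{\rm loc}(U)$ and all $(\Psi_{1,\varepsilon})_\varepsilon,\dots,(\Psi_{l,\varepsilon})_\varepsilon\in\mathrm{TO}^0_{\rm loc}(U)$ one has $p(\mathrm d^lR(\Phi_\varepsilon)(\Psi_{1,\varepsilon},\dots,\Psi_{l,\varepsilon}))=O(\lambda_\varepsilon)$ for some $\lambda\in\mathcal A$ (resp. for all $\lambda\in\mathcal I$). Let $\mathcal G_{\rm loc}(U)$ be the quotient of the space of moderate elements of $\mathcal E_{\rm loc}(U)$ by the space of negligible ones, and let $\sigma_U\colon F(U)\to\mathcal G_{\rm loc}(U)$ send $\varphi$ to the class of the constant map $\Phi\mapsto\varphi$. For open $V\subseteq U$ and $R\in\mathcal E_{\rm loc}(U)$ let $\rho^{\mathcal E}_{V,U}(R)\in\mathcal E_{\rm loc}(V)$ be determined by the requirement that $\rho_{W,V}(\rho^{\mathcal E}_{V,U}(R)(\Phi))=\rho_{W,U}(R(\Phi'))$ whenever $W\Subset V$, $\Phi\in\mathrm{RO}(V)$,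 $\Phi'\in\mathrm{RO}(U)$ and $\rho_{W,V}\circ\Phi\circ\rho_{V,U}=\rho_{W,U}\circ\Phi'$. **Statement.** For every open $V\subseteq U$ and $R\in\mathcal E_{\rm loc}(U)$ there is exactly one such $\rho^{\mathcal E}_{V,U}(R)$; the maps $[R]\mapsto[\rho^{\mathcal E}_{V,U}(R)]$ are well defined, and with them $\mathcal G_{\rm loc}$ is a sheaf of vector spaces on $X$. Moreover: 1. For every open $U\subseteq X$ the sheaf $\mathcal G_{\rm loc}|_U$ is fine: for disjoint closed subsets $A,B$ of $U$ there is an endomorphism of $\mathcal G_{\rm loc}|_U$ that is the identity on an open neighbourhood of $A$ and zero on an open neighbourhood of $B$; and for every open covering of $U$ there is a subordinate partition of unity in $\operatorname{Hom}(\mathcal G_{\rm loc}|_U,\mathcal G_{\rm loc}|_U)$. Every $T\in\operatorname{Hom}(F|_U,F|_U)$ induces an endomorphism of $\mathcal G_{\rm loc}|_U$ by $[R]\mapsto[T_V\circ R]$ for $V\subseteq U$ open; it extends $T$ in the sense that $\sigma_V(\varphi)\mapsto\sigma_V(T_V\varphi)$, and it is the identity (resp. zero) on every open $W\subseteq U$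 on which $T$ is the identity (resp. zero). 2. $\sigma\colon F\to\mathcal G_{\rm loc}$ is an injective morphism of sheaves of vector spaces. If $F$ is a locally convex sheaf of algebras (associative, commutative, with jointly continuous multiplications that commute with restriction), then $\mathcal G_{\rm loc}$ is a sheaf of (associative, commutative) algebras with the multiplication $[R_1]\cdot[R_2]=[R_1\cdot R_2]$, where $(R_1\cdot R_2)(\Phi)=R_1(\Phi)\cdot R_2(\Phi)$, and $\sigma$ is a homomorphism of sheaves of algebras; if $e$ is a unit of $F(U)$, then $\sigma_U(e)$ is a unit of $\mathcal G_{\rm loc}(U)$. -/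

import Mathlib

open Filter Topology TopologicalSpace Set Asymptotics
open scoped NNReal ENNReal

universe u v w

noncomputable section

namespace NonlinearExtension

/-! ## Asymptotic scales -/

/-- The parameter set `(0, 1]`. -/
abbrev Param : Type := Set.Ioc (0 : ℝ) 1

/-- The filter `ε → 0⁺` on the parameter set. -/
def toZero : Filter Param := Filter.comap Subtype.val (𝓝[>] (0 : ℝ))

/-- `f_ε = O(g_ε)` as `ε → 0⁺`. -/
def BigO (f : Param → ℝ) (g : Param → ℝ≥0) : Prop :=
  f =O[toZero] fun ε => (g ε : ℝ)

/-- An admissible pair of scales `(𝒜, ℐ)`: an asymptotic growth scale `A`, an asymptotic decay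
scale `I`, and two compatibility conditions. -/
structure ScalePair where
  A : Set (Param → ℝ≥0)
  I : Set (Param → ℝ≥0)
  A_add : ∀ l ∈ A, ∀ m ∈ A, ∃ n ∈ A, BigO (fun ε => (l ε + m ε : ℝ)) n
  A_mul : ∀ l ∈ A, ∀ m ∈ A, ∃ n ∈ A, BigO (fun ε => (l ε * m ε : ℝ)) n
  A_liminf : ∃ l ∈ A, 0 < liminf (fun ε => (l ε : ℝ≥0∞)) toZero
  I_add : ∀ l ∈ I, ∃ m ∈ I, ∃ n ∈ I, BigO (fun ε => (m ε + n ε : ℝ)) l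
  I_mul : ∀ l ∈ I, ∃ m ∈ I, ∃ n ∈ I, BigO (fun ε => (m ε * n ε : ℝ)) l
  I_lim : ∃ l ∈ I, Tendsto l toZero (𝓝 0)
  A_mul_I : ∀ l ∈ I, ∀ m ∈ A, ∃ n ∈ I, BigO (fun ε => (m ε * n ε : ℝ)) l
  I_le_A : ∃ l ∈ A, ∃ m ∈ I, BigO (fun ε => (m ε : ℝ)) l

/-! ## Smooth maps between locally convex spaces, in the sense of convenient calculus -/

section Smooth

variable {E : Type v} [AddCommGroup E] [Module ℂ E] [TopologicalSpace E]
variable {F : Type w} [AddCommGroup F] [Module ℂ F] [TopologicalSpace F]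

/-- The curve `c : ℝ → F` has derivative `d` at `t`: the difference quotients converge to `d`. -/
def HasCurveDeriv (c : ℝ → F) (d : F) (t : ℝ) : Prop :=
  Tendsto (fun h : ℝ => ((h : ℂ)⁻¹) • (c (t + h) - c t)) (𝓝[≠] 0) (𝓝 d)

/-- The derivative of a curve (meaningful where it exists). -/
def curveDeriv (c : ℝ → F) (t : ℝ) : F :=
  limUnder (𝓝[≠] (0 : ℝ)) fun h : ℝ => ((h : ℂ)⁻¹) • (c (t + h) - c t)

/-- A smooth curve: derivatives of all orders exist everywhere. -/
def IsSmoothCurve (c : ℝ → F) : Prop :=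
  ∃ d : ℕ → ℝ → F, d 0 = c ∧ ∀ n t, HasCurveDeriv (d n) (d (n + 1) t) t

/-- A map is smooth (in the sense of convenient calculus) if it maps smooth curves to smooth
curves. -/
def IsSmoothMap (f : E → F) : Prop :=
  ∀ c : ℝ → E, IsSmoothCurve c → IsSmoothCurve fun t => f (c t)

/-- The `l`-th differential `dˡf(x)(v₁, …, v_l)` of a smooth map `f`. It is the symmetric `l`-linear
map whose value on the diagonal, at `(v, …, v)`, is the `l`-th derivative at `t = 0` of the curve
`t ↦ f(x + t v)`; it is written here by polarization,
`dˡf(x)(v₁, …, v_l) = (1 / l!) ∑_{S ⊆ {1, …, l}} (-1)^(l - |S|) (d/dt)ˡ|₀ f(x + t ∑_{i ∈ S} v_i)`. -/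
def differential (l : ℕ) (f : E → F) (x : E) (y : Fin l → E) : F :=
  ((l.factorial : ℂ)⁻¹) • ∑ S : Finset (Fin l), ((-1 : ℂ) ^ (l - S.card)) •
    (curveDeriv^[l] fun t : ℝ => f (x + (t : ℂ) • ∑ i ∈ S, y i)) 0

theorem iterate_curveDeriv_eq [T2Space F] {c : ℝ → F} {d : ℕ → ℝ → F} (h0 : d 0 = c)
    (hd : ∀ n t, HasCurveDeriv (d n) (d (n + 1) t) t) (n : ℕ) : curveDeriv^[n] c = d n := by
  induction n with
  | zero => simp [h0]
  | succ n ih =>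
    rw [Function.iterate_succ_apply', ih]
    funext t
    exact (hd n t).limUnder_eq

theorem isSmoothCurve_const (x : F) : IsSmoothCurve fun _ : ℝ => x := by
  refine ⟨fun n _ => if n = 0 then x else 0, by simp, fun n t => ?_⟩
  simp [HasCurveDeriv, tendsto_const_nhds]

theorem isSmoothCurve_line (x y : E) : IsSmoothCurve fun t : ℝ => x + (t : ℂ) • y := by
  refine ⟨fun n t => if n = 0 then x + (t : ℂ) • y else if n = 1 then y else 0, by simp, ?_⟩
  intro n t
  rcases n with _ | n
  · have : (fun h : ℝ => ((h : ℂ)⁻¹) • ((x + ((t + h : ℝ) : ℂ) • y) - (x + (t : ℂ) • y)))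
        =ᶠ[𝓝[≠] 0] fun _ => y := by
      filter_upwards [self_mem_nhdsWithin] with h hh
      have hh' : (h : ℂ) ≠ 0 := by simpa using hh
      have e : (x + ((t + h : ℝ) : ℂ) • y) - (x + (t : ℂ) • y) = (h : ℂ) • y := by
        push_cast
        rw [add_smul]
        abel
      rw [e, smul_smul, inv_mul_cancel₀ hh', one_smul]
    simpa [HasCurveDeriv] using tendsto_const_nhds.congr' this.symm
  · simp [HasCurveDeriv, tendsto_const_nhds]

theorem HasCurveDeriv.add [IsTopologicalAddGroup F] {c c' : ℝ → F} {d d' : F} {t : ℝ} (h : HasCurveDeriv c d t)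
    (h' : HasCurveDeriv c' d' t) : HasCurveDeriv (fun s => c s + c' s) (d + d') t := by
  refine (Tendsto.add h h').congr fun r => ?_
  rw [← smul_add, add_sub_add_comm]

theorem HasCurveDeriv.const_smul [ContinuousSMul ℂ F] {c : ℝ → F} {d : F} {t : ℝ} (a : ℂ) (h : HasCurveDeriv c d t) :
    HasCurveDeriv (fun s => a • c s) (a • d) t := by
  refine (Tendsto.const_smul h a).congr fun r => ?_
  rw [← smul_sub, smul_comm]

theorem IsSmoothCurve.add [IsTopologicalAddGroup F] {c c' : ℝ → F} (h : IsSmoothCurve c) (h' : IsSmoothCurve c') :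
    IsSmoothCurve fun t => c t + c' t := by
  obtain ⟨d, rfl, hd⟩ := h
  obtain ⟨d', rfl, hd'⟩ := h'
  exact ⟨fun n t => d n t + d' n t, rfl, fun n t => (hd n t).add (hd' n t)⟩

theorem IsSmoothCurve.const_smul [ContinuousSMul ℂ F] {c : ℝ → F} (a : ℂ) (h : IsSmoothCurve c) :
    IsSmoothCurve fun t => a • c t := by
  obtain ⟨d, rfl, hd⟩ := h
  exact ⟨fun n t => a • d n t, rfl, fun n t => (hd n t).const_smul a⟩

theorem differential_add [IsTopologicalAddGroup F] [T2Space F] {f g : E → F} (hf : IsSmoothMap f) (hg : IsSmoothMap g)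
    (l : ℕ) (x : E) (y : Fin l → E) :
    differential l (fun z => f z + g z) x y = differential l f x y + differential l g x y := by
  unfold differential
  rw [← smul_add, ← Finset.sum_add_distrib]
  congr 1
  refine Finset.sum_congr rfl fun S _ => ?_
  rw [← smul_add]
  congr 1
  obtain ⟨d, h0, hd⟩ := hf _ (isSmoothCurve_line x (∑ i ∈ S, y i))
  obtain ⟨d', h0', hd'⟩ := hg _ (isSmoothCurve_line x (∑ i ∈ S, y i))
  rw [iterate_curveDeriv_eq h0 hd, iterate_curveDeriv_eq h0' hd',
    iterate_curveDeriv_eq (d := fun n t => d n t + d' n t) (by simp [h0, h0'])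
      fun n t => (hd n t).add (hd' n t)]

theorem differential_const_smul [ContinuousSMul ℂ F] [T2Space F] {f : E → F}
    (hf : IsSmoothMap f) (a : ℂ)
    (l : ℕ) (x : E) (y : Fin l → E) :
    differential l (fun z => a • f z) x y = a • differential l f x y := by
  unfold differential
  rw [smul_comm (a : ℂ) ((l.factorial : ℂ)⁻¹) (_ : F), Finset.smul_sum (r := a)]
  congr 1
  refine Finset.sum_congr rfl fun S _ => ?_
  rw [smul_comm (a : ℂ) ((-1 : ℂ) ^ (l - S.card)) (_ : F)]
  congr 1
  obtain ⟨d, h0, hd⟩ := hf _ (isSmoothCurve_line x (∑ i ∈ S, y i))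
  rw [iterate_curveDeriv_eq h0 hd,
    iterate_curveDeriv_eq (d := fun n t => a • d n t) (by simp [h0])
      fun n t => (hd n t).const_smul a]

end Smooth

/-! ## Presheaves and sheaves of vector spaces, and locally convex sheaves -/

/-- `V ⋐ U`: the closure of `V` is compact and contained in `U`. -/
def RelCompact {X : Type u} [TopologicalSpace X] (V U : Opens X) : Prop :=
  IsCompact (closure (V : Set X)) ∧ closure (V : Set X) ⊆ U

/-- A presheaf of complex vector spaces on `X`. -/
structure VPresheaf (X : Type u) [TopologicalSpace X] where
  obj : Opens X → Type v
  [addCommGroup : ∀ U, AddCommGroup (obj U)]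
  [module : ∀ U, Module ℂ (obj U)]
  /-- The restriction maps. -/
  res : ∀ {U V : Opens X}, V ≤ U → obj U →ₗ[ℂ] obj V
  res_self : ∀ (U : Opens X) (u : obj U), res (le_refl U) u = u
  res_res : ∀ {U V W : Opens X} (hWV : W ≤ V) (hVU : V ≤ U) (u : obj U),
    res hWV (res hVU u) = res (hWV.trans hVU) u

attribute [instance] VPresheaf.addCommGroup VPresheaf.module

namespace VPresheaf

variable {X : Type u} [TopologicalSpace X]

/-- The sheaf property: uniqueness and existence of gluings over open coverings. -/
def IsSheaf (P : VPresheaf.{u, v} X) : Prop :=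
  ∀ (U : Opens X) (ι : Type u) (c : ι → Opens X) (hc : ∀ i, c i ≤ U), U ≤ ⨆ i, c i →
    (∀ u : P.obj U, (∀ i, P.res (hc i) u = 0) → u = 0) ∧
    (∀ s : ∀ i, P.obj (c i),
      (∀ i j, P.res (inf_le_left : c i ⊓ c j ≤ c i) (s i)
        = P.res (inf_le_right : c i ⊓ c j ≤ c j) (s j)) →
      ∃ u : P.obj U, ∀ i, P.res (hc i) u = s i)

/-- Linear (pre)sheaf morphisms `P|_U → Q|_U`. -/
@[ext] structure Hom (P : VPresheaf.{u, v} X) (Q : VPresheaf.{u, w} X) (U : Opens X) where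
  app : ∀ V : Opens X, V ≤ U → P.obj V →ₗ[ℂ] Q.obj V
  app_res : ∀ {V W : Opens X} (hV : V ≤ U) (hW : W ≤ V) (u : P.obj V),
    Q.res hW (app V hV u) = app W (hW.trans hV) (P.res hW u)

namespace Hom

variable {P : VPresheaf.{u, v} X} {U : Opens X}

/-- The restriction of `μ` to the open subset `W` is zero. -/
def VanishesOn (μ : Hom P P U) (W : Opens X) : Prop :=
  ∀ (V : Opens X) (hV : V ≤ U), V ≤ W → ∀ u : P.obj V, μ.app V hV u = 0

/-- The restriction of `μ` to the open subset `W` is the identity. -/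
def IsIdOn (μ : Hom P P U) (W : Opens X) : Prop :=
  ∀ (V : Opens X) (hV : V ≤ U), V ≤ W → ∀ u : P.obj V, μ.app V hV u = u

/-- The support of `μ`: the complement in `U` of the union of the open sets on which it vanishes. -/
def support (μ : Hom P P U) : Set X :=
  {x | x ∈ U ∧ ∀ W : Opens X, W ≤ U → x ∈ W → ¬ μ.VanishesOn W}

/-- `(η i)` is a partition of unity on `P|_U` subordinate to the family `(c i)`. The sum of the
`η i` is a locally finite sum, evaluated on the open sets that meet finitely many supports. -/
structure IsPartitionOfUnity {ι : Type u} (c : ι → Opens X) (η : ι → Hom P P U) : Prop where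
  locallyFinite : ∀ x ∈ U, ∃ W : Opens X, x ∈ W ∧ W ≤ U ∧
    {i | ((η i).support ∩ (W : Set X)).Nonempty}.Finite
  support_subset : ∀ i, (η i).support ⊆ c i
  sum_eq : ∀ (V : Opens X) (hV : V ≤ U)
    (hfin : {i | ((η i).support ∩ (V : Set X)).Nonempty}.Finite) (u : P.obj V),
    ∑ i ∈ hfin.toFinset, (η i).app V hV u = u

end Hom

/-- `P|_U` is fine, in terms of cut-off morphisms: disjoint closed subsets of `U` are separated by
an endomorphism that is the identity near the first and zero near the second. -/
def IsFineOn (P : VPresheaf.{u, v} X) (U : Opens X) : Prop :=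
  ∀ A B : Set U, IsClosed A → IsClosed B → Disjoint A B →
    ∃ (μ : Hom P P U) (V W : Opens X), V ≤ U ∧ W ≤ U ∧
      Subtype.val '' A ⊆ (V : Set X) ∧ Subtype.val '' B ⊆ (W : Set X) ∧
      μ.IsIdOn V ∧ μ.VanishesOn W

/-- `P|_U` is fine, in terms of partitions of unity. -/
def HasPartitionsOfUnityOn (P : VPresheaf.{u, v} X) (U : Opens X) : Prop :=
  ∀ (ι : Type u) (c : ι → Opens X), (∀ i, c i ≤ U) → U ≤ ⨆ i, c i →
    ∃ η : ι → Hom P P U, Hom.IsPartitionOfUnity c η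

/-- The structure of a presheaf of (associative, commutative) algebras on `P`. -/
structure AlgebraStructure (P : VPresheaf.{u, v} X) where
  mul : ∀ U : Opens X, P.obj U →ₗ[ℂ] P.obj U →ₗ[ℂ] P.obj U
  mul_comm : ∀ U (a b : P.obj U), mul U a b = mul U b a
  mul_assoc : ∀ U (a b c : P.obj U), mul U (mul U a b) c = mul U a (mul U b c)
  res_mul : ∀ {U V : Opens X} (h : V ≤ U) (a b : P.obj U),
    P.res h (mul U a b) = mul V (P.res h a) (P.res h b)

end VPresheaf

/-- A sheaf of (Hausdorff) locally convex spaces with continuous restriction maps, such that the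
topology on sections over `U` is the projective topology for every open covering of `U`. -/
structure LCSheaf (X : Type u) [TopologicalSpace X] extends VPresheaf.{u, v} X where
  [top : ∀ U, TopologicalSpace (obj U)]
  [topAddGroup : ∀ U, IsTopologicalAddGroup (obj U)]
  [continuousSMul : ∀ U, ContinuousSMul ℂ (obj U)]
  [locallyConvex : ∀ U, LocallyConvexSpace ℝ (obj U)]
  [t2 : ∀ U, T2Space (obj U)]
  continuous_res : ∀ {U V : Opens X} (h : V ≤ U), Continuous (res h)
  isSheaf : toVPresheaf.IsSheaf
  projective : ∀ (U : Opens X) (ι : Type u) (c : ι → Opens X) (hc : ∀ i, c i ≤ U),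
    U ≤ ⨆ i, c i → top U = ⨅ i, TopologicalSpace.induced (res (hc i)) (top (c i))

attribute [instance] LCSheaf.top LCSheaf.topAddGroup LCSheaf.continuousSMul
  LCSheaf.locallyConvex LCSheaf.t2

namespace LCSheaf

variable {X : Type u} [TopologicalSpace X]

/-- Linear sheaf morphisms `E|_U → E|_U`; see `IsContinuous` for the topological condition. -/
abbrev EndOn (E : LCSheaf.{u, v} X) (U : Opens X) := VPresheaf.Hom E.toVPresheaf E.toVPresheaf U

/-- A morphism of locally convex sheaves consists of continuous maps. -/
def IsContinuous {E : LCSheaf.{u, v} X} {U : Opens X} (μ : E.EndOn U) : Prop :=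
  ∀ (V : Opens X) (hV : V ≤ U), Continuous (μ.app V hV)

/-- A locally convex sheaf of algebras: the multiplications are jointly continuous. -/
def IsJointlyContinuous {E : LCSheaf.{u, v} X} (a : E.toVPresheaf.AlgebraStructure) : Prop :=
  ∀ U : Opens X, Continuous fun p : E.obj U × E.obj U => a.mul U p.1 p.2

end LCSheaf

/-! ## Test pairs of sheaves -/

/-- A test pair of sheaves `(E, F)`: `F` is a subsheaf of `E` (through `incl`), each `F(U)` carries
a topology finer than that induced by `E(U)`, and for every open covering of an open set `U` there
is a subordinate partition of unity on `E|_U` by continuous morphisms that restrict to continuous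
morphisms of `F|_U`. -/
structure TestPair (X : Type u) [TopologicalSpace X] where
  E : LCSheaf.{u, v} X
  F : LCSheaf.{u, w} X
  incl : ∀ U : Opens X, F.obj U →L[ℂ] E.obj U
  incl_injective : ∀ U, Function.Injective (incl U)
  incl_res : ∀ {U V : Opens X} (h : V ≤ U) (φ : F.obj U),
    incl V (F.res h φ) = E.res h (incl U φ)
  exists_partition : ∀ (U : Opens X) (ι : Type u) (c : ι → Opens X),
    (∀ i, c i ≤ U) → U ≤ ⨆ i, c i →
    ∃ η : ι → E.EndOn U, VPresheaf.Hom.IsPartitionOfUnity c η ∧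
      (∀ i, LCSheaf.IsContinuous (η i)) ∧
      ∀ i, ∃ θ : F.EndOn U, LCSheaf.IsContinuous θ ∧
        ∀ (V : Opens X) (hV : V ≤ U) (φ : F.obj V),
          (η i).app V hV (incl V φ) = incl V (θ.app V hV φ)

namespace TestPair

variable {X : Type u} [TopologicalSpace X] (P : TestPair.{u, v, w} X)

/-- Regularization operators on `U`, with the topology of bounded convergence. -/
abbrev RO (U : Opens X) := P.E.obj U →L[ℂ] P.F.obj U

/-- Nets of regularization operators, indexed by `(0, 1]`. -/
abbrev Net (U : Opens X) := Param → P.RO U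

/-- Localizing nets. -/
def ROloc (U : Opens X) : Set (P.Net U) :=
  {Φ | ∀ (V V₀ : Opens X) (_ : RelCompact V V₀) (_ : RelCompact V₀ U) (h₀ : V₀ ≤ U) (h : V ≤ U),
    ∀ᶠ ε in toZero, ∀ u : P.E.obj U, P.E.res h₀ u = 0 → P.F.res h (Φ ε u) = 0}

/-- Test objects on `U` with respect to the pair of scales `S`; `E →Lₚₜ[ℂ] F` is the space of
continuous linear maps with the topology of pointwise convergence. -/
structure IsTestObject (S : ScalePair) {U : Opens X} (Φ : P.Net U) : Prop where
  moderate : ∀ p : Seminorm ℂ (P.E.obj U →Lₚₜ[ℂ] P.F.obj U), Continuous p →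
    ∃ l ∈ S.A, BigO (fun ε => p ((Φ ε).toPointwiseConvergenceCLM ℂ (RingHom.id ℂ) _ _)) l
  approx : ∀ p : Seminorm ℂ (P.F.obj U →Lₚₜ[ℂ] P.F.obj U), Continuous p → ∀ l ∈ S.I,
    BigO (fun ε => p (((Φ ε).comp (P.incl U) - ContinuousLinearMap.id ℂ
      (P.F.obj U)).toPointwiseConvergenceCLM ℂ (RingHom.id ℂ) _ _)) l
  tendsto : Tendsto (fun ε =>
      ((P.incl U).comp (Φ ε)).toPointwiseConvergenceCLM ℂ (RingHom.id ℂ) _ _) toZero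
    (𝓝 ((ContinuousLinearMap.id ℂ (P.E.obj U)).toPointwiseConvergenceCLM ℂ (RingHom.id ℂ) _ _))

/-- `0`-test objects on `U` with respect to the pair of scales `S`. -/
structure IsZeroTestObject (S : ScalePair) {U : Opens X} (Ψ : P.Net U) : Prop where
  moderate : ∀ p : Seminorm ℂ (P.E.obj U →Lₚₜ[ℂ] P.F.obj U), Continuous p →
    ∃ l ∈ S.A, BigO (fun ε => p ((Ψ ε).toPointwiseConvergenceCLM ℂ (RingHom.id ℂ) _ _)) l
  approx : ∀ p : Seminorm ℂ (P.F.obj U →Lₚₜ[ℂ] P.F.obj U), Continuous p → ∀ l ∈ S.I,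
    BigO (fun ε =>
      p (((Ψ ε).comp (P.incl U)).toPointwiseConvergenceCLM ℂ (RingHom.id ℂ) _ _)) l
  tendsto : Tendsto (fun ε =>
      ((P.incl U).comp (Ψ ε)).toPointwiseConvergenceCLM ℂ (RingHom.id ℂ) _ _) toZero (𝓝 0)

/-- Localizing test objects. -/
def TOloc (S : ScalePair) (U : Opens X) : Set (P.Net U) :=
  {Φ | P.IsTestObject S Φ ∧ Φ ∈ P.ROloc U}

/-- Localizing `0`-test objects. -/
def TOzloc (S : ScalePair) (U : Opens X) : Set (P.Net U) :=
  {Ψ | P.IsZeroTestObject S Ψ ∧ Ψ ∈ P.ROloc U}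

/-! ## The local basic space and the quotient construction -/

variable {P}

/-- The elements of the basic space on `U` are the smooth maps from `RO(U)` to `F(U)`; such a map
`R` is local if `R(Φ)|_V` only depends on `ρ_{V,U} ∘ Φ`. -/
def IsLocal {U : Opens X} (R : P.RO U → P.F.obj U) : Prop :=
  ∀ (V : Opens X) (h : V ≤ U) (Φ₁ Φ₂ : P.RO U),
    (∀ u, P.F.res h (Φ₁ u) = P.F.res h (Φ₂ u)) → P.F.res h (R Φ₁) = P.F.res h (R Φ₂)

/-- The space of local elements of the basic space on `U`. -/
structure IsBasicLocal {U : Opens X} (R : P.RO U → P.F.obj U) : Prop where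
  smooth : IsSmoothMap R
  isLocal : IsLocal R

/-- Moderate maps. -/
def IsModerate (S : ScalePair) {U : Opens X} (R : P.RO U → P.F.obj U) : Prop :=
  ∀ p : Seminorm ℂ (P.F.obj U), Continuous p → ∀ (l : ℕ), ∀ Φ ∈ P.TOloc S U,
    ∀ Ψ : Fin l → P.Net U, (∀ j, Ψ j ∈ P.TOzloc S U) →
      ∃ m ∈ S.A, BigO (fun ε => p (differential l R (Φ ε) fun j => Ψ j ε)) m

/-- Negligible maps. -/
def IsNegligible (S : ScalePair) {U : Opens X} (R : P.RO U → P.F.obj U) : Prop :=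
  ∀ p : Seminorm ℂ (P.F.obj U), Continuous p → ∀ (l : ℕ), ∀ Φ ∈ P.TOloc S U,
    ∀ Ψ : Fin l → P.Net U, (∀ j, Ψ j ∈ P.TOzloc S U) →
      ∀ m ∈ S.I, BigO (fun ε => p (differential l R (Φ ε) fun j => Ψ j ε)) m

theorem IsBasicLocal.zero {U : Opens X} :
    IsBasicLocal (fun _ => 0 : P.RO U → P.F.obj U) :=
  ⟨fun _ _ => isSmoothCurve_const _, fun _ _ _ _ _ => rfl⟩

theorem IsBasicLocal.const {U : Opens X} (φ : P.F.obj U) :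
    IsBasicLocal (fun _ => φ : P.RO U → P.F.obj U) :=
  ⟨fun _ _ => isSmoothCurve_const _, fun _ _ _ _ _ => rfl⟩

theorem IsBasicLocal.add {U : Opens X} {R R' : P.RO U → P.F.obj U} (h : IsBasicLocal R)
    (h' : IsBasicLocal R') : IsBasicLocal fun Φ => R Φ + R' Φ :=
  ⟨fun c hc => (h.smooth c hc).add (h'.smooth c hc), fun V hV Φ₁ Φ₂ hΦ => by
    rw [map_add, map_add, h.isLocal V hV Φ₁ Φ₂ hΦ, h'.isLocal V hV Φ₁ Φ₂ hΦ]⟩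

theorem IsBasicLocal.const_smul {U : Opens X} {R : P.RO U → P.F.obj U} (a : ℂ)
    (h : IsBasicLocal R) : IsBasicLocal fun Φ => a • R Φ :=
  ⟨fun c hc => (h.smooth c hc).const_smul a, fun V hV Φ₁ Φ₂ hΦ => by
    rw [map_smul, map_smul, h.isLocal V hV Φ₁ Φ₂ hΦ]⟩

theorem BigO_of_le_add {f g k : Param → ℝ} {m : Param → ℝ≥0} (hk0 : ∀ ε, 0 ≤ k ε)
    (hk : ∀ ε, k ε ≤ f ε + g ε) (hf : BigO f m) (hg : BigO g m) : BigO k m := by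
  refine IsBigO.trans (IsBigO.of_bound 1 (Eventually.of_forall fun ε => ?_))
    (IsBigO.add hf hg)
  rw [one_mul, Real.norm_of_nonneg (hk0 ε)]
  exact (hk ε).trans (le_abs_self _)

theorem IsModerate.const (S : ScalePair) {U : Opens X} (φ : P.F.obj U) :
    IsModerate S (fun _ => φ : P.RO U → P.F.obj U) := by
  intro p _ l Φ _ Ψ _
  obtain ⟨m, hm, hlim⟩ := S.A_liminf
  refine ⟨m, hm, ?_⟩
  obtain ⟨r, hr0, hr⟩ := exists_between hlim
  have hev : ∀ᶠ ε in toZero, r < (m ε : ℝ≥0∞) := eventually_lt_of_lt_liminf hr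
  have hrtop : r ≠ ∞ := hr.ne_top
  set C : ℝ := p (differential l (fun _ => φ : P.RO U → P.F.obj U) 0 0) with hC
  have hr' : 0 < r.toReal := ENNReal.toReal_pos hr0.ne' hrtop
  refine IsBigO.of_bound (C / r.toReal) ?_
  filter_upwards [hev] with ε hε
  have h1 : r.toReal ≤ (m ε : ℝ) := by
    have := ENNReal.toReal_mono (ENNReal.coe_ne_top (r := m ε)) hε.le
    simpa using this
  have hC0 : 0 ≤ C := apply_nonneg p _
  have h2 : p (differential l (fun _ => φ : P.RO U → P.F.obj U) (Φ ε) fun j => Ψ j ε) = C := rfl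
  rw [h2, Real.norm_of_nonneg hC0, Real.norm_of_nonneg (NNReal.coe_nonneg _), div_mul_eq_mul_div,
    le_div_iff₀ hr']
  exact mul_le_mul_of_nonneg_left h1 hC0

/-- The space of moderate local elements of the basic space on `U`. -/
def Mloc (P : TestPair.{u, v, w} X) (S : ScalePair) (U : Opens X) :
    Submodule ℂ (P.RO U → P.F.obj U) where
  carrier := {R | IsBasicLocal R ∧ IsModerate S R}
  zero_mem' := ⟨IsBasicLocal.zero, IsModerate.const S 0⟩
  add_mem' := by
    rintro R R' ⟨hR, hM⟩ ⟨hR', hM'⟩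
    refine ⟨hR.add hR', fun p hp l Φ hΦ Ψ hΨ => ?_⟩
    obtain ⟨m, hm, h⟩ := hM p hp l Φ hΦ Ψ hΨ
    obtain ⟨m', hm', h'⟩ := hM' p hp l Φ hΦ Ψ hΨ
    obtain ⟨n, hn, hmn⟩ := S.A_add m hm m' hm'
    refine ⟨n, hn, ?_⟩
    have key : ∀ k k' : Param → ℝ≥0, BigO (fun ε => (k ε : ℝ)) fun ε => k ε + k' ε := by
      intro k k'
      refine IsBigO.of_bound 1 (Eventually.of_forall fun ε => ?_)
      rw [one_mul, Real.norm_of_nonneg (NNReal.coe_nonneg _),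
        Real.norm_of_nonneg (NNReal.coe_nonneg _)]
      exact_mod_cast le_self_add
    have e1 : BigO (fun ε => (m ε : ℝ)) n := (key m m').trans (by simpa [BigO] using hmn)
    have e2 : BigO (fun ε => (m' ε : ℝ)) n :=
      (key m' m).trans (by simpa [BigO, add_comm] using hmn)
    refine BigO_of_le_add (fun ε => apply_nonneg p _) (fun ε => ?_) (IsBigO.trans h e1)
      (IsBigO.trans h' e2)
    have := differential_add hR.smooth hR'.smooth l (Φ ε) fun j => Ψ j ε
    exact (congrArg p this).le.trans (map_add_le_add p _ _)
  smul_mem' := by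
    rintro a R ⟨hR, hM⟩
    refine ⟨hR.const_smul a, fun p hp l Φ hΦ Ψ hΨ => ?_⟩
    obtain ⟨m, hm, h⟩ := hM p hp l Φ hΦ Ψ hΨ
    refine ⟨m, hm, ?_⟩
    refine IsBigO.congr_left (IsBigO.const_mul_left h ‖a‖) fun ε => ?_
    have := differential_const_smul hR.smooth a l (Φ ε) fun j => Ψ j ε
    exact ((congrArg p this).trans (map_smul_eq_mul p _ _)).symm

/-- The space of negligible local elements of the basic space on `U`. -/
def Nloc (P : TestPair.{u, v, w} X) (S : ScalePair) (U : Opens X) :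
    Submodule ℂ (P.RO U → P.F.obj U) where
  carrier := {R | IsBasicLocal R ∧ IsNegligible S R}
  zero_mem' := by
    refine ⟨IsBasicLocal.zero, fun p hp l Φ hΦ Ψ hΨ m hm => ?_⟩
    have := differential_const_smul (IsBasicLocal.zero (P := P) (U := U)).smooth 0 l
    refine IsBigO.congr_left (isBigO_zero _ _) fun ε => ?_
    have h := this (Φ ε) fun j => Ψ j ε
    simp only [smul_zero, zero_smul] at h
    exact ((congrArg p h).trans (map_zero p)).symm
  add_mem' := by
    rintro R R' ⟨hR, hM⟩ ⟨hR', hM'⟩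
    refine ⟨hR.add hR', fun p hp l Φ hΦ Ψ hΨ m hm => ?_⟩
    refine BigO_of_le_add (fun ε => apply_nonneg p _) (fun ε => ?_) (hM p hp l Φ hΦ Ψ hΨ m hm)
      (hM' p hp l Φ hΦ Ψ hΨ m hm)
    have := differential_add hR.smooth hR'.smooth l (Φ ε) fun j => Ψ j ε
    exact (congrArg p this).le.trans (map_add_le_add p _ _)
  smul_mem' := by
    rintro a R ⟨hR, hM⟩
    refine ⟨hR.const_smul a, fun p hp l Φ hΦ Ψ hΨ m hm => ?_⟩
    refine IsBigO.congr_left (IsBigO.const_mul_left (hM p hp l Φ hΦ Ψ hΨ m hm) ‖a‖) fun ε => ?_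
    have := differential_const_smul hR.smooth a l (Φ ε) fun j => Ψ j ε
    exact ((congrArg p this).trans (map_smul_eq_mul p _ _)).symm

/-- The space `𝒢_loc(U)`: moderate local elements modulo negligible local elements. -/
abbrev Gloc (P : TestPair.{u, v, w} X) (S : ScalePair) (U : Opens X) :=
  (P.Mloc S U) ⧸ (P.Nloc S U).submoduleOf (P.Mloc S U)

/-- The class `[R]` of a moderate local element `R`. -/
def cls {S : ScalePair} {U : Opens X} (R : P.Mloc S U) : P.Gloc S U :=
  ((P.Nloc S U).submoduleOf (P.Mloc S U)).mkQ R

/-- The embedding `σ_U : F(U) → 𝒢_loc(U)`, which sends `φ` to the class of the constant map `φ`. -/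
def sigma (P : TestPair.{u, v, w} X) (S : ScalePair) (U : Opens X) :
    P.F.obj U →ₗ[ℂ] P.Gloc S U :=
  ((P.Nloc S U).submoduleOf (P.Mloc S U)).mkQ.comp
    (LinearMap.codRestrict (P.Mloc S U) (LinearMap.pi fun _ => LinearMap.id)
      fun φ => ⟨IsBasicLocal.const φ, IsModerate.const S φ⟩)

/-- `R'` is the restriction `ρ^ℰ_{V,U}(R)` to `V` of the local element `R` on `U`: the values of `R'`
are determined by `R'(Φ)|_W = R(Φ')|_W` whenever `W ⋐ V` and
`ρ_{W,V} ∘ Φ ∘ ρ_{V,U} = ρ_{W,U} ∘ Φ'`. -/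
def IsRestriction {U V : Opens X} (h : V ≤ U) (R : P.RO U → P.F.obj U)
    (R' : P.RO V → P.F.obj V) : Prop :=
  ∀ (W : Opens X) (_ : RelCompact W V) (hW : W ≤ V) (Φ : P.RO V) (Φ' : P.RO U),
    (∀ u : P.E.obj U, P.F.res hW (Φ (P.E.res h u)) = P.F.res (hW.trans h) (Φ' u)) →
    P.F.res hW (R' Φ) = P.F.res (hW.trans h) (R Φ')

/-- The presheaf `𝒢_loc`: presheaf structures on `U ↦ 𝒢_loc(U)` whose restriction maps are given by
`[R] ↦ [ρ^ℰ_{V,U}(R)]`. (There is exactly one.) -/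
structure GlocPresheaf (P : TestPair.{u, v, w} X) (S : ScalePair) where
  res : ∀ {U V : Opens X}, V ≤ U → P.Gloc S U →ₗ[ℂ] P.Gloc S V
  res_self : ∀ (U : Opens X) (g : P.Gloc S U), res (le_refl U) g = g
  res_res : ∀ {U V W : Opens X} (hWV : W ≤ V) (hVU : V ≤ U) (g : P.Gloc S U),
    res hWV (res hVU g) = res (hWV.trans hVU) g
  res_mk : ∀ {U V : Opens X} (h : V ≤ U) (R : P.Mloc S U),
    ∃ R' : P.Mloc S V, IsRestriction h R.1 R'.1 ∧ res h (cls R) = cls R'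

namespace GlocPresheaf

variable {S : ScalePair}

/-- `𝒢_loc` as a presheaf of vector spaces. -/
def toVPresheaf (G : P.GlocPresheaf S) : VPresheaf.{u, max v w} X where
  obj U := P.Gloc S U
  res h := G.res h
  res_self := G.res_self
  res_res := G.res_res

end GlocPresheaf

end TestPair

end NonlinearExtension

end

/-! Everything rests on cut-offs: a two-set partition of unity gives, for `W ⋐ V ⊆ U`, an
endomorphism `κ` of `E|_U` and `F|_U` that is the identity on `W` and supported in `V`
(`exists_cutoff`). Extension by zero then gives compatible operators `E(V) → E(U)` and `F(V) →
F(U)`.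

Restriction: composing `Φ ∈ RO(V)` with the restriction `E(U) → E(V)` and with the extension `F(V) →
F(U)` gives `L Φ ∈ RO(U)`, which agrees with `Φ` on `W` and depends linearly and continuously on
`Φ`. The restriction of `R` has to be `R(L Φ)|_W` there; locality of `R` makes this independent of
the choices, and the sheaf property of `F` glues the pieces (`IsBasicLocal.exists_restriction`).

Bounds: by polarization, and because `0`-test objects form a class closed under sums, moderateness
and negligibility only involve derivatives of `t ↦ R(Φ + tΨ)` (`forall_differential_iff`). Since
`F(U)` has the projective topology of a covering, these bounds can be checked locally, after
transport of the test objects to another open set (`DirBound.of_locally`). A transport `Φ ↦ bΦa`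
preserves `0`-test objects; test objects need a correction `kΦ₀` with `ba + k = id` and a fixed test
object `Φ₀`, which exists by the nonemptiness assumption (`Transfer.mapAdd_mem_TOloc`). Consequently
restriction respects the quotient, and an element with locally negligible restrictions is
negligible; the latter uses that a localizing net eventually does not see a cut-off in its argument.

Gluing: given compatible classes `s_i` on `c_i` and a partition of unity `(η_i)`, each `η_i s_i` is
extended by zero to `U` (`exists_extension_Mloc`). The locally finite sum of the extensions
restricts on `c_j` to `∑ η_i s_j = s_j`.

Endomorphisms of `F` act on representatives by composition, which gives fineness. The embedding `σ`
is injective because a negligible constant is dominated by a scale tending to `0`. Products are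
controlled by the Leibniz rule. -/

noncomputable section

namespace NonlinearExtension

/-! ### Continuous seminorms on locally convex spaces -/

section Seminorms

variable {F : Type w} [AddCommGroup F] [Module ℂ F]

theorem seminorm_le_of_lt_one_imp {p q : Seminorm ℂ F} (h : ∀ x, q x < 1 → p x < 1) (x : F) :
    p x ≤ q x := by
  by_contra! hlt
  obtain ⟨r, hr, hr'⟩ := exists_between hlt
  have hr0 : 0 < r := (apply_nonneg q x).trans_lt hr
  have key : ∀ p : Seminorm ℂ F, p ((r⁻¹ : ℂ) • x) = r⁻¹ * p x := fun p => by
    rw [map_smul_eq_mul]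
    simp [abs_of_pos hr0]
  have h1 := h ((r⁻¹ : ℂ) • x) (by rw [key, inv_mul_lt_iff₀ hr0]; simpa using hr)
  rw [key, inv_mul_lt_iff₀ hr0] at h1
  linarith

variable [TopologicalSpace F]

theorem exists_continuous_seminorm_of_mem_nhds [IsTopologicalAddGroup F] [ContinuousSMul ℂ F]
    [LocallyConvexSpace ℝ F] {N : Set F} (hN : N ∈ 𝓝 (0 : F)) :
    ∃ q : Seminorm ℂ F, Continuous q ∧ ∀ x, q x < 1 → x ∈ N := by
  open scoped ComplexOrder in
  have : ContinuousSMul ℝ F := IsScalarTower.continuousSMul ℂ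
  -- In the order on `ℂ` the nonnegative scalars are exactly the nonnegative reals, so real
  -- convexity is complex convexity; gauges of absolutely convex open sets then become available.
  have : LocallyConvexSpace ℂ F := by
    rw [locallyConvexSpace_iff_exists_convex_subset_zero]
    intro U hU
    obtain ⟨S, hS, hc, hSU⟩ := (locallyConvexSpace_iff_exists_convex_subset_zero ℝ F).1 ‹_› U hU
    exact ⟨S, hS, convex_of_nonneg_surjective_algebraMap _
      (fun _ hr => RCLike.nonneg_iff_exists_ofReal.mp hr) hc, hSU⟩
  obtain ⟨s, hs, hsN⟩ := (nhds_hasBasis_absConvex_open ℂ F).mem_iff.1 hN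
  let s' : AbsConvexOpenSets ℂ F := ⟨s, hs⟩
  refine ⟨gaugeSeminormFamily ℂ F s', with_gaugeSeminormFamily.continuous_seminorm s',
    fun x hx => hsN ?_⟩
  have h := gaugeSeminormFamily_ball s'
  rw [← Seminorm.mem_ball_zero, h] at hx
  exact hx

theorem eq_zero_of_forall_seminorm [IsTopologicalAddGroup F] [ContinuousSMul ℂ F]
    [LocallyConvexSpace ℝ F] [T2Space F] {x : F}
    (h : ∀ q : Seminorm ℂ F, Continuous q → q x = 0) : x = 0 := by
  by_contra hx
  obtain ⟨q, hq, hq'⟩ := exists_continuous_seminorm_of_mem_nhds (F := F)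
    (isOpen_compl_singleton.mem_nhds (by simpa using Ne.symm hx) : ({x}ᶜ : Set F) ∈ 𝓝 0)
  exact hq' x (by rw [h q hq]; exact one_pos) rfl

theorem exists_seminorm_bilinear_le [IsTopologicalAddGroup F] [ContinuousSMul ℂ F]
    [LocallyConvexSpace ℝ F] (B : F →ₗ[ℂ] F →ₗ[ℂ] F)
    (hB : Continuous fun x : F × F => B x.1 x.2) (p : Seminorm ℂ F) (hp : Continuous p) :
    ∃ q : Seminorm ℂ F, Continuous q ∧ ∀ a b, p (B a b) ≤ q a * q b := by
  have h0 : {x : F × F | p (B x.1 x.2) < 1} ∈ 𝓝 ((0 : F), (0 : F)) :=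
    (isOpen_Iio.preimage (hp.comp hB)).mem_nhds (by simp)
  obtain ⟨N, hN, N', hN', hNN⟩ := mem_nhds_prod_iff.1 h0
  obtain ⟨q, hq, hqN⟩ := exists_continuous_seminorm_of_mem_nhds (Filter.inter_mem hN hN')
  refine ⟨q, hq, fun a b => ?_⟩
  have key : ∀ r s : ℝ, q a < r → q b < s → p (B a b) ≤ r * s := by
    intro r s hr hs
    have hr0 : 0 < r := (apply_nonneg q a).trans_lt hr
    have hs0 : 0 < s := (apply_nonneg q b).trans_lt hs
    have sc : ∀ (p : Seminorm ℂ F) (r : ℝ), 0 < r → ∀ x, p ((r⁻¹ : ℂ) • x) = r⁻¹ * p x :=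
      fun p r hr0 x => by
        rw [map_smul_eq_mul]
        simp [abs_of_pos hr0]
    have ha : q ((r⁻¹ : ℂ) • a) < 1 := by
      rw [sc q r hr0, inv_mul_lt_iff₀ hr0]; simpa using hr
    have hb : q ((s⁻¹ : ℂ) • b) < 1 := by
      rw [sc q s hs0, inv_mul_lt_iff₀ hs0]; simpa using hs
    have h1 : p (B ((r⁻¹ : ℂ) • a) ((s⁻¹ : ℂ) • b)) < 1 :=
      hNN (Set.mk_mem_prod (hqN _ ha).1 (hqN _ hb).2)
    rw [(B _).map_smul, B.map_smul, LinearMap.smul_apply, sc p s hs0, sc p r hr0,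
      inv_mul_lt_iff₀ hs0, inv_mul_lt_iff₀ hr0] at h1
    linarith
  -- The rescaling needs strict bounds, since `q a` or `q b` may be `0`; the sharp inequality is the
  -- limit as `δ → 0⁺`.
  have ht : Tendsto (fun δ : ℝ => (q a + δ) * (q b + δ)) (𝓝[>] 0) (𝓝 (q a * q b)) := by
    have : Continuous fun δ : ℝ => (q a + δ) * (q b + δ) := by fun_prop
    simpa using (this.tendsto 0).mono_left nhdsWithin_le_nhds
  refine ge_of_tendsto ht ?_
  filter_upwards [self_mem_nhdsWithin] with δ hδ
  have hδ' : (0 : ℝ) < δ := hδ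
  exact key _ _ (by linarith) (by linarith)

end Seminorms

/-! ### Calculus of smooth curves and directional derivatives -/

section Smooth

variable {E : Type v} [AddCommGroup E] [Module ℂ E]
variable {F : Type w} [AddCommGroup F] [Module ℂ F] [TopologicalSpace F]

/-- The `l`-th derivative at `0` of the curve `t ↦ f (x + t v)`. -/
def dirDeriv (l : ℕ) (f : E → F) (x v : E) : F :=
  curveDeriv^[l] (fun t : ℝ => f (x + (t : ℂ) • v)) 0

theorem differential_eq_sum_dirDeriv (l : ℕ) (f : E → F) (x : E) (y : Fin l → E) :
    differential l f x y = ((l.factorial : ℂ)⁻¹) • ∑ S : Finset (Fin l),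
      ((-1 : ℂ) ^ (l - S.card)) • dirDeriv l f x (∑ i ∈ S, y i) := rfl

theorem dirDeriv_zero (f : E → F) (x v : E) : dirDeriv 0 f x v = f x := by
  simp [dirDeriv]

variable [TopologicalSpace E]

theorem HasCurveDeriv.map {G : Type*} [AddCommGroup G] [Module ℂ G] [TopologicalSpace G]
    (L : F →L[ℂ] G) {c : ℝ → F} {d : F} {t : ℝ} (h : HasCurveDeriv c d t) :
    HasCurveDeriv (fun s => L (c s)) (L d) t := by
  refine ((L.continuous.tendsto d).comp h).congr fun r => ?_
  simp

theorem IsSmoothCurve.map {G : Type*} [AddCommGroup G] [Module ℂ G] [TopologicalSpace G]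
    (L : F →L[ℂ] G) {c : ℝ → F} (h : IsSmoothCurve c) : IsSmoothCurve fun s => L (c s) := by
  obtain ⟨d, rfl, hd⟩ := h
  exact ⟨fun n t => L (d n t), rfl, fun n t => (hd n t).map L⟩

theorem IsSmoothMap.comp_clm {E' : Type*} [AddCommGroup E'] [Module ℂ E'] [TopologicalSpace E']
    {f : E → F} (hf : IsSmoothMap f) (L : E' →L[ℂ] E) : IsSmoothMap fun x => f (L x) :=
  fun _ hc => hf _ (hc.map L)

theorem IsSmoothMap.clm_comp {G : Type*} [AddCommGroup G] [Module ℂ G] [TopologicalSpace G]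
    {f : E → F} (L : F →L[ℂ] G) (hf : IsSmoothMap f) : IsSmoothMap fun x => L (f x) :=
  fun c hc => (hf c hc).map L

theorem map_iterate_curveDeriv {G : Type*} [AddCommGroup G] [Module ℂ G] [TopologicalSpace G]
    [T2Space F] [T2Space G] (L : F →L[ℂ] G) {c : ℝ → F} (hc : IsSmoothCurve c) (n : ℕ) (t : ℝ) :
    L (curveDeriv^[n] c t) = curveDeriv^[n] (fun s => L (c s)) t := by
  obtain ⟨d, rfl, hd⟩ := hc
  rw [iterate_curveDeriv_eq rfl hd, iterate_curveDeriv_eq (d := fun n t => L (d n t)) rfl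
    fun n t => (hd n t).map L]

theorem HasCurveDeriv.comp_mul [T2Space F] [ContinuousSMul ℂ F] {c : ℝ → F} {d : F} {t m : ℝ}
    (h : HasCurveDeriv c d (m * t)) :
    HasCurveDeriv (fun s => c (m * s)) ((m : ℂ) • d) t := by
  -- For `m = 0` the substitution `r ↦ m * r` leaves the punctured neighbourhoods, but the curve is
  -- constant.
  rcases eq_or_ne m 0 with rfl | hm
  · simp [HasCurveDeriv]
  have h1 : Tendsto (fun r : ℝ => m * r) (𝓝[≠] 0) (𝓝[≠] 0) := by
    refine tendsto_nhdsWithin_iff.2 ⟨?_, ?_⟩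
    · have : Continuous fun r : ℝ => m * r := by fun_prop
      simpa using (this.tendsto 0).mono_left nhdsWithin_le_nhds
    · filter_upwards [self_mem_nhdsWithin] with r hr
      exact mul_ne_zero hm hr
  refine ((h.comp h1).const_smul (m : ℂ)).congr fun r => ?_
  have hm' : (m : ℂ) ≠ 0 := by exact_mod_cast hm
  simp only [Function.comp_apply, smul_smul, mul_add]
  congr 1
  push_cast
  rw [mul_inv, mul_inv_cancel_left₀ hm']

theorem HasCurveDeriv.tendsto [IsTopologicalAddGroup F] [ContinuousSMul ℂ F] {c : ℝ → F} {d : F}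
    {t : ℝ} (h : HasCurveDeriv c d t) :
    Tendsto (fun r : ℝ => c (t + r)) (𝓝[≠] 0) (𝓝 (c t)) := by
  have h0 : Tendsto (fun r : ℝ => (r : ℂ)) (𝓝[≠] 0) (𝓝 0) := by
    simpa using (Complex.continuous_ofReal.tendsto 0).mono_left nhdsWithin_le_nhds
  have h1 := (h0.smul h).add_const (c t)
  rw [zero_smul, zero_add] at h1
  refine h1.congr' ?_
  filter_upwards [self_mem_nhdsWithin] with r hr
  have hr' : (r : ℂ) ≠ 0 := by simpa using hr
  rw [smul_smul, mul_inv_cancel₀ hr', one_smul, sub_add_cancel]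

/-- The increment of the product splits as `B (c t) (Δc') + B (Δc) (c' (t + r))`; the second term
needs the continuity of `c'`, which follows from differentiability. -/
theorem HasCurveDeriv.bilinear [IsTopologicalAddGroup F] [ContinuousSMul ℂ F]
    {B : F →ₗ[ℂ] F →ₗ[ℂ] F} (hB : Continuous fun x : F × F => B x.1 x.2) {c c' : ℝ → F}
    {d d' : F} {t : ℝ} (h : HasCurveDeriv c d t) (h' : HasCurveDeriv c' d' t) :
    HasCurveDeriv (fun s => B (c s) (c' s)) (B (c t) d' + B d (c' t)) t := by
  have h1 : Tendsto (fun r : ℝ => B (c t) ((r : ℂ)⁻¹ • (c' (t + r) - c' t))) (𝓝[≠] 0)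
      (𝓝 (B (c t) d')) :=
    (hB.tendsto (c t, d')).comp (tendsto_const_nhds.prodMk_nhds h')
  have h2 : Tendsto (fun r : ℝ => B ((r : ℂ)⁻¹ • (c (t + r) - c t)) (c' (t + r))) (𝓝[≠] 0)
      (𝓝 (B d (c' t))) :=
    (hB.tendsto (d, c' t)).comp (Tendsto.prodMk_nhds h h'.tendsto)
  refine (h1.add h2).congr fun r => ?_
  simp only [map_smul, LinearMap.smul_apply, map_sub, LinearMap.sub_apply]
  rw [← smul_add]
  congr 1
  abel

theorem HasCurveDeriv.sum [IsTopologicalAddGroup F] {ι : Type*} (s : Finset ι) {c : ι → ℝ → F}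
    {d : ι → F} {t : ℝ} (h : ∀ i ∈ s, HasCurveDeriv (c i) (d i) t) :
    HasCurveDeriv (fun r => ∑ i ∈ s, c i r) (∑ i ∈ s, d i) t := by
  refine (tendsto_finsetSum s h).congr fun r => ?_
  rw [← Finset.smul_sum, Finset.sum_sub_distrib]

theorem hasCurveDeriv_leibniz [IsTopologicalAddGroup F] [ContinuousSMul ℂ F]
    {B : F →ₗ[ℂ] F →ₗ[ℂ] F} (hB : Continuous fun x : F × F => B x.1 x.2) {d d' : ℕ → ℝ → F}
    (hd : ∀ n t, HasCurveDeriv (d n) (d (n + 1) t) t)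
    (hd' : ∀ n t, HasCurveDeriv (d' n) (d' (n + 1) t) t) (n : ℕ) (t : ℝ) :
    HasCurveDeriv
      (fun t => ∑ ij ∈ Finset.HasAntidiagonal.antidiagonal n,
        n.choose ij.1 • B (d ij.1 t) (d' ij.2 t))
      (∑ ij ∈ Finset.HasAntidiagonal.antidiagonal (n + 1),
        (n + 1).choose ij.1 • B (d ij.1 t) (d' ij.2 t)) t := by
  rw [Finset.sum_antidiagonal_choose_succ_nsmul (fun i j => B (d i t) (d' j t)),
    ← Finset.sum_add_distrib]
  refine HasCurveDeriv.sum _ fun ij hij => ?_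
  have h := (HasCurveDeriv.bilinear hB (hd ij.1 t) (hd' ij.2 t)).const_smul (n.choose ij.1 : ℂ)
  -- Pascal's recursion puts `n.choose ij.2` on the second sum; symmetry gives both terms of the
  -- product rule the same coefficient.
  rw [← Nat.choose_symm_of_eq_add (Finset.HasAntidiagonal.mem_antidiagonal.1 hij).symm, ← smul_add]
  simpa only [Nat.cast_smul_eq_nsmul] using h

/-- Continuous linear maps commute with curve derivatives, so only the two curves in `t` matter.
This is how derivatives of maps on different open sets are compared. -/
theorem dirDeriv_congr {E' : Type*} [AddCommGroup E'] [Module ℂ E'] [TopologicalSpace E']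
    {F' : Type*} [AddCommGroup F'] [Module ℂ F'] [TopologicalSpace F'] {G : Type*}
    [AddCommGroup G] [Module ℂ G] [TopologicalSpace G] [T2Space F] [T2Space F'] [T2Space G]
    {f : E → F} {f' : E' → F'} (hf : IsSmoothMap f) (hf' : IsSmoothMap f') (L : F →L[ℂ] G)
    (L' : F' →L[ℂ] G) {x v : E} {x' v' : E'}
    (h : ∀ t : ℝ, L (f (x + (t : ℂ) • v)) = L' (f' (x' + (t : ℂ) • v'))) (l : ℕ) :
    L (dirDeriv l f x v) = L' (dirDeriv l f' x' v') := by
  unfold dirDeriv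
  rw [map_iterate_curveDeriv L (hf _ (isSmoothCurve_line x v)),
    map_iterate_curveDeriv L' (hf' _ (isSmoothCurve_line x' v'))]
  simp_rw [h]

theorem dirDeriv_smul [T2Space F] [ContinuousSMul ℂ F] {f : E → F} (hf : IsSmoothMap f) (l : ℕ)
    (x v : E) (m : ℝ) : dirDeriv l f x ((m : ℂ) • v) = (m : ℂ) ^ l • dirDeriv l f x v := by
  obtain ⟨d, h0, hd⟩ := hf _ (isSmoothCurve_line x v)
  unfold dirDeriv
  rw [iterate_curveDeriv_eq h0 hd,
    iterate_curveDeriv_eq (d := fun n t => (m : ℂ) ^ n • d n (m * t)) ?_ ?_]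
  · simp
  · funext t
    simp only [pow_zero, one_smul, h0]
    rw [smul_smul]
    push_cast
    rw [mul_comm]
  · intro n t
    have := ((hd n (m * t)).comp_mul).const_smul ((m : ℂ) ^ n)
    rwa [smul_smul, ← pow_succ] at this

/-- By homogeneity the summand for `S` is `|S|^l` times the same vector, and the alternating sum of
these powers is the `l`-th finite difference of `m ↦ m ^ l` at `0`, namely `l!`. -/
theorem differential_diag [T2Space F] [ContinuousSMul ℂ F] {f : E → F} (hf : IsSmoothMap f)
    (l : ℕ) (x v : E) : (differential l f x fun _ => v) = dirDeriv l f x v := by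
  rw [differential_eq_sum_dirDeriv]
  have h1 : ∀ S : Finset (Fin l), ((-1 : ℂ) ^ (l - S.card)) • dirDeriv l f x (∑ _i ∈ S, v)
      = ((-1 : ℂ) ^ (l - S.card) * (S.card : ℂ) ^ l) • dirDeriv l f x v := by
    intro S
    have : (∑ _i ∈ S, v) = (((S.card : ℝ) : ℂ)) • v := by
      simp [Nat.cast_smul_eq_nsmul]
    rw [this, dirDeriv_smul hf, smul_smul]
    push_cast
    rfl
  have h2 : ∑ S : Finset (Fin l), (-1 : ℂ) ^ (l - S.card) * (S.card : ℂ) ^ l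
      = (l.factorial : ℂ) := by
    have e := Finset.sum_powerset_apply_card
      (fun m => (-1 : ℂ) ^ (l - m) * (m : ℂ) ^ l) (x := (Finset.univ : Finset (Fin l)))
    rw [Finset.powerset_univ] at e
    rw [e, Finset.card_univ, Fintype.card_fin]
    have e2 := congrFun (fwdDiff_iter_eq_factorial (R := ℂ) (n := l)) 0
    rw [fwdDiff_iter_eq_sum_shift] at e2
    simp only [nsmul_eq_mul, mul_one, zero_add, Pi.natCast_apply] at e2
    rw [← e2]
    refine Finset.sum_congr rfl fun m _ => ?_
    rw [zsmul_eq_mul, nsmul_eq_mul]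
    push_cast
    ring
  simp_rw [h1]
  rw [← Finset.sum_smul, h2, smul_smul, inv_mul_cancel₀ (by exact_mod_cast l.factorial_ne_zero),
    one_smul]

theorem IsSmoothMap.bilinear [IsTopologicalAddGroup F] [ContinuousSMul ℂ F]
    {B : F →ₗ[ℂ] F →ₗ[ℂ] F} (hB : Continuous fun x : F × F => B x.1 x.2) {f g : E → F}
    (hf : IsSmoothMap f) (hg : IsSmoothMap g) : IsSmoothMap fun x => B (f x) (g x) := by
  intro c hc
  obtain ⟨d, h0, hd⟩ := hf c hc
  obtain ⟨d', h0', hd'⟩ := hg c hc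
  refine ⟨fun n t => ∑ ij ∈ Finset.HasAntidiagonal.antidiagonal n,
      n.choose ij.1 • B (d ij.1 t) (d' ij.2 t),
    by simp [h0, h0'], hasCurveDeriv_leibniz hB hd hd'⟩

theorem dirDeriv_bilinear [T2Space F] [IsTopologicalAddGroup F] [ContinuousSMul ℂ F]
    {B : F →ₗ[ℂ] F →ₗ[ℂ] F} (hB : Continuous fun x : F × F => B x.1 x.2) {f g : E → F}
    (hf : IsSmoothMap f) (hg : IsSmoothMap g) (l : ℕ) (x v : E) :
    dirDeriv l (fun x => B (f x) (g x)) x v = ∑ ij ∈ Finset.HasAntidiagonal.antidiagonal l,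
      l.choose ij.1 • B (dirDeriv ij.1 f x v) (dirDeriv ij.2 g x v) := by
  obtain ⟨d, h0, hd⟩ := hf _ (isSmoothCurve_line x v)
  obtain ⟨d', h0', hd'⟩ := hg _ (isSmoothCurve_line x v)
  unfold dirDeriv
  rw [iterate_curveDeriv_eq (d := fun n t => ∑ ij ∈ Finset.HasAntidiagonal.antidiagonal n,
    n.choose ij.1 • B (d ij.1 t) (d' ij.2 t)) (by simp [h0, h0']) (hasCurveDeriv_leibniz hB hd hd')]
  simp_rw [iterate_curveDeriv_eq h0 hd, iterate_curveDeriv_eq h0' hd']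

end Smooth

/-! ### Gluing in sheaves, and supports of endomorphisms -/

namespace VPresheaf

variable {X : Type u} [TopologicalSpace X] {P : VPresheaf.{u, v} X}

theorem res_eq (P : VPresheaf.{u, v} X) {U : Opens X} (h : U ≤ U) (s : P.obj U) :
    P.res h s = s :=
  P.res_self U s

/-- Equality on an open set passes to smaller open sets. -/
theorem res_congr (P : VPresheaf.{u, v} X) {U V W : Opens X} (hVU : V ≤ U) (hWV : W ≤ V)
    {a b : P.obj U} (h : P.res hVU a = P.res hVU b) :
    P.res (hWV.trans hVU) a = P.res (hWV.trans hVU) b := by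
  rw [← P.res_res hWV hVU, h, P.res_res]

theorem IsSheaf.eq_of_locally (hP : P.IsSheaf) {U : Opens X} {a b : P.obj U}
    (h : ∀ x ∈ U, ∃ (W : Opens X) (hW : W ≤ U), x ∈ W ∧ P.res hW a = P.res hW b) : a = b := by
  choose! W hW hx he using h
  have := (hP U U (fun x => W x) (fun x => hW x x.2) fun x hxU =>
    Opens.mem_iSup.2 ⟨⟨x, hxU⟩, hx x hxU⟩).1 (a - b) fun x => by
      rw [map_sub, he x x.2, sub_self]
  exact sub_eq_zero.1 this

theorem IsSheaf.eq_of_sup (hP : P.IsSheaf) {U V Z : Opens X} (hV : V ≤ U) (hZ : Z ≤ U)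
    (hU : U ≤ V ⊔ Z) {a b : P.obj U} (h₁ : P.res hV a = P.res hV b)
    (h₂ : P.res hZ a = P.res hZ b) : a = b := by
  refine hP.eq_of_locally fun x hx => ?_
  rcases hU hx with h | h
  exacts [⟨V, hV, h, h₁⟩, ⟨Z, hZ, h, h₂⟩]

/-- The local sections are given by a relation instead of a family: the result is then known on
every open set admitted by `Q`, not only on those of the covering chosen in the proof. -/
theorem IsSheaf.exists_glue (hP : P.IsSheaf) {U : Opens X}
    (Q : ∀ W : Opens X, W ≤ U → P.obj W → Prop)
    (hcov : ∀ x ∈ U, ∃ (W : Opens X) (hW : W ≤ U) (s : P.obj W), x ∈ W ∧ Q W hW s)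
    (hcoh : ∀ (W W' : Opens X) (hW : W ≤ U) (hW' : W' ≤ U) (s : P.obj W) (s' : P.obj W'),
      Q W hW s → Q W' hW' s' →
        P.res (inf_le_left : W ⊓ W' ≤ W) s = P.res (inf_le_right : W ⊓ W' ≤ W') s') :
    ∃ a : P.obj U, ∀ (W : Opens X) (hW : W ≤ U) (s : P.obj W), Q W hW s → P.res hW a = s := by
  have hcov' : ∀ x : U, ∃ (W : Opens X) (hW : W ≤ U) (s : P.obj W), x.1 ∈ W ∧ Q W hW s :=
    fun x => hcov x x.2
  choose W hW s hx hQ using hcov'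
  obtain ⟨a, ha⟩ := (hP U U W hW fun x hxU =>
    Opens.mem_iSup.2 ⟨⟨x, hxU⟩, hx ⟨x, hxU⟩⟩).2 s fun i j =>
      hcoh _ _ (hW i) (hW j) _ _ (hQ i) (hQ j)
  refine ⟨a, fun V hV t ht => hP.eq_of_locally fun x hxV => ?_⟩
  refine ⟨V ⊓ W ⟨x, hV hxV⟩, inf_le_left, ⟨hxV, hx _⟩, ?_⟩
  rw [hcoh _ _ hV (hW ⟨x, hV hxV⟩) _ _ ht (hQ _), ← ha, P.res_res, P.res_res]

namespace Hom

variable {U : Opens X}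

theorem VanishesOn.mono {μ : Hom P P U} {V W : Opens X} (h : μ.VanishesOn W) (hVW : V ≤ W) :
    μ.VanishesOn V :=
  fun O hO hOV => h O hO (hOV.trans hVW)

theorem IsIdOn.mono {μ : Hom P P U} {V W : Opens X} (h : μ.IsIdOn W) (hVW : V ≤ W) :
    μ.IsIdOn V :=
  fun O hO hOV => h O hO (hOV.trans hVW)

theorem VanishesOn.res_app {μ : Hom P P U} {V Z W : Opens X} (h : μ.VanishesOn Z) (hV : V ≤ U)
    (hWV : W ≤ V) (hWZ : W ≤ Z) (a : P.obj V) : P.res hWV (μ.app V hV a) = 0 := by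
  rw [μ.app_res, h _ _ hWZ]

theorem IsIdOn.res_app {μ : Hom P P U} {V Z W : Opens X} (h : μ.IsIdOn Z) (hV : V ≤ U)
    (hWV : W ≤ V) (hWZ : W ≤ Z) (a : P.obj V) : P.res hWV (μ.app V hV a) = P.res hWV a := by
  rw [μ.app_res, h _ _ hWZ]

/-- The complement in `U` of the support of `μ`. -/
def zeroLocus (μ : Hom P P U) : Opens X := sSup {W | W ≤ U ∧ μ.VanishesOn W}

theorem zeroLocus_le (μ : Hom P P U) : μ.zeroLocus ≤ U := sSup_le fun _ h => h.1

theorem mem_support_or_mem_zeroLocus (μ : Hom P P U) {x : X} (hx : x ∈ U) :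
    x ∈ μ.support ∨ x ∈ μ.zeroLocus := by
  by_cases h : x ∈ μ.support
  · exact Or.inl h
  · simp only [support, mem_ofPred_eq, not_and, not_forall, not_not] at h
    obtain ⟨W, hW, hxW, hv⟩ := h hx
    exact Or.inr (Opens.mem_sSup.2 ⟨W, ⟨hW, hv⟩, hxW⟩)

theorem le_zeroLocus_of_disjoint (μ : Hom P P U) {W : Opens X} (hW : W ≤ U)
    (h : ¬ (μ.support ∩ (W : Set X)).Nonempty) : W ≤ μ.zeroLocus := fun _ hx =>
  (μ.mem_support_or_mem_zeroLocus (hW hx)).resolve_left fun hs => h ⟨_, hs, hx⟩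

theorem vanishesOn_zeroLocus (hP : P.IsSheaf) (μ : Hom P P U) : μ.VanishesOn μ.zeroLocus := by
  intro V hV hVZ a
  refine hP.eq_of_locally fun x hx => ?_
  obtain ⟨W, ⟨hW, hv⟩, hxW⟩ := Opens.mem_sSup.1 (hVZ hx)
  exact ⟨V ⊓ W, inf_le_left, ⟨hx, hxW⟩, by
    rw [hv.res_app hV inf_le_left inf_le_right, map_zero]⟩

end Hom

end VPresheaf

/-! ### Local verification of topological properties; extension by zero -/

namespace LCSheaf

variable {X : Type u} [TopologicalSpace X] (E : LCSheaf.{u, v} X) {U : Opens X}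

/-- The restriction maps as continuous linear maps. -/
def resL {U V : Opens X} (h : V ≤ U) : E.obj U →L[ℂ] E.obj V := ⟨E.res h, E.continuous_res h⟩

@[simp] theorem resL_apply {U V : Opens X} (h : V ≤ U) (a : E.obj U) : E.resL h a = E.res h a :=
  rfl

/-- The maps of a continuous endomorphism as continuous linear maps. -/
def IsContinuous.appL {E : LCSheaf.{u, v} X} {μ : E.EndOn U} (hμ : IsContinuous μ) {V : Opens X}
    (hV : V ≤ U) : E.obj V →L[ℂ] E.obj V := ⟨μ.app V hV, hμ V hV⟩

@[simp] theorem IsContinuous.appL_apply {E : LCSheaf.{u, v} X} {μ : E.EndOn U}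
    (hμ : IsContinuous μ) {V : Opens X} (hV : V ≤ U) (a : E.obj V) :
    hμ.appL hV a = μ.app V hV a := rfl

/-- This is the projectivity axiom for a covering indexed by the points of `U`. Convergence,
smoothness and seminorm estimates become local in the same way. -/
theorem continuous_of_locally {M : Type*} [TopologicalSpace M] {f : M → E.obj U}
    (h : ∀ x ∈ U, ∃ (W : Opens X) (hW : W ≤ U), x ∈ W ∧ Continuous fun m => E.res hW (f m)) :
    Continuous f := by
  have h' : ∀ x : U, ∃ (W : Opens X) (hW : W ≤ U), x.1 ∈ W ∧ Continuous fun m => E.res hW (f m) :=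
    fun x => h x x.2
  choose W hW hx hc using h'
  rw [continuous_iff_le_induced, E.projective U U W hW fun x hxU =>
    Opens.mem_iSup.2 ⟨⟨x, hxU⟩, hx ⟨x, hxU⟩⟩, induced_iInf]
  refine le_iInf fun i => ?_
  rw [induced_compose]
  exact continuous_iff_le_induced.1 (hc i)

theorem tendsto_of_locally {M : Type*} {l : Filter M} {f : M → E.obj U} {a : E.obj U}
    (h : ∀ x ∈ U, ∃ (W : Opens X) (hW : W ≤ U), x ∈ W ∧
      Tendsto (fun m => E.res hW (f m)) l (𝓝 (E.res hW a))) : Tendsto f l (𝓝 a) := by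
  have h' : ∀ x : U, ∃ (W : Opens X) (hW : W ≤ U), x.1 ∈ W ∧
      Tendsto (fun m => E.res hW (f m)) l (𝓝 (E.res hW a)) := fun x => h x x.2
  choose W hW hx hc using h'
  rw [E.projective U U W hW fun x hxU => Opens.mem_iSup.2 ⟨⟨x, hxU⟩, hx ⟨x, hxU⟩⟩,
    nhds_iInf, tendsto_iInf]
  intro i
  rw [nhds_induced, tendsto_comap_iff]
  exact hc i

/-- Restriction commutes with curve derivatives, so the local derivatives of each order agree on
overlaps and glue; the difference quotients of the glued curves converge because they do so locally.
-/
theorem isSmoothCurve_of_locally {c : ℝ → E.obj U}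
    (h : ∀ x ∈ U, ∃ (W : Opens X) (hW : W ≤ U), x ∈ W ∧ IsSmoothCurve fun t => E.res hW (c t)) :
    IsSmoothCurve c := by
  have key : ∀ n t, ∃ a : E.obj U, ∀ (W : Opens X) (hW : W ≤ U) (s : E.obj W),
      ((IsSmoothCurve fun t => E.res hW (c t)) ∧
        s = curveDeriv^[n] (fun t => E.res hW (c t)) t) → E.res hW a = s := by
    intro n t
    refine E.isSheaf.exists_glue (fun W hW s => (IsSmoothCurve fun t => E.res hW (c t)) ∧
        s = curveDeriv^[n] (fun t => E.res hW (c t)) t) (fun x hx => ?_) ?_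
    · obtain ⟨W, hW, hxW, hs⟩ := h x hx
      exact ⟨W, hW, _, hxW, hs, rfl⟩
    · rintro W W' hW hW' s s' ⟨hs, rfl⟩ ⟨hs', rfl⟩
      have e := map_iterate_curveDeriv (E.resL (inf_le_left : W ⊓ W' ≤ W)) hs n t
      have e' := map_iterate_curveDeriv (E.resL (inf_le_right : W ⊓ W' ≤ W')) hs' n t
      simp only [resL_apply] at e e'
      rw [e, e']
      simp only [E.res_res]
  choose d hd using key
  refine ⟨d, funext fun t => E.isSheaf.eq_of_locally fun x hx => ?_, fun n t => ?_⟩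
  · obtain ⟨W, hW, hxW, hs⟩ := h x hx
    exact ⟨W, hW, hxW, hd 0 t W hW _ ⟨hs, rfl⟩⟩
  · refine E.tendsto_of_locally fun x hx => ?_
    obtain ⟨W, hW, hxW, hs⟩ := h x hx
    refine ⟨W, hW, hxW, ?_⟩
    obtain ⟨e, he0, he⟩ := id hs
    have hde : ∀ n t, E.res hW (d n t) = e n t := fun n t => by
      rw [hd n t W hW _ ⟨hs, rfl⟩, iterate_curveDeriv_eq he0 he]
    rw [hde]
    refine (he n t).congr fun r => ?_
    rw [map_smul, map_sub, hde, hde]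

/-- A neighbourhood of `0` in the projective topology constrains only finitely many restrictions;
replacing each constraint by a seminorm and using homogeneity gives the estimate. -/
theorem exists_seminorm_le_sum (W : U → Opens X) (hW : ∀ x, W x ≤ U) (hx : ∀ x : U, x.1 ∈ W x)
    (p : Seminorm ℂ (E.obj U)) (hp : Continuous p) :
    ∃ (J : Finset U) (q : ∀ x : U, Seminorm ℂ (E.obj (W x))), (∀ x, Continuous (q x)) ∧
      ∀ a, p a ≤ ∑ x ∈ J, q x (E.res (hW x) a) := by
  have h0 : {a | p a < 1} ∈ 𝓝 (0 : E.obj U) :=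
    (isOpen_Iio.preimage hp).mem_nhds (by simp)
  rw [E.projective U U W hW fun x hxU => Opens.mem_iSup.2 ⟨⟨x, hxU⟩, hx ⟨x, hxU⟩⟩,
    nhds_iInf] at h0
  obtain ⟨I, hI, V, hV, -, hU, -⟩ := Filter.mem_iInf'.1 h0
  have hq : ∀ x : U, ∃ q : Seminorm ℂ (E.obj (W x)), Continuous q ∧
      ∀ a, q (E.res (hW x) a) < 1 → a ∈ V x := by
    intro x
    have := hV x
    rw [nhds_induced] at this
    obtain ⟨N, hN, hNV⟩ := this
    rw [map_zero] at hN
    obtain ⟨q, hq, hqN⟩ := exists_continuous_seminorm_of_mem_nhds hN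
    exact ⟨q, hq, fun a ha => hNV (hqN _ ha)⟩
  choose q hqc hqV using hq
  refine ⟨hI.toFinset, q, hqc, fun a => ?_⟩
  have hs : ∀ (T : Finset U) a, (∑ x ∈ T, (q x).comp (E.res (hW x))) a
      = ∑ x ∈ T, q x (E.res (hW x) a) := fun T a => by
    classical
    induction T using Finset.induction_on with
    | empty => simp
    | insert x T hx ih =>
      rw [Finset.sum_insert hx, Finset.sum_insert hx, ← ih]
      rfl
  rw [← hs]
  refine seminorm_le_of_lt_one_imp (fun b hb => ?_) a
  rw [hs] at hb
  have : b ∈ ⋂ i ∈ I, V i := mem_iInter₂.2 fun i hi => hqV i b <|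
    (Finset.single_le_sum (f := fun x => q x (E.res (hW x) b)) (fun _ _ => apply_nonneg _ _)
      (hI.mem_toFinset.2 hi)).trans_lt hb
  rw [← hU] at this
  exact this

/-- The sections `μ a` on `V` and `0` on `Z` agree on the overlap because `μ` vanishes on `Z`.
Linearity and continuity of the glued section in `a` are checked on `V` and `Z`. -/
theorem exists_extension {V Z : Opens X} (hV : V ≤ U) (hZ : Z ≤ U) (hU : U ≤ V ⊔ Z)
    {μ : E.EndOn U} (hμ : IsContinuous μ) (h0 : μ.VanishesOn Z) :
    ∃ e : E.obj V →L[ℂ] E.obj U, (∀ a, E.res hV (e a) = μ.app V hV a) ∧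
      ∀ a, E.res hZ (e a) = 0 := by
  have key : ∀ a : E.obj V, ∃ b : E.obj U, E.res hV b = μ.app V hV a ∧ E.res hZ b = 0 := by
    intro a
    obtain ⟨b, hb⟩ := E.isSheaf.exists_glue (U := U)
      (fun W _ s => (∃ h : W ≤ V, s = E.res h (μ.app V hV a)) ∨ (W ≤ Z ∧ s = 0))
      (fun x hx => by
        rcases hU hx with h | h
        exacts [⟨V, hV, _, h, Or.inl ⟨le_rfl, rfl⟩⟩, ⟨Z, hZ, _, h, Or.inr ⟨le_rfl, rfl⟩⟩]) (by
        rintro W W' hW hW' s s' (⟨h, rfl⟩ | ⟨h, rfl⟩) (⟨h', rfl⟩ | ⟨h', rfl⟩)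
        · rw [E.res_res, E.res_res]
        · rw [E.res_res, map_zero, h0.res_app hV _ (inf_le_right.trans h')]
        · rw [E.res_res, map_zero, h0.res_app hV _ (inf_le_left.trans h)]
        · rw [map_zero, map_zero])
    exact ⟨b, by rw [hb V hV _ (Or.inl ⟨le_rfl, rfl⟩), E.res_eq],
      hb Z hZ 0 (Or.inr ⟨le_rfl, rfl⟩)⟩
  choose e heV heZ using key
  refine ⟨⟨⟨⟨e, fun a b => ?_⟩, fun c a => ?_⟩, ?_⟩, heV, heZ⟩
  · refine E.isSheaf.eq_of_sup hV hZ hU ?_ ?_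
    · simp only [map_add, heV]
    · simp only [map_add, heZ, add_zero]
  · refine E.isSheaf.eq_of_sup hV hZ hU ?_ ?_
    · simp only [map_smul, heV, RingHom.id_apply]
    · simp only [map_smul, heZ, smul_zero]
  · refine E.continuous_of_locally fun x hx => ?_
    rcases hU hx with h | h
    · refine ⟨V, hV, h, ?_⟩
      simpa [heV] using hμ V hV
    · refine ⟨Z, hZ, h, ?_⟩
      simpa [heZ] using continuous_const

end LCSheaf

/-! ### Relatively compact open subsets -/

section RelCompact

variable {X : Type u} [TopologicalSpace X]

theorem RelCompact.le {V U : Opens X} (h : RelCompact V U) : V ≤ U :=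
  fun _ hx => h.2 (subset_closure hx)

theorem RelCompact.mono {V U U' : Opens X} (h : RelCompact V U) (hU : U ≤ U') : RelCompact V U' :=
  ⟨h.1, h.2.trans hU⟩

/-- The open complement in `U` of the closure of `W`. -/
def awayFrom (U W : Opens X) : Opens X :=
  ⟨(U : Set X) \ closure (W : Set X), U.isOpen.sdiff isClosed_closure⟩

theorem awayFrom_le (U W : Opens X) : awayFrom U W ≤ U := fun _ hx => hx.1

/-- This is the two-set covering from which cut-offs are built: a cut-off that is the identity off
`awayFrom U W` is the identity on `W`, by `le_of_le_sup_awayFrom`. -/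
theorem RelCompact.le_sup_awayFrom {W V : Opens X} (h : RelCompact W V) (U : Opens X) :
    U ≤ V ⊔ awayFrom U W := by
  intro x hx
  by_cases hxW : x ∈ closure (W : Set X)
  exacts [Or.inl (h.2 hxW), Or.inr ⟨hx, hxW⟩]

theorem le_of_le_sup_awayFrom {U W N : Opens X} (hWU : W ≤ U) (h : U ≤ N ⊔ awayFrom U W) :
    W ≤ N := fun _ hx => (h (hWU hx)).resolve_right fun h' => h'.2 (subset_closure hx)

variable [T2Space X] [LocallyCompactSpace X]

theorem exists_relCompact_of_isCompact {K : Set X} (hK : IsCompact K) {U : Opens X}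
    (hKU : K ⊆ U) : ∃ V : Opens X, K ⊆ V ∧ RelCompact V U := by
  obtain ⟨V, hV, hKV, hVU, hc⟩ := exists_open_between_and_isCompact_closure hK U.isOpen hKU
  exact ⟨⟨V, hV⟩, hKV, hc, hVU⟩

theorem exists_relCompact_of_mem {x : X} {U : Opens X} (hx : x ∈ U) :
    ∃ V : Opens X, x ∈ V ∧ RelCompact V U := by
  obtain ⟨V, hV, h⟩ := exists_relCompact_of_isCompact (K := {x}) isCompact_singleton
    (singleton_subset_iff.2 hx)
  exact ⟨V, hV rfl, h⟩

theorem RelCompact.exists_between {V U : Opens X} (h : RelCompact V U) :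
    ∃ W : Opens X, RelCompact V W ∧ RelCompact W U := by
  obtain ⟨W, hW, h'⟩ := exists_relCompact_of_isCompact h.1 h.2
  exact ⟨W, ⟨h.1, hW⟩, h'⟩

end RelCompact

/-! ### Cut-offs and the associated extension operators -/

namespace VPresheaf.Hom.IsPartitionOfUnity

variable {X : Type u} [TopologicalSpace X] {P : VPresheaf.{u, v} X} {U : Opens X} {ι : Type u}
  {c : ι → Opens X} {η : ι → Hom P P U}

/-- Frees the index set from supports: the indices whose support meets `V` lie in `J`, and the other
members of `J` contribute zero on `V`. -/
theorem sum_eq_of_vanishesOn (hP : P.IsSheaf) (h : IsPartitionOfUnity c η) {V : Opens X}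
    (hV : V ≤ U) (J : Finset ι) (hJ : ∀ i ∉ J, (η i).VanishesOn V) (a : P.obj V) :
    ∑ i ∈ J, (η i).app V hV a = a := by
  have hsub : {i | ((η i).support ∩ (V : Set X)).Nonempty} ⊆ J := by
    rintro i ⟨x, hx, hxV⟩
    by_contra hi
    exact hx.2 V hV hxV (hJ i hi)
  have hfin := J.finite_toSet.subset hsub
  refine Eq.trans (Eq.symm ?_) (h.sum_eq V hV hfin a)
  refine Finset.sum_subset (fun i hi => hsub (hfin.mem_toFinset.1 hi)) fun i _ hi => ?_
  exact (η i).vanishesOn_zeroLocus hP V hV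
    ((η i).le_zeroLocus_of_disjoint hV fun h' => hi (hfin.mem_toFinset.2 h')) a

end VPresheaf.Hom.IsPartitionOfUnity

namespace TestPair

variable {X : Type u} [TopologicalSpace X] (P : TestPair.{u, v, w} X)

/-- A continuous endomorphism of `E|_U` together with its restriction to `F|_U`. -/
structure EndPair (U : Opens X) where
  η : P.E.EndOn U
  θ : P.F.EndOn U
  contE : LCSheaf.IsContinuous η
  contF : LCSheaf.IsContinuous θ
  compat : ∀ (V : Opens X) (hV : V ≤ U) (φ : P.F.obj V),
    η.app V hV (P.incl V φ) = P.incl V (θ.app V hV φ)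

variable {P}

theorem EndPair.θ_vanishesOn {U W : Opens X} (κ : P.EndPair U) (h : κ.η.VanishesOn W) :
    κ.θ.VanishesOn W := fun V hV hVW φ => P.incl_injective V <| by
  rw [← κ.compat, h V hV hVW, map_zero]

theorem EndPair.θ_isIdOn {U W : Opens X} (κ : P.EndPair U) (h : κ.η.IsIdOn W) :
    κ.θ.IsIdOn W := fun V hV hVW φ => P.incl_injective V <| by
  rw [← κ.compat, h V hV hVW]

/-- Take the member supported in `V` of a partition of unity for `{V, Z₀}`. It vanishes on `Z`, the
complement of its support, and is the identity on `N`, the complement of the support of the other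
member, which lies in `Z₀`. -/
theorem exists_cutoff {U V Z₀ : Opens X} (hV : V ≤ U) (hZ₀ : Z₀ ≤ U) (hU : U ≤ V ⊔ Z₀) :
    ∃ (κ : P.EndPair U) (N Z : Opens X), N ≤ U ∧ Z ≤ U ∧ U ≤ N ⊔ Z₀ ∧ U ≤ V ⊔ Z ∧
      κ.η.IsIdOn N ∧ κ.η.VanishesOn Z := by
  obtain ⟨η, hη, hc, hθ⟩ := P.exists_partition U (ULift Bool) (fun b => cond b.down V Z₀)
    (fun b => by rcases b with ⟨_ | _⟩ <;> assumption)
    (fun x hx => by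
      rcases hU hx with h | h
      exacts [Opens.mem_iSup.2 ⟨⟨true⟩, h⟩, Opens.mem_iSup.2 ⟨⟨false⟩, h⟩])
  obtain ⟨θ, hθc, hθη⟩ := hθ ⟨true⟩
  refine ⟨⟨η ⟨true⟩, θ, hc _, hθc, hθη⟩, (η ⟨false⟩).zeroLocus, (η ⟨true⟩).zeroLocus,
    (η _).zeroLocus_le, (η _).zeroLocus_le, fun x hx => ?_, fun x hx => ?_, ?_,
    (η _).vanishesOn_zeroLocus P.E.isSheaf⟩
  · exact ((η ⟨false⟩).mem_support_or_mem_zeroLocus hx).symm.imp_right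
      fun h => hη.support_subset ⟨false⟩ h
  · exact ((η ⟨true⟩).mem_support_or_mem_zeroLocus hx).imp_left
      fun h => hη.support_subset ⟨true⟩ h
  · intro W hW hWN a
    have := hη.sum_eq_of_vanishesOn P.E.isSheaf hW {⟨true⟩} (by
      rintro ⟨_ | _⟩ hi
      · exact ((η ⟨false⟩).vanishesOn_zeroLocus P.E.isSheaf).mono hWN
      · simp at hi) a
    rwa [Finset.sum_singleton] at this

/-- Compatible extension operators `E(V) → E(U)` and `F(V) → F(U)` associated with a cut-off. -/
structure Extension {U V Z : Opens X} (κ : P.EndPair U) (hV : V ≤ U) (hZ : Z ≤ U) where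
  E : P.E.obj V →L[ℂ] P.E.obj U
  F : P.F.obj V →L[ℂ] P.F.obj U
  le_sup : U ≤ V ⊔ Z
  vanishesOn : κ.η.VanishesOn Z
  res_E : ∀ u, P.E.res hV (E u) = κ.η.app V hV u
  res_F : ∀ φ, P.F.res hV (F φ) = κ.θ.app V hV φ
  res_E_zero : ∀ u, P.E.res hZ (E u) = 0
  res_F_zero : ∀ φ, P.F.res hZ (F φ) = 0

theorem EndPair.exists_extension {U V Z : Opens X} (κ : P.EndPair U) (hV : V ≤ U) (hZ : Z ≤ U)
    (hU : U ≤ V ⊔ Z) (h0 : κ.η.VanishesOn Z) : Nonempty (Extension κ hV hZ) := by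
  obtain ⟨e, he, he0⟩ := P.E.exists_extension hV hZ hU κ.contE h0
  obtain ⟨f, hf, hf0⟩ := P.F.exists_extension hV hZ hU κ.contF (κ.θ_vanishesOn h0)
  exact ⟨⟨e, f, hU, h0, he, hf, he0, hf0⟩⟩

namespace Extension

variable {U V Z : Opens X} {κ : P.EndPair U} {hV : V ≤ U} {hZ : Z ≤ U} (e : Extension κ hV hZ)

theorem E_incl (φ : P.F.obj V) : e.E (P.incl V φ) = P.incl U (e.F φ) := by
  refine P.E.isSheaf.eq_of_sup hV hZ e.le_sup ?_ ?_
  · rw [e.res_E, ← P.incl_res, e.res_F, κ.compat]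
  · rw [e.res_E_zero, ← P.incl_res, e.res_F_zero, map_zero]

theorem E_res (u : P.E.obj U) : e.E (P.E.res hV u) = κ.η.app U le_rfl u := by
  refine P.E.isSheaf.eq_of_sup hV hZ e.le_sup ?_ ?_
  · rw [e.res_E, κ.η.app_res]
  · rw [e.res_E_zero, e.vanishesOn.res_app _ _ le_rfl]

/-- The extension of a section that is zero on `O` is zero on `O`. -/
theorem res_E_eq_zero {O O' : Opens X} (hO : O ≤ U) (hO' : O' ≤ V) (hOO' : O ⊓ V ≤ O')
    {u : P.E.obj V} (h : P.E.res hO' u = 0) : P.E.res hO (e.E u) = 0 := by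
  refine P.E.isSheaf.eq_of_locally fun x hx => ?_
  rcases e.le_sup (hO hx) with hxV | hxZ
  · refine ⟨O ⊓ V, inf_le_left, ⟨hx, hxV⟩, ?_⟩
    rw [P.E.res_res, map_zero, ← P.E.res_res (inf_le_right : O ⊓ V ≤ V) hV, e.res_E, κ.η.app_res,
      ← P.E.res_res hOO' hO', h, map_zero, map_zero]
  · refine ⟨O ⊓ Z, inf_le_left, ⟨hx, hxZ⟩, ?_⟩
    rw [P.E.res_res, map_zero, ← P.E.res_res (inf_le_right : O ⊓ Z ≤ Z) hZ, e.res_E_zero, map_zero]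

/-- The extension is zero on `Z` anyway, so `φ` has to vanish only on the part of `O ∩ V` outside
`Z`. This allows `O'` to be relatively compact in `V` when `O` is not contained in `V`. -/
theorem res_F_eq_zero {O O' : Opens X} (hO : O ≤ U) (hO' : O' ≤ V) (hOO' : O ⊓ V ≤ O' ⊔ Z)
    {φ : P.F.obj V} (h : P.F.res hO' φ = 0) : P.F.res hO (e.F φ) = 0 := by
  refine P.F.isSheaf.eq_of_locally fun x hx => ?_
  by_cases hxZ : x ∈ Z
  · refine ⟨O ⊓ Z, inf_le_left, ⟨hx, hxZ⟩, ?_⟩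
    rw [P.F.res_res, map_zero, ← P.F.res_res (inf_le_right : O ⊓ Z ≤ Z) hZ, e.res_F_zero, map_zero]
  · have hxV : x ∈ V := (e.le_sup (hO hx)).resolve_right hxZ
    have hxO' : x ∈ O' := (hOO' ⟨hx, hxV⟩).resolve_right hxZ
    refine ⟨O ⊓ O', inf_le_left, ⟨hx, hxO'⟩, ?_⟩
    rw [P.F.res_res, map_zero, ← P.F.res_res (inf_le_right.trans hO' : O ⊓ O' ≤ V) hV, e.res_F,
      κ.θ.app_res, ← P.F.res_res inf_le_right hO', h, map_zero, map_zero]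

end Extension

end TestPair

/-! ### Test objects and their transport between open sets -/

theorem BigO.of_le {f g : Param → ℝ} {m : Param → ℝ≥0} (hf : ∀ ε, 0 ≤ f ε) (h : ∀ ε, f ε ≤ g ε)
    (hg : BigO g m) : BigO f m :=
  TestPair.BigO_of_le_add (g := 0) hf (by simpa using h) hg (isBigO_zero _ _)

theorem ScalePair.exists_bigO_add (S : ScalePair) {l m : Param → ℝ≥0} (hl : l ∈ S.A)
    (hm : m ∈ S.A) : ∃ n ∈ S.A, BigO (fun ε => (l ε : ℝ)) n ∧ BigO (fun ε => (m ε : ℝ)) n := by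
  obtain ⟨n, hn, h⟩ := S.A_add l hl m hm
  exact ⟨n, hn, h.of_le (fun ε => (l ε).2) fun ε => le_add_of_nonneg_right (m ε).2,
    h.of_le (fun ε => (m ε).2) fun ε => le_add_of_nonneg_left (l ε).2⟩

namespace TestPair

variable {X : Type u} [TopologicalSpace X] {P : TestPair.{u, v, w} X} {S : ScalePair}

/-- Nets of regularization operators that approximate `t_E` and `t_F` the way test objects
approximate the identity. -/
structure IsApprox (S : ScalePair) {U : Opens X} (Φ : P.Net U) (tE : P.E.obj U →L[ℂ] P.E.obj U)
    (tF : P.F.obj U →L[ℂ] P.F.obj U) : Prop where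
  moderate : ∀ p : Seminorm ℂ (P.E.obj U →Lₚₜ[ℂ] P.F.obj U), Continuous p →
    ∃ l ∈ S.A, BigO (fun ε => p ((Φ ε).toPointwiseConvergenceCLM ℂ (RingHom.id ℂ) _ _)) l
  approx : ∀ p : Seminorm ℂ (P.F.obj U →Lₚₜ[ℂ] P.F.obj U), Continuous p → ∀ l ∈ S.I,
    BigO (fun ε => p (((Φ ε).comp (P.incl U) - tF).toPointwiseConvergenceCLM ℂ
      (RingHom.id ℂ) _ _)) l
  tendsto : ∀ u, Tendsto (fun ε => P.incl U (Φ ε u)) toZero (𝓝 (tE u))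

/-- Test objects and `0`-test objects are the cases `id` and `0` of one notion, so stability under
sums and compositions is proved once for both. -/
theorem isTestObject_iff {U : Opens X} {Φ : P.Net U} : P.IsTestObject S Φ ↔
    IsApprox S Φ (ContinuousLinearMap.id ℂ _) (ContinuousLinearMap.id ℂ _) :=
  ⟨fun h => ⟨h.1, h.2, PointwiseConvergenceCLM.tendsto_iff_forall_tendsto.1 h.3⟩,
    fun h => ⟨h.1, h.2, PointwiseConvergenceCLM.tendsto_iff_forall_tendsto.2 h.3⟩⟩

theorem isZeroTestObject_iff {U : Opens X} {Ψ : P.Net U} : P.IsZeroTestObject S Ψ ↔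
    IsApprox S Ψ 0 0 :=
  ⟨fun h => ⟨h.1, fun p hp l hl => by simpa only [sub_zero] using h.2 p hp l hl,
      PointwiseConvergenceCLM.tendsto_iff_forall_tendsto.1 h.3⟩,
    fun h => ⟨h.1, fun p hp l hl => by simpa only [sub_zero] using h.2 p hp l hl,
      PointwiseConvergenceCLM.tendsto_iff_forall_tendsto.2 h.3⟩⟩

namespace IsApprox

variable {U V : Opens X}

theorem zero : IsApprox S (0 : P.Net U) 0 0 where
  moderate p _ := by
    obtain ⟨l, hl, -⟩ := S.A_liminf
    refine ⟨l, hl, ?_⟩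
    simp only [Pi.zero_apply, map_zero]
    exact isBigO_zero _ _
  approx p _ l _ := by
    simp only [Pi.zero_apply, ContinuousLinearMap.zero_comp, sub_zero, map_zero]
    exact isBigO_zero _ _
  tendsto u := by simp [tendsto_const_nhds]

theorem add {Φ Φ' : P.Net U} {tE tE' : P.E.obj U →L[ℂ] P.E.obj U}
    {tF tF' : P.F.obj U →L[ℂ] P.F.obj U} (h : IsApprox S Φ tE tF) (h' : IsApprox S Φ' tE' tF') :
    IsApprox S (fun ε => Φ ε + Φ' ε) (tE + tE') (tF + tF') where
  moderate p hp := by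
    obtain ⟨l, hl, hb⟩ := h.moderate p hp
    obtain ⟨l', hl', hb'⟩ := h'.moderate p hp
    obtain ⟨n, hn, hln, hln'⟩ := S.exists_bigO_add hl hl'
    refine ⟨n, hn, BigO_of_le_add (fun _ => apply_nonneg _ _) (fun ε => ?_) (IsBigO.trans hb hln)
      (IsBigO.trans hb' hln')⟩
    rw [map_add]
    exact map_add_le_add p _ _
  approx p hp l hl := by
    refine BigO_of_le_add (fun _ => apply_nonneg _ _) (fun ε => ?_) (h.approx p hp l hl)
      (h'.approx p hp l hl)
    rw [ContinuousLinearMap.add_comp, add_sub_add_comm, map_add]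
    exact map_add_le_add p _ _
  tendsto u := by
    refine ((h.tendsto u).add (h'.tendsto u)).congr fun ε => ?_
    simp

/-- Pre- and postcomposition are continuous for pointwise convergence, so seminorms pull back.
Compatibility of `a` with the inclusions gives `approx`, that of `b` gives `tendsto`. -/
theorem comp {Φ : P.Net U} {tE : P.E.obj U →L[ℂ] P.E.obj U}
    {tF : P.F.obj U →L[ℂ] P.F.obj U} (h : IsApprox S Φ tE tF)
    (aE : P.E.obj V →L[ℂ] P.E.obj U) (aF : P.F.obj V →L[ℂ] P.F.obj U)
    (ha : ∀ φ, aE (P.incl V φ) = P.incl U (aF φ))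
    (bE : P.E.obj U →L[ℂ] P.E.obj V) (bF : P.F.obj U →L[ℂ] P.F.obj V)
    (hb : ∀ φ, bE (P.incl U φ) = P.incl V (bF φ)) :
    IsApprox S (fun ε => bF.comp ((Φ ε).comp aE)) (bE.comp (tE.comp aE))
      (bF.comp (tF.comp aF)) where
  moderate p hp :=
    h.moderate (p.comp ((PointwiseConvergenceCLM.postcomp _ bF).comp
      (PointwiseConvergenceCLM.precomp _ aE)).toLinearMap) (hp.comp (ContinuousLinearMap.cont _))
  approx p hp l hl := by
    have := h.approx (p.comp ((PointwiseConvergenceCLM.postcomp _ bF).comp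
      (PointwiseConvergenceCLM.precomp _ aF)).toLinearMap) (hp.comp (ContinuousLinearMap.cont _))
      l hl
    refine IsBigO.congr_left this fun ε => congrArg p ?_
    ext φ
    change bF (Φ ε (P.incl U (aF φ)) - tF (aF φ)) = bF (Φ ε (aE (P.incl V φ))) - bF (tF (aF φ))
    rw [ha, map_sub]
  tendsto u := by
    refine ((bE.continuous.tendsto _).comp (h.tendsto (aE u))).congr fun ε => ?_
    exact hb _

end IsApprox

theorem ROloc_add {U : Opens X} {Φ Φ' : P.Net U} (h : Φ ∈ P.ROloc U) (h' : Φ' ∈ P.ROloc U) :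
    (fun ε => Φ ε + Φ' ε) ∈ P.ROloc U := by
  intro V V₀ hV hV₀ h₀ h₁
  filter_upwards [h V V₀ hV hV₀ h₀ h₁, h' V V₀ hV hV₀ h₀ h₁] with ε hε hε' u hu
  rw [add_apply, map_add, hε u hu, hε' u hu, add_zero]

theorem TOzloc_zero {U : Opens X} : (0 : P.Net U) ∈ P.TOzloc S U :=
  ⟨isZeroTestObject_iff.2 IsApprox.zero, fun _ _ _ _ _ _ => Eventually.of_forall fun _ u _ => by
    simp⟩

theorem TOzloc_add {U : Opens X} {Ψ Ψ' : P.Net U} (h : Ψ ∈ P.TOzloc S U)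
    (h' : Ψ' ∈ P.TOzloc S U) : (fun ε => Ψ ε + Ψ' ε) ∈ P.TOzloc S U :=
  ⟨isZeroTestObject_iff.2 (by
    simpa using (isZeroTestObject_iff.1 h.1).add (isZeroTestObject_iff.1 h'.1)), ROloc_add h.2 h'.2⟩

theorem TOzloc_sum {U : Opens X} {ι : Type*} (J : Finset ι) {Ψ : ι → P.Net U}
    (h : ∀ i, Ψ i ∈ P.TOzloc S U) : (fun ε => ∑ i ∈ J, Ψ i ε) ∈ P.TOzloc S U := by
  classical
  induction J using Finset.induction_on with
  | empty => exact TOzloc_zero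
  | insert i J hi ih =>
    simp only [Finset.sum_insert hi]
    exact TOzloc_add (h i) ih

variable (P) in
/-- Data that transport test objects on `U` to test objects on `V`. -/
structure Transfer (U V : Opens X) where
  aE : P.E.obj V →L[ℂ] P.E.obj U
  aF : P.F.obj V →L[ℂ] P.F.obj U
  bE : P.E.obj U →L[ℂ] P.E.obj V
  bF : P.F.obj U →L[ℂ] P.F.obj V
  kE : P.E.obj V →L[ℂ] P.E.obj V
  kF : P.F.obj V →L[ℂ] P.F.obj V
  aE_incl : ∀ φ, aE (P.incl V φ) = P.incl U (aF φ)
  bE_incl : ∀ φ, bE (P.incl U φ) = P.incl V (bF φ)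
  kE_incl : ∀ φ, kE (P.incl V φ) = P.incl V (kF φ)
  bE_aE_add_kE : ∀ u, bE (aE u) + kE u = u
  local_ab : ∀ (V₁ V₀ : Opens X), RelCompact V₁ V₀ → RelCompact V₀ V →
    ∀ (h₁ : V₁ ≤ V) (h₀ : V₀ ≤ V),
    ∃ (U₁ U₀ : Opens X) (hU₁ : U₁ ≤ U) (hU₀ : U₀ ≤ U), RelCompact U₁ U₀ ∧ RelCompact U₀ U ∧
      (∀ u, P.E.res h₀ u = 0 → P.E.res hU₀ (aE u) = 0) ∧
      ∀ φ, P.F.res hU₁ φ = 0 → P.F.res h₁ (bF φ) = 0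
  local_k : ∀ (O : Opens X) (hO : O ≤ V) (φ : P.F.obj V), P.F.res hO φ = 0 →
    P.F.res hO (kF φ) = 0

namespace Transfer

variable {U V : Opens X} (T : P.Transfer U V)

/-- The transport of regularization operators. -/
def map (Φ : P.RO U) : P.RO V := T.bF.comp (Φ.comp T.aE)

/-- The transport of regularization operators, corrected by an operator on the target. -/
def mapAdd (Φ : P.RO U) (Φ₀ : P.RO V) : P.RO V := T.map Φ + T.kF.comp Φ₀

theorem map_mem_ROloc {Φ : P.Net U} (h : Φ ∈ P.ROloc U) : (fun ε => T.map (Φ ε)) ∈ P.ROloc V := by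
  intro V₁ V₀ hV₁ hV₀ h₀ h₁
  obtain ⟨U₁, U₀, hU₁, hU₀, hc₁, hc₀, ha, hb⟩ := T.local_ab V₁ V₀ hV₁ hV₀ h₁ h₀
  filter_upwards [h U₁ U₀ hc₁ hc₀ hU₀ hU₁] with ε hε u hu
  exact hb _ (hε _ (ha u hu))

theorem map_mem_TOzloc {Ψ : P.Net U} (h : Ψ ∈ P.TOzloc S U) :
    (fun ε => T.map (Ψ ε)) ∈ P.TOzloc S V :=
  ⟨isZeroTestObject_iff.2 (by
    have := (isZeroTestObject_iff.1 h.1).comp T.aE T.aF T.aE_incl T.bE T.bF T.bE_incl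
    simp only [ContinuousLinearMap.zero_comp, ContinuousLinearMap.comp_zero] at this
    exact this), T.map_mem_ROloc h.2⟩

theorem bF_aF_add_kF (φ : P.F.obj V) : T.bF (T.aF φ) + T.kF φ = φ :=
  P.incl_injective V <| by
    rw [map_add, ← T.bE_incl, ← T.aE_incl, ← T.kE_incl, T.bE_aE_add_kE]

/-- The transported net approximates `b ∘ a`, the correction approximates `k`, and `b ∘ a + k = id`.
-/
theorem mapAdd_mem_TOloc {Φ : P.Net U} {Φ₀ : P.Net V} (h : Φ ∈ P.TOloc S U)
    (h₀ : Φ₀ ∈ P.TOloc S V) : (fun ε => T.mapAdd (Φ ε) (Φ₀ ε)) ∈ P.TOloc S V := by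
  refine ⟨isTestObject_iff.2 ?_, ROloc_add (T.map_mem_ROloc h.2) ?_⟩
  · have := ((isTestObject_iff.1 h.1).comp T.aE T.aF T.aE_incl T.bE T.bF T.bE_incl).add
      ((isTestObject_iff.1 h₀.1).comp (ContinuousLinearMap.id ℂ _) (ContinuousLinearMap.id ℂ _)
        (fun _ => rfl) T.kE T.kF T.kE_incl)
    have hE : ContinuousLinearMap.id ℂ (P.E.obj V) = T.bE.comp ((ContinuousLinearMap.id ℂ _).comp
        T.aE) + T.kE.comp ((ContinuousLinearMap.id ℂ _).comp (ContinuousLinearMap.id ℂ _)) :=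
      ContinuousLinearMap.ext fun u => (T.bE_aE_add_kE u).symm
    have hF : ContinuousLinearMap.id ℂ (P.F.obj V) = T.bF.comp ((ContinuousLinearMap.id ℂ _).comp
        T.aF) + T.kF.comp ((ContinuousLinearMap.id ℂ _).comp (ContinuousLinearMap.id ℂ _)) :=
      ContinuousLinearMap.ext fun φ => (T.bF_aF_add_kF φ).symm
    rw [← hE, ← hF] at this
    exact this
  · intro V₁ V₀ hV₁ hV₀ hle₀ hle₁
    filter_upwards [h₀.2 V₁ V₀ hV₁ hV₀ hle₀ hle₁] with ε hε u hu
    exact T.local_k _ _ _ (hε u hu)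

/-- Transport is affine in `Φ` with linear part `map`: the line `t ↦ Φ + tΨ` goes to a line whose
direction is again a `0`-test object if `Ψ` is one. -/
theorem mapAdd_add_smul_map (Φ Ψ : P.RO U) (Φ₀ : P.RO V) (t : ℂ) :
    T.mapAdd Φ Φ₀ + t • T.map Ψ = T.mapAdd (Φ + t • Ψ) Φ₀ := by
  ext u
  simp only [mapAdd, map, add_apply, ContinuousLinearMap.comp_apply,
    smul_apply, map_add, map_smul]
  abel

end Transfer

section

variable {U V N Z Z' : Opens X}

/-- Restriction of test objects to a smaller open set, by means of two cut-offs. -/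
def restrictTransfer {χ κ : P.EndPair U} {hV : V ≤ U} {hZ : Z ≤ U} (e : Extension χ hV hZ)
    (hN : χ.η.IsIdOn N) (hZ' : κ.η.VanishesOn Z') (hU : U ≤ N ⊔ Z') : P.Transfer U V where
  aE := e.E
  aF := e.F
  bE := (P.E.resL hV).comp (κ.contE.appL le_rfl)
  bF := (P.F.resL hV).comp (κ.contF.appL le_rfl)
  kE := ContinuousLinearMap.id ℂ _ - κ.contE.appL hV
  kF := ContinuousLinearMap.id ℂ _ - κ.contF.appL hV
  aE_incl := e.E_incl
  bE_incl φ := by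
    simp only [ContinuousLinearMap.comp_apply, LCSheaf.resL_apply, LCSheaf.IsContinuous.appL_apply]
    rw [κ.compat, P.incl_res]
  kE_incl φ := by
    simp only [sub_apply, LCSheaf.IsContinuous.appL_apply,
      ContinuousLinearMap.id_apply]
    rw [κ.compat, map_sub]
  bE_aE_add_kE u := by
    simp only [sub_apply, LCSheaf.IsContinuous.appL_apply,
      ContinuousLinearMap.id_apply, ContinuousLinearMap.comp_apply, LCSheaf.resL_apply]
    rw [κ.η.app_res, e.res_E, add_sub_left_comm, add_eq_left, sub_eq_zero]
    -- What remains is `κχ = κ` on `V`: on `N` the cut-off `χ` is the identity, on `Z'` the cut-off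
    -- `κ` is zero.
    refine P.E.isSheaf.eq_of_locally fun x hx => ?_
    rcases hU (hV hx) with h | h
    · refine ⟨V ⊓ N, inf_le_left, ⟨hx, h⟩, ?_⟩
      rw [κ.η.app_res, hN.res_app hV inf_le_left inf_le_right, ← κ.η.app_res hV]
    · refine ⟨V ⊓ Z', inf_le_left, ⟨hx, h⟩, ?_⟩
      rw [hZ'.res_app hV inf_le_left inf_le_right, hZ'.res_app hV inf_le_left inf_le_right]
  local_ab V₁ V₀ hV₁ hV₀ h₁ h₀ := by
    refine ⟨V₁, V₀, h₁.trans hV, h₀.trans hV, hV₁, hV₀.mono hV, fun u hu => ?_, fun φ hφ => ?_⟩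
    · exact e.res_E_eq_zero _ h₀ inf_le_left hu
    · simp only [ContinuousLinearMap.comp_apply, LCSheaf.resL_apply,
        LCSheaf.IsContinuous.appL_apply]
      rw [P.F.res_res, κ.θ.app_res, hφ, map_zero]
  local_k O hO φ hφ := by
    simp only [sub_apply, LCSheaf.IsContinuous.appL_apply,
      ContinuousLinearMap.id_apply]
    rw [map_sub, κ.θ.app_res, hφ, map_zero, sub_zero]

/-- Extension of test objects to a larger open set, by means of a cut-off. -/
def extendTransfer [T2Space X] [LocallyCompactSpace X] {κ : P.EndPair U} {hV : V ≤ U} {hZ : Z ≤ U}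
    (e : Extension κ hV hZ) : P.Transfer V U where
  aE := P.E.resL hV
  aF := P.F.resL hV
  bE := e.E
  bF := e.F
  kE := ContinuousLinearMap.id ℂ _ - κ.contE.appL le_rfl
  kF := ContinuousLinearMap.id ℂ _ - κ.contF.appL le_rfl
  aE_incl φ := (P.incl_res hV φ).symm
  bE_incl := e.E_incl
  kE_incl φ := by
    simp only [sub_apply, LCSheaf.IsContinuous.appL_apply,
      ContinuousLinearMap.id_apply]
    rw [κ.compat, map_sub]
  bE_aE_add_kE u := by
    simp only [sub_apply, LCSheaf.IsContinuous.appL_apply,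
      ContinuousLinearMap.id_apply, LCSheaf.resL_apply]
    rw [e.E_res, add_sub_cancel]
  local_ab U₁ U₀ hU₁ hU₀ h₁ h₀ := by
    -- `U₁` need not lie in `V`, but the part of its closure outside `Z` is compact in `V ⊓ U₀`.
    -- Vanishing on a neighbourhood `N₁` of that part suffices, because the extension is zero on
    -- `Z`.
    have hK : IsCompact (closure (U₁ : Set X) \ Z) := hU₁.1.diff Z.isOpen
    have hKV : closure (U₁ : Set X) \ Z ⊆ (V ⊓ U₀ : Opens X) := fun x hx =>
      ⟨(e.le_sup (h₀ (hU₁.2 hx.1))).resolve_right hx.2, hU₁.2 hx.1⟩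
    obtain ⟨N₁, hKN, hN₁⟩ := exists_relCompact_of_isCompact hK hKV
    obtain ⟨N₀, hN₁₀, hN₀⟩ := hN₁.exists_between
    have hN₁V : N₁ ≤ V := hN₁.le.trans inf_le_left
    have hN₀V : N₀ ≤ V := hN₀.le.trans inf_le_left
    refine ⟨N₁, N₀, hN₁V, hN₀V, hN₁₀, hN₀.mono inf_le_left, fun u hu => ?_, fun φ hφ => ?_⟩
    · rw [LCSheaf.resL_apply, P.E.res_res, ← P.E.res_res (hN₀.le.trans inf_le_right) h₀, hu,
        map_zero]
    · refine e.res_F_eq_zero _ hN₁V (fun x hx => ?_) hφ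
      by_cases hxZ : x ∈ Z
      exacts [Or.inr hxZ, Or.inl (hKN ⟨subset_closure hx.1, hxZ⟩)]
  local_k O hO φ hφ := by
    simp only [sub_apply, LCSheaf.IsContinuous.appL_apply,
      ContinuousLinearMap.id_apply]
    rw [map_sub, κ.θ.app_res, hφ, map_zero, sub_zero]

/-- Where `κ` is the identity, the correction `(id - κ) ∘ Φ₀` disappears. -/
theorem res_restrictTransfer_mapAdd {χ κ : P.EndPair U} {hV : V ≤ U} {hZ : Z ≤ U}
    (e : Extension χ hV hZ) (hN : χ.η.IsIdOn N) (hZ' : κ.η.VanishesOn Z')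
    (hU : U ≤ N ⊔ Z') {O : Opens X} (hO : κ.η.IsIdOn O) (hOV : O ≤ V)
    (Φ : P.RO U) (Φ₀ : P.RO V) (u : P.E.obj V) :
    P.F.res hOV ((restrictTransfer e hN hZ' hU).mapAdd Φ Φ₀ u)
      = P.F.res (hOV.trans hV) (Φ (e.E u)) := by
  have hO' := κ.θ_isIdOn hO
  simp only [Transfer.mapAdd, Transfer.map, restrictTransfer, add_apply,
    ContinuousLinearMap.comp_apply, sub_apply, LCSheaf.resL_apply,
    LCSheaf.IsContinuous.appL_apply, ContinuousLinearMap.id_apply]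
  rw [map_add, map_sub, hO'.res_app hV hOV le_rfl, sub_self, add_zero, P.F.res_res,
    hO'.res_app _ _ le_rfl]

theorem res_extendTransfer_mapAdd [T2Space X] [LocallyCompactSpace X] {κ : P.EndPair U}
    {hV : V ≤ U} {hZ : Z ≤ U} (e : Extension κ hV hZ) {O : Opens X} (hO : κ.η.IsIdOn O)
    (hOV : O ≤ V) (Φ : P.RO V) (Φ₀ : P.RO U) (u : P.E.obj U) :
    P.F.res (hOV.trans hV) ((extendTransfer e).mapAdd Φ Φ₀ u)
      = P.F.res hOV (Φ (P.E.res hV u)) := by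
  have hO' := κ.θ_isIdOn hO
  simp only [Transfer.mapAdd, Transfer.map, extendTransfer, add_apply,
    ContinuousLinearMap.comp_apply, sub_apply, LCSheaf.resL_apply,
    LCSheaf.IsContinuous.appL_apply, ContinuousLinearMap.id_apply]
  rw [map_add, map_sub, hO'.res_app _ _ le_rfl, sub_self, add_zero, ← P.F.res_res hOV hV, e.res_F,
    hO'.res_app hV hOV le_rfl]

end

/-- Applied to `χu` and `u`, with `χ` the identity on `V₀`: for small `ε` the cut-off in the
argument is invisible on `V`. -/
theorem ROloc_eventually_eq {U V V₀ : Opens X} {Φ : P.Net U} (h : Φ ∈ P.ROloc U)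
    (hV : RelCompact V V₀) (hV₀ : RelCompact V₀ U) (hVU : V ≤ U) :
    ∀ᶠ ε in toZero, ∀ u u' : P.E.obj U, P.E.res hV₀.le u = P.E.res hV₀.le u' →
      P.F.res hVU (Φ ε u) = P.F.res hVU (Φ ε u') := by
  filter_upwards [h V V₀ hV hV₀ hV₀.le hVU] with ε hε u u' hu
  have := hε (u - u') (by rw [map_sub, hu, sub_self])
  rwa [map_sub, map_sub, sub_eq_zero] at this

/-- The transport of regularization operators as a continuous linear map. -/
def Transfer.mapL {U V : Opens X} (T : P.Transfer U V) : P.RO U →L[ℂ] P.RO V :=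
  (ContinuousLinearMap.postcomp _ T.bF).comp (ContinuousLinearMap.precomp _ T.aE)

theorem Transfer.mapL_eq_mapAdd {U V : Opens X} (T : P.Transfer U V) (Φ : P.RO U) :
    T.mapL Φ = T.mapAdd Φ 0 := by
  ext u
  simp [Transfer.mapL, Transfer.mapAdd, Transfer.map]

/-! ### Restriction of local maps -/

section Restriction

theorem IsBasicLocal.isRestriction_self {U : Opens X} {R : P.RO U → P.F.obj U}
    (hR : IsBasicLocal R) : IsRestriction le_rfl R R := by
  intro W _ hW Φ Φ' hΦ
  refine hR.isLocal W hW Φ Φ' fun u => ?_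
  rw [← hΦ, P.E.res_self]

theorem IsRestriction.add {U V : Opens X} {h : V ≤ U} {R₁ R₂ : P.RO U → P.F.obj U}
    {R₁' R₂' : P.RO V → P.F.obj V} (h₁ : IsRestriction h R₁ R₁') (h₂ : IsRestriction h R₂ R₂') :
    IsRestriction h (R₁ + R₂) (R₁' + R₂') := fun W hWc hW Φ Φ' hΦ => by
  rw [Pi.add_apply, Pi.add_apply, map_add, map_add, h₁ W hWc hW Φ Φ' hΦ, h₂ W hWc hW Φ Φ' hΦ]

theorem IsRestriction.smul {U V : Opens X} {h : V ≤ U} (a : ℂ) {R : P.RO U → P.F.obj U}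
    {R' : P.RO V → P.F.obj V} (hR : IsRestriction h R R') :
    IsRestriction h (a • R) (a • R') := fun W hWc hW Φ Φ' hΦ => by
  rw [Pi.smul_apply, Pi.smul_apply, map_smul, map_smul, hR W hWc hW Φ Φ' hΦ]

variable [T2Space X] [LocallyCompactSpace X]

theorem exists_extendTransfer {U V W : Opens X} (hV : V ≤ U) (hW : RelCompact W V) :
    ∃ T : P.Transfer V U, ∀ (Φ : P.RO V) (Φ₀ : P.RO U) (u : P.E.obj U),
      P.F.res (hW.le.trans hV) (T.mapAdd Φ Φ₀ u) = P.F.res hW.le (Φ (P.E.res hV u)) := by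
  obtain ⟨κ, N, Z, hN, hZ, hNU, hVU, hid, hvan⟩ :=
    exists_cutoff (P := P) hV (awayFrom_le U W) (hW.le_sup_awayFrom U)
  obtain ⟨e⟩ := κ.exists_extension hV hZ hVU hvan
  exact ⟨extendTransfer e, fun Φ Φ₀ u => res_extendTransfer_mapAdd e
    (hid.mono (le_of_le_sup_awayFrom (hW.le.trans hV) hNU)) hW.le Φ Φ₀ u⟩

theorem exists_mapL {U V W : Opens X} (hV : V ≤ U) (hW : RelCompact W V) :
    ∃ L : P.RO V →L[ℂ] P.RO U, ∀ (Φ : P.RO V) (u : P.E.obj U),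
      P.F.res hW.le (Φ (P.E.res hV u)) = P.F.res (hW.le.trans hV) (L Φ u) := by
  obtain ⟨T, hT⟩ := exists_extendTransfer (P := P) hV hW
  exact ⟨T.mapL, fun Φ u => by rw [T.mapL_eq_mapAdd, hT]⟩

/-- On `W ⋐ V` the value must be `R(L Φ)` with `L Φ` from `exists_mapL`. Locality of `R` makes these
sections agree on overlaps, and smoothness passes through the continuous linear `L`. -/
theorem IsBasicLocal.exists_restriction {U V : Opens X} (h : V ≤ U) {R : P.RO U → P.F.obj U}
    (hR : IsBasicLocal R) :
    ∃ R' : P.RO V → P.F.obj V, IsBasicLocal R' ∧ IsRestriction h R R' := by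
  have key : ∀ Φ : P.RO V, ∃ a : P.F.obj V, ∀ (W : Opens X) (hW : W ≤ V) (s : P.F.obj W),
      (RelCompact W V ∧ ∃ Φ' : P.RO U,
        (∀ u, P.F.res hW (Φ (P.E.res h u)) = P.F.res (hW.trans h) (Φ' u)) ∧
        s = P.F.res (hW.trans h) (R Φ')) → P.F.res hW a = s := by
    intro Φ
    refine P.F.isSheaf.exists_glue (fun W hW s => RelCompact W V ∧ ∃ Φ' : P.RO U,
        (∀ u, P.F.res hW (Φ (P.E.res h u)) = P.F.res (hW.trans h) (Φ' u)) ∧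
        s = P.F.res (hW.trans h) (R Φ')) (fun x hx => ?_) ?_
    · obtain ⟨W, hxW, hW⟩ := exists_relCompact_of_mem hx
      obtain ⟨L, hL⟩ := exists_mapL (P := P) h hW
      exact ⟨W, hW.le, _, hxW, hW, L Φ, hL Φ, rfl⟩
    · rintro W W' hW hW' _ _ ⟨-, Φ₁, h₁, rfl⟩ ⟨-, Φ₂, h₂, rfl⟩
      rw [P.F.res_res, P.F.res_res]
      refine hR.isLocal _ _ _ _ fun u => ?_
      rw [← P.F.res_res inf_le_left (hW.trans h), ← h₁, P.F.res_res,
        ← P.F.res_res inf_le_right (hW'.trans h), ← h₂, P.F.res_res]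
  choose R' hR' using key
  have hres : IsRestriction h R R' := fun W hWc hW Φ Φ' hΦ => hR' Φ W hW _ ⟨hWc, Φ', hΦ, rfl⟩
  refine ⟨R', ⟨fun c hc => ?_, fun O hO Φ₁ Φ₂ hΦ => ?_⟩, hres⟩
  · refine P.F.isSmoothCurve_of_locally fun x hx => ?_
    obtain ⟨W, hxW, hW⟩ := exists_relCompact_of_mem hx
    obtain ⟨L, hL⟩ := exists_mapL (P := P) h hW
    refine ⟨W, hW.le, hxW, ?_⟩
    simp_rw [fun t => hres W hW hW.le (c t) (L (c t)) (hL _)]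
    exact (hR.smooth _ (hc.map L)).map (P.F.resL (hW.le.trans h))
  · refine P.F.isSheaf.eq_of_locally fun x hx => ?_
    obtain ⟨W, hxW, hW⟩ := exists_relCompact_of_mem hx
    have hWV := hW.mono hO
    obtain ⟨L, hL⟩ := exists_mapL (P := P) h hWV
    refine ⟨W, hW.le, hxW, ?_⟩
    -- The operator `L Φ₁` is admissible for `Φ₂` too, since `Φ₁` and `Φ₂` agree on `O ⊇ W`.
    rw [P.F.res_res, P.F.res_res, hres W hWV _ Φ₁ (L Φ₁) (hL _),
      hres W hWV _ Φ₂ (L Φ₁) fun u => ?_]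
    rw [← hL]
    exact P.F.res_congr hO hW.le (hΦ _).symm

theorem IsRestriction.eq {U V : Opens X} {h : V ≤ U} {R : P.RO U → P.F.obj U}
    {R₁ R₂ : P.RO V → P.F.obj V} (h₁ : IsRestriction h R R₁) (h₂ : IsRestriction h R R₂) :
    R₁ = R₂ := by
  funext Φ
  refine P.F.isSheaf.eq_of_locally fun x hx => ?_
  obtain ⟨W, hxW, hW⟩ := exists_relCompact_of_mem hx
  obtain ⟨L, hL⟩ := exists_mapL (P := P) h hW
  exact ⟨W, hW.le, hxW, by rw [h₁ W hW _ Φ _ (hL Φ), h₂ W hW _ Φ _ (hL Φ)]⟩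

theorem IsRestriction.res_eq {U V : Opens X} {h : V ≤ U} {R : P.RO U → P.F.obj U}
    {R' : P.RO V → P.F.obj V} (hR' : IsRestriction h R R') {W : Opens X} (hW : W ≤ V)
    {Φ : P.RO V} {Φ' : P.RO U}
    (hΦ : ∀ u, P.F.res hW (Φ (P.E.res h u)) = P.F.res (hW.trans h) (Φ' u)) :
    P.F.res hW (R' Φ) = P.F.res (hW.trans h) (R Φ') := by
  refine P.F.isSheaf.eq_of_locally fun x hx => ?_
  obtain ⟨O, hxO, hO⟩ := exists_relCompact_of_mem hx
  refine ⟨O, hO.le, hxO, ?_⟩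
  rw [P.F.res_res, P.F.res_res]
  refine hR' O (hO.mono hW) _ Φ Φ' fun u => ?_
  rw [← P.F.res_res hO.le hW, hΦ, P.F.res_res]

theorem IsRestriction.trans {U V W : Opens X} {hV : V ≤ U} {hW : W ≤ V} {R : P.RO U → P.F.obj U}
    {R' : P.RO V → P.F.obj V} {R'' : P.RO W → P.F.obj W} (h : IsRestriction hV R R')
    (h' : IsRestriction hW R' R'') : IsRestriction (hW.trans hV) R R'' := by
  intro O hO hOW Φ Φ' hΦ
  obtain ⟨L, hL⟩ := exists_mapL (P := P) hW hO
  rw [h' O hO hOW Φ (L Φ) (hL Φ)]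
  refine h O (hO.mono hW) _ _ _ fun u => ?_
  rw [← hL, P.E.res_res]
  exact hΦ u

end Restriction

/-! ### Bounds along test objects -/

/-- A class of nets of real numbers that is stable under sums and domination. -/
structure IsBoundClass (B : Set (Param → ℝ)) : Prop where
  zero_mem : 0 ∈ B
  add_mem : ∀ {f g : Param → ℝ}, f ∈ B → g ∈ B → f + g ∈ B
  of_isBigO : ∀ {f g : Param → ℝ}, g ∈ B → f =O[toZero] g → f ∈ B

theorem IsBoundClass.sum_mem {B : Set (Param → ℝ)} (hB : IsBoundClass B) {ι : Type*}
    (J : Finset ι) {f : ι → Param → ℝ} (hf : ∀ i ∈ J, f i ∈ B) : ∑ i ∈ J, f i ∈ B :=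
  Finset.sum_induction _ (· ∈ B) (fun _ _ => hB.add_mem) hB.zero_mem hf

theorem IsBoundClass.of_le {B : Set (Param → ℝ)} (hB : IsBoundClass B) {f g : Param → ℝ}
    (hg : g ∈ B) (hf : ∀ ε, 0 ≤ f ε) (h : ∀ᶠ ε in toZero, f ε ≤ g ε) : f ∈ B :=
  hB.of_isBigO hg <| IsBigO.of_bound 1 <| h.mono fun ε hε => by
    rw [one_mul, Real.norm_of_nonneg (hf ε)]
    exact hε.trans (le_abs_self _)

theorem IsBoundClass.const_mul_mem {B : Set (Param → ℝ)} (hB : IsBoundClass B) {f : Param → ℝ}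
    (hf : f ∈ B) (a : ℝ) : (fun ε => a * f ε) ∈ B :=
  hB.of_isBigO hf (isBigO_const_mul_self a f _)

variable (S) in
/-- The nets of moderate growth. -/
def moderateClass : Set (Param → ℝ) := {f | ∃ m ∈ S.A, BigO f m}

variable (S) in
/-- The negligible nets. -/
def negligibleClass : Set (Param → ℝ) := {f | ∀ m ∈ S.I, BigO f m}

variable (S) in
theorem isBoundClass_moderateClass : IsBoundClass (moderateClass S) where
  zero_mem := by
    obtain ⟨l, hl, -⟩ := S.A_liminf
    exact ⟨l, hl, isBigO_zero _ _⟩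
  add_mem := by
    rintro f g ⟨l, hl, hf⟩ ⟨m, hm, hg⟩
    obtain ⟨n, hn, hln, hmn⟩ := S.exists_bigO_add hl hm
    exact ⟨n, hn, (IsBigO.trans hf hln).add (IsBigO.trans hg hmn)⟩
  of_isBigO := by
    rintro f g ⟨l, hl, hg⟩ hfg
    exact ⟨l, hl, hfg.trans hg⟩

variable (S) in
theorem isBoundClass_negligibleClass : IsBoundClass (negligibleClass S) where
  zero_mem := fun _ _ => isBigO_zero _ _
  add_mem := fun hf hg m hm => (hf m hm).add (hg m hm)
  of_isBigO := fun hg hfg m hm => hfg.trans (hg m hm)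

/-- The directional derivatives of `R` along test objects have bounds in the class `B`. -/
def DirBound (S : ScalePair) (B : Set (Param → ℝ)) {U : Opens X} (R : P.RO U → P.F.obj U) : Prop :=
  ∀ p : Seminorm ℂ (P.F.obj U), Continuous p → ∀ l : ℕ, ∀ Φ ∈ P.TOloc S U, ∀ Ψ ∈ P.TOzloc S U,
    (fun ε => p (dirDeriv l R (Φ ε) (Ψ ε))) ∈ B

/-- The diagonal gives one direction. For the other, the polarization formula involves only partial
sums of the `Ψ j`, which are again `0`-test objects. The class `B` is abstract so that moderate and
negligible bounds share all later arguments. -/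
theorem forall_differential_iff {B : Set (Param → ℝ)} (hB : IsBoundClass B) {U : Opens X}
    {R : P.RO U → P.F.obj U} (hR : IsSmoothMap R) :
    (∀ p : Seminorm ℂ (P.F.obj U), Continuous p → ∀ (l : ℕ), ∀ Φ ∈ P.TOloc S U,
      ∀ Ψ : Fin l → P.Net U, (∀ j, Ψ j ∈ P.TOzloc S U) →
        (fun ε => p (differential l R (Φ ε) fun j => Ψ j ε)) ∈ B) ↔ DirBound S B R := by
  refine ⟨fun h p hp l Φ hΦ Ψ hΨ => ?_, fun h p hp l Φ hΦ Ψ hΨ => ?_⟩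
  · simpa only [differential_diag hR] using h p hp l Φ hΦ (fun _ => Ψ) fun _ => hΨ
  · have hS := fun J : Finset (Fin l) => h p hp l Φ hΦ _ (TOzloc_sum J hΨ)
    refine hB.of_le (hB.const_mul_mem (hB.sum_mem Finset.univ fun J _ => hS J)
      ‖((l.factorial : ℂ)⁻¹)‖) (fun _ => apply_nonneg _ _) (Eventually.of_forall fun ε => ?_)
    rw [differential_eq_sum_dirDeriv, map_smul_eq_mul, Finset.sum_apply]
    refine mul_le_mul_of_nonneg_left ?_ (norm_nonneg _)
    refine (Finset.le_sum_of_subadditive p (map_zero p).le (map_add_le_add p) _ _).trans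
      (Finset.sum_le_sum fun J _ => ?_)
    rw [map_smul_eq_mul]
    simp

theorem isModerate_iff {U : Opens X} {R : P.RO U → P.F.obj U} (hR : IsSmoothMap R) :
    IsModerate S R ↔ DirBound S (moderateClass S) R :=
  forall_differential_iff (isBoundClass_moderateClass S) hR

theorem isNegligible_iff {U : Opens X} {R : P.RO U → P.F.obj U} (hR : IsSmoothMap R) :
    IsNegligible S R ↔ DirBound S (negligibleClass S) R :=
  forall_differential_iff (isBoundClass_negligibleClass S) hR

theorem DirBound.zero {B : Set (Param → ℝ)} (hB : IsBoundClass B) {U : Opens X} :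
    DirBound S B (fun _ => 0 : P.RO U → P.F.obj U) := by
  intro p hp l Φ _ Ψ _
  have : ∀ ε, dirDeriv l (fun _ => 0 : P.RO U → P.F.obj U) (Φ ε) (Ψ ε) = 0 := fun ε =>
    dirDeriv_congr (f := fun _ => 0) (f' := fun _ => 0) (IsBasicLocal.zero (P := P)).smooth
      (IsBasicLocal.zero (P := P)).smooth (ContinuousLinearMap.id ℂ (P.F.obj U))
      (0 : P.F.obj U →L[ℂ] P.F.obj U) (x := Φ ε) (v := Ψ ε) (x' := Φ ε) (v' := Ψ ε) (fun _ => rfl) l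
  simp only [this, map_zero]
  exact hB.zero_mem

theorem DirBound.clm_comp {B : Set (Param → ℝ)} {U : Opens X} {R : P.RO U → P.F.obj U}
    (h : DirBound S B R) (hR : IsSmoothMap R) (T : P.F.obj U →L[ℂ] P.F.obj U) :
    DirBound S B fun Φ => T (R Φ) := by
  intro p hp l Φ hΦ Ψ hΨ
  have := h (p.comp T.toLinearMap) (hp.comp T.continuous) l Φ hΦ Ψ hΨ
  convert this using 2 with ε
  exact congrArg p (dirDeriv_congr (hR.clm_comp T) hR (ContinuousLinearMap.id ℂ _) T
    (fun _ => rfl) l)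

/-- Bounds may be verified locally, after transport of the test objects. -/
theorem DirBound.of_locally {B : Set (Param → ℝ)} (hB : IsBoundClass B) {U : Opens X}
    {R : P.RO U → P.F.obj U} (hR : IsSmoothMap R)
    (h : ∀ x ∈ U, ∃ (W : Opens X) (hW : W ≤ U) (V : Opens X) (R' : P.RO V → P.F.obj V)
      (τ : P.F.obj V →L[ℂ] P.F.obj W), x ∈ W ∧ IsSmoothMap R' ∧ DirBound S B R' ∧
      ∀ Φ ∈ P.TOloc S U, ∀ Ψ ∈ P.TOzloc S U, ∃ Φ' ∈ P.TOloc S V, ∃ Ψ' ∈ P.TOzloc S V,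
        ∀ᶠ ε in toZero, ∀ t : ℂ,
          P.F.res hW (R (Φ ε + t • Ψ ε)) = τ (R' (Φ' ε + t • Ψ' ε))) :
    DirBound S B R := by
  have h' : ∀ x : U, _ := fun x => h x x.2
  choose W hW V R' τ hxW hR' hbd hτ using h'
  intro p hp l Φ hΦ Ψ hΨ
  -- Only finitely many points are needed to dominate `p`, so the corresponding eventual identities
  -- hold simultaneously for small `ε`.
  obtain ⟨J, q, hq, hpq⟩ := P.F.exists_seminorm_le_sum W hW hxW p hp
  choose Φ' hΦ' Ψ' hΨ' he using fun x => hτ x Φ hΦ Ψ hΨ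
  refine hB.of_le (hB.sum_mem J fun x _ => hbd x ((q x).comp (τ x).toLinearMap)
    ((hq x).comp (τ x).continuous) l (Φ' x) (hΦ' x) (Ψ' x) (hΨ' x)) (fun _ => apply_nonneg _ _) ?_
  filter_upwards [(Filter.eventually_all_finset J).2 fun x _ => he x] with ε hε
  rw [Finset.sum_apply]
  refine (hpq _).trans (Finset.sum_le_sum fun x hx => le_of_eq (congrArg (q x) ?_))
  exact dirDeriv_congr hR (hR' x) (P.F.resL (hW x)) (τ x) (fun t => hε x hx t) l

section Local

variable [T2Space X] [LocallyCompactSpace X]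

/-- Test objects on `V` are extended to `U`, completed by a fixed test object `Φ₀` on `U`. On `W ⋐
V` the extension agrees with the original net, so `R'` there is a value of `R`, for every `ε`. -/
theorem DirBound.restriction {B : Set (Param → ℝ)} (hB : IsBoundClass B) {U V : Opens X}
    (hU : (P.TOloc S U).Nonempty) {h : V ≤ U} {R : P.RO U → P.F.obj U} {R' : P.RO V → P.F.obj V}
    (hR : IsSmoothMap R) (hR' : IsSmoothMap R') (hres : IsRestriction h R R')
    (hbd : DirBound S B R) : DirBound S B R' := by
  obtain ⟨Φ₀, hΦ₀⟩ := hU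
  refine DirBound.of_locally hB hR' fun x hx => ?_
  obtain ⟨W, hxW, hW⟩ := exists_relCompact_of_mem hx
  obtain ⟨T, hT⟩ := exists_extendTransfer (P := P) h hW
  refine ⟨W, hW.le, U, R, P.F.resL (hW.le.trans h), hxW, hR, hbd, fun Φ hΦ Ψ hΨ =>
    ⟨_, T.mapAdd_mem_TOloc hΦ hΦ₀, _, T.map_mem_TOzloc hΨ, Eventually.of_forall fun ε t => ?_⟩⟩
  rw [T.mapAdd_add_smul_map]
  exact hres W hW _ _ _ fun u => (hT _ _ u).symm

/-- Here test objects go from `U` to `V`, with `W ⋐ W₀ ⋐ V`: `χ` is the identity on `W₀` and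
supported in `V`, `κ` is the identity on `W` and supported where `χ = id`. The transported net is
`Φ(χu)` on `W`, which equals `Φ(u)` only for small `ε`, by the localizing property. -/
theorem DirBound.of_restrictions {B : Set (Param → ℝ)} (hB : IsBoundClass B) {U : Opens X}
    (hTO : ∀ V : Opens X, (P.TOloc S V).Nonempty) {R : P.RO U → P.F.obj U}
    (hR : IsSmoothMap R)
    (hloc : ∀ x ∈ U, ∃ (V : Opens X) (hV : V ≤ U) (R' : P.RO V → P.F.obj V), x ∈ V ∧
      IsSmoothMap R' ∧ IsRestriction hV R R' ∧ DirBound S B R') : DirBound S B R := by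
  refine DirBound.of_locally hB hR fun x hx => ?_
  obtain ⟨V, hV, R', hxV, hR', hres, hbd⟩ := hloc x hx
  obtain ⟨Φ₀, hΦ₀⟩ := hTO V
  obtain ⟨W, hxW, hW⟩ := exists_relCompact_of_mem hxV
  obtain ⟨W₀, hWW₀, hW₀⟩ := hW.exists_between
  obtain ⟨χ, N, Z, hN, hZ, hNU, hVU, hid, hvan⟩ :=
    exists_cutoff (P := P) hV (awayFrom_le U W₀) (hW₀.le_sup_awayFrom U)
  obtain ⟨e⟩ := χ.exists_extension hV hZ hVU hvan
  have hW₀N : W₀ ≤ N := le_of_le_sup_awayFrom (hW₀.le.trans hV) hNU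
  obtain ⟨κ, N', Z', hN', hZ', hNU', hVU', hid', hvan'⟩ :=
    exists_cutoff (P := P) hN (awayFrom_le U W) ((hWW₀.mono hW₀N).le_sup_awayFrom U)
  have hidW : κ.η.IsIdOn W := hid'.mono (le_of_le_sup_awayFrom (hW.le.trans hV) hNU')
  refine ⟨W, hW.le.trans hV, V, R', P.F.resL hW.le, hxW, hR', hbd, fun Φ hΦ Ψ hΨ =>
    ⟨_, (restrictTransfer e hid hvan' hVU').mapAdd_mem_TOloc hΦ hΦ₀, _,
      (restrictTransfer e hid hvan' hVU').map_mem_TOzloc hΨ, ?_⟩⟩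
  filter_upwards [ROloc_eventually_eq hΦ.2 hWW₀ (hW₀.mono hV) (hW.le.trans hV),
    ROloc_eventually_eq hΨ.2 hWW₀ (hW₀.mono hV) (hW.le.trans hV)] with ε hε hε' t
  rw [Transfer.mapAdd_add_smul_map]
  refine (hres W hW hW.le _ _ fun u => ?_).symm
  rw [res_restrictTransfer_mapAdd e hid hvan' hVU' hidW, e.E_res]
  have hu : P.E.res (hW₀.mono hV).le (χ.η.app U le_rfl u) = P.E.res (hW₀.mono hV).le u :=
    hid.res_app _ _ hW₀N u
  rw [add_apply, add_apply, smul_apply, smul_apply, map_add, map_add, map_smul, map_smul,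
    hε _ _ hu, hε' _ _ hu]

end Local

/-! ### The quotient presheaf and its separatedness -/

theorem cls_eq_iff {U : Opens X} {R R' : P.Mloc S U} :
    cls R = cls R' ↔ IsNegligible S (R - R').1 := by
  refine (Submodule.Quotient.eq _).trans ⟨fun h => h.2, fun h => ⟨?_, h⟩⟩
  exact (R - R').2.1

theorem exists_cls_eq {U : Opens X} (g : P.Gloc S U) : ∃ R : P.Mloc S U, cls R = g :=
  Submodule.mkQ_surjective _ g

theorem cls_sum {U : Opens X} {ι : Type*} (J : Finset ι) (R : ι → P.Mloc S U) :
    cls (∑ i ∈ J, R i) = ∑ i ∈ J, cls (R i) :=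
  map_sum ((P.Nloc S U).submoduleOf (P.Mloc S U)).mkQ R J

theorem Mloc_sum_apply {U : Opens X} {ι : Type*} (J : Finset ι) (R : ι → P.Mloc S U)
    (Φ : P.RO U) : (∑ i ∈ J, R i).1 Φ = ∑ i ∈ J, (R i).1 Φ := by
  have : (∑ i ∈ J, R i).1 = ∑ i ∈ J, (R i).1 := map_sum (P.Mloc S U).subtype R J
  rw [this, Finset.sum_apply]

section Presheaf

variable [T2Space X] [LocallyCompactSpace X]

theorem exists_restriction_mem_Mloc (hTO : ∀ U : Opens X, (P.TOloc S U).Nonempty)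
    {U V : Opens X} (h : V ≤ U) (R : P.Mloc S U) :
    ∃ R' : P.Mloc S V, IsRestriction h R.1 R'.1 := by
  obtain ⟨R', hR', hres⟩ := R.2.1.exists_restriction h
  refine ⟨⟨R', hR', (isModerate_iff hR'.smooth).2 ?_⟩, hres⟩
  exact DirBound.restriction (isBoundClass_moderateClass S) (hTO U) R.2.1.smooth hR'.smooth hres
    ((isModerate_iff R.2.1.smooth).1 R.2.2)

/-- The restriction of moderate local maps. -/
def resM (hTO : ∀ U : Opens X, (P.TOloc S U).Nonempty) {U V : Opens X} (h : V ≤ U) :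
    P.Mloc S U →ₗ[ℂ] P.Mloc S V where
  toFun R := (exists_restriction_mem_Mloc hTO h R).choose
  map_add' R₁ R₂ := Subtype.ext <|
    (exists_restriction_mem_Mloc hTO h (R₁ + R₂)).choose_spec.eq <|
      (exists_restriction_mem_Mloc hTO h R₁).choose_spec.add
        (exists_restriction_mem_Mloc hTO h R₂).choose_spec
  map_smul' a R := Subtype.ext <|
    (exists_restriction_mem_Mloc hTO h (a • R)).choose_spec.eq <|
      (exists_restriction_mem_Mloc hTO h R).choose_spec.smul a

theorem isRestriction_resM (hTO : ∀ U : Opens X, (P.TOloc S U).Nonempty) {U V : Opens X}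
    (h : V ≤ U) (R : P.Mloc S U) : IsRestriction h R.1 (resM hTO h R).1 :=
  (exists_restriction_mem_Mloc hTO h R).choose_spec

theorem resM_mem_Nloc (hTO : ∀ U : Opens X, (P.TOloc S U).Nonempty) {U V : Opens X}
    (h : V ≤ U) (R : P.Mloc S U) (hR : R.1 ∈ P.Nloc S U) : (resM hTO h R).1 ∈ P.Nloc S V :=
  ⟨(resM hTO h R).2.1, (isNegligible_iff (resM hTO h R).2.1.smooth).2 <|
    DirBound.restriction (isBoundClass_negligibleClass S) (hTO U) R.2.1.smooth
      (resM hTO h R).2.1.smooth (isRestriction_resM hTO h R)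
      ((isNegligible_iff R.2.1.smooth).1 hR.2)⟩

/-- The restriction maps of `𝒢_loc`. -/
def resG (hTO : ∀ U : Opens X, (P.TOloc S U).Nonempty) {U V : Opens X} (h : V ≤ U) :
    P.Gloc S U →ₗ[ℂ] P.Gloc S V :=
  Submodule.mapQ _ _ (resM hTO h) fun R hR => resM_mem_Nloc hTO h R hR

theorem resG_cls (hTO : ∀ U : Opens X, (P.TOloc S U).Nonempty) {U V : Opens X} (h : V ≤ U)
    {R : P.Mloc S U} {R' : P.Mloc S V} (hR : IsRestriction h R.1 R'.1) :
    resG hTO h (cls R) = cls R' := by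
  have : resM hTO h R = R' := Subtype.ext ((isRestriction_resM hTO h R).eq hR)
  rw [← this]
  rfl

/-- The presheaf structure of `𝒢_loc`. -/
def glocPresheaf (hTO : ∀ U : Opens X, (P.TOloc S U).Nonempty) : P.GlocPresheaf S where
  res h := resG hTO h
  res_self U g := by
    obtain ⟨R, rfl⟩ := exists_cls_eq g
    exact resG_cls hTO _ R.2.1.isRestriction_self
  res_res hWV hVU g := by
    obtain ⟨R, rfl⟩ := exists_cls_eq g
    rw [resG_cls hTO hVU (isRestriction_resM hTO hVU R),
      resG_cls hTO hWV (isRestriction_resM hTO hWV _)]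
    exact (resG_cls hTO _ ((isRestriction_resM hTO hVU R).trans
      (isRestriction_resM hTO hWV _))).symm
  res_mk h R := ⟨resM hTO h R, isRestriction_resM hTO h R,
    resG_cls hTO h (isRestriction_resM hTO h R)⟩

namespace GlocPresheaf

theorem res_cls (G : P.GlocPresheaf S) {U V : Opens X} (h : V ≤ U)
    {R : P.Mloc S U} {R' : P.Mloc S V} (hR : IsRestriction h R.1 R'.1) :
    G.res h (cls R) = cls R' := by
  obtain ⟨R'', hR'', he⟩ := G.res_mk h R
  rw [he, Subtype.ext (hR''.eq hR)]

theorem res_eq_res (G G' : P.GlocPresheaf S) {U V : Opens X} (h : V ≤ U) :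
    G.res h = G'.res h := by
  refine LinearMap.ext fun g => ?_
  obtain ⟨R, rfl⟩ := exists_cls_eq g
  obtain ⟨R', hR', he⟩ := G.res_mk h R
  rw [he, G'.res_cls h hR']

theorem eq (G G' : P.GlocPresheaf S) : G = G' := by
  have h : @G.res = @G'.res := by
    funext U V h
    exact G.res_eq_res G' h
  cases G
  cases G'
  simpa using h

/-- The defining condition of a restriction to `V` involves only the values `R(Φ)|_V`, so a
restriction of `R` is also one of `R'`. -/
theorem res_cls_congr (G : P.GlocPresheaf S) {U V : Opens X} (h : V ≤ U) {R R' : P.Mloc S U}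
    (hR : ∀ Φ, P.F.res h (R.1 Φ) = P.F.res h (R'.1 Φ)) : G.res h (cls R) = G.res h (cls R') := by
  obtain ⟨R'', hR'', he⟩ := G.res_mk h R
  rw [he, G.res_cls h (R' := R'')]
  intro W hWV hW Φ Φ' hΦ
  rw [hR'' W hWV hW Φ Φ' hΦ]
  exact P.F.res_congr h hW (hR Φ')

/-- Negligibility is local by `DirBound.of_restrictions`; it is applied to the difference of two
representatives. -/
theorem eq_of_locally (G : P.GlocPresheaf S) (hTO : ∀ U : Opens X, (P.TOloc S U).Nonempty)
    {U : Opens X} {a b : P.Gloc S U}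
    (h : ∀ x ∈ U, ∃ (W : Opens X) (hW : W ≤ U), x ∈ W ∧ G.res hW a = G.res hW b) : a = b := by
  obtain ⟨R, rfl⟩ := exists_cls_eq a
  obtain ⟨R', rfl⟩ := exists_cls_eq b
  rw [cls_eq_iff, isNegligible_iff (R - R').2.1.smooth]
  refine DirBound.of_restrictions (isBoundClass_negligibleClass S) hTO (R - R').2.1.smooth
    fun x hx => ?_
  obtain ⟨W, hW, hxW, he⟩ := h x hx
  have hres := isRestriction_resM hTO hW
  rw [G.res_cls hW (hres R), G.res_cls hW (hres R'), cls_eq_iff, ← map_sub,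
    isNegligible_iff (resM hTO hW (R - R')).2.1.smooth] at he
  exact ⟨W, hW, _, hxW, (resM hTO hW (R - R')).2.1.smooth, hres (R - R'), he⟩

end GlocPresheaf

end Presheaf

/-! ### Endomorphisms -/

/-- Composition of moderate local maps with an endomorphism of `F|_U`. -/
def endM {U : Opens X} {T : P.F.EndOn U} (hT : LCSheaf.IsContinuous T) {V : Opens X}
    (hV : V ≤ U) : P.Mloc S V →ₗ[ℂ] P.Mloc S V where
  toFun R := ⟨fun Φ => T.app V hV (R.1 Φ),
    ⟨R.2.1.smooth.clm_comp (hT.appL hV), fun W hW Φ₁ Φ₂ hΦ => by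
      rw [T.app_res, T.app_res, R.2.1.isLocal W hW Φ₁ Φ₂ hΦ]⟩,
    (isModerate_iff (R.2.1.smooth.clm_comp (hT.appL hV))).2
      (((isModerate_iff R.2.1.smooth).1 R.2.2).clm_comp R.2.1.smooth (hT.appL hV))⟩
  map_add' R R' := Subtype.ext <| funext fun Φ => map_add (T.app V hV) (R.1 Φ) (R'.1 Φ)
  map_smul' a R := Subtype.ext <| funext fun Φ => map_smul (T.app V hV) a (R.1 Φ)

theorem endM_apply {U : Opens X} {T : P.F.EndOn U} (hT : LCSheaf.IsContinuous T) {V : Opens X}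
    (hV : V ≤ U) (R : P.Mloc S V) (Φ : P.RO V) : (endM hT hV R).1 Φ = T.app V hV (R.1 Φ) := rfl

theorem endM_mem_Nloc {U : Opens X} {T : P.F.EndOn U} (hT : LCSheaf.IsContinuous T) {V : Opens X}
    (hV : V ≤ U) (R : P.Mloc S V) (hR : R.1 ∈ P.Nloc S V) : (endM hT hV R).1 ∈ P.Nloc S V :=
  ⟨(endM hT hV R).2.1, (isNegligible_iff (endM hT hV R).2.1.smooth).2
    (((isNegligible_iff R.2.1.smooth).1 hR.2).clm_comp R.2.1.smooth (hT.appL hV))⟩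

theorem IsRestriction.endM {U : Opens X} {T : P.F.EndOn U} (hT : LCSheaf.IsContinuous T)
    {V W : Opens X} {hV : V ≤ U} {hW : W ≤ V} {R : P.Mloc S V} {R' : P.Mloc S W}
    (h : IsRestriction hW R.1 R'.1) :
    IsRestriction hW (endM hT hV R).1 (endM hT (hW.trans hV) R').1 := by
  intro O hOc hO Φ Φ' hΦ
  rw [endM_apply, endM_apply, T.app_res, T.app_res, h O hOc hO Φ Φ' hΦ]

/-- The endomorphism of `𝒢_loc(V)` induced by an endomorphism of `F|_U`. -/
def endG {U : Opens X} {T : P.F.EndOn U} (hT : LCSheaf.IsContinuous T) {V : Opens X}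
    (hV : V ≤ U) : P.Gloc S V →ₗ[ℂ] P.Gloc S V :=
  Submodule.mapQ _ _ (endM hT hV) fun R hR => endM_mem_Nloc hT hV R hR

theorem endG_cls {U : Opens X} {T : P.F.EndOn U} (hT : LCSheaf.IsContinuous T) {V : Opens X}
    (hV : V ≤ U) (R : P.Mloc S V) : endG hT hV (cls R) = cls (endM hT hV R) := rfl

namespace GlocPresheaf

variable [T2Space X] [LocallyCompactSpace X] (G : P.GlocPresheaf S)

/-- The endomorphism of `𝒢_loc|_U` induced by an endomorphism of `F|_U`. -/
def endHom {U : Opens X} {T : P.F.EndOn U} (hT : LCSheaf.IsContinuous T) :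
    VPresheaf.Hom G.toVPresheaf G.toVPresheaf U where
  app V hV := endG hT hV
  app_res {V W} hV hW g := by
    change G.res hW (endG hT hV g) = endG hT (hW.trans hV) (G.res hW g)
    obtain ⟨R, rfl⟩ := exists_cls_eq g
    obtain ⟨R', hR', he⟩ := G.res_mk hW R
    rw [he, endG_cls, endG_cls, G.res_cls hW (hR'.endM hT)]

theorem endHom_app_cls {U : Opens X} {T : P.F.EndOn U} (hT : LCSheaf.IsContinuous T)
    {V : Opens X} (hV : V ≤ U) (R : P.Mloc S V) :
    (G.endHom hT).app V hV (cls R) = cls (endM hT hV R) := rfl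

theorem endHom_isIdOn {U W : Opens X} {T : P.F.EndOn U} (hT : LCSheaf.IsContinuous T)
    (h : T.IsIdOn W) : (G.endHom hT).IsIdOn W := by
  intro V hV hVW g
  obtain ⟨R, rfl⟩ := exists_cls_eq g
  rw [endHom_app_cls]
  exact congrArg cls (Subtype.ext (funext fun Φ => h V hV hVW _))

theorem endHom_vanishesOn {U W : Opens X} {T : P.F.EndOn U} (hT : LCSheaf.IsContinuous T)
    (h : T.VanishesOn W) : (G.endHom hT).VanishesOn W := by
  intro V hV hVW g
  obtain ⟨R, rfl⟩ := exists_cls_eq g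
  rw [endHom_app_cls]
  exact congrArg cls (Subtype.ext (funext fun Φ => h V hV hVW _) : endM hT hV R = 0)

theorem sum_endHom_app {U : Opens X} {ι : Type*} {T : ι → P.F.EndOn U}
    (hT : ∀ i, LCSheaf.IsContinuous (T i)) {V : Opens X} (hV : V ≤ U) (J : Finset ι)
    (h : ∀ φ, ∑ i ∈ J, (T i).app V hV φ = φ) (g : P.Gloc S V) :
    ∑ i ∈ J, (G.endHom (hT i)).app V hV g = g := by
  obtain ⟨R, rfl⟩ := exists_cls_eq g
  refine (cls_sum J fun i => endM (hT i) hV R).symm.trans (congrArg cls (Subtype.ext ?_))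
  funext Φ
  rw [Mloc_sum_apply]
  exact h _

end GlocPresheaf

/-! ### Extension by cut-off, and the sheaf property -/

theorem EndPair.app_θ_congr {U V N Z : Opens X} (κ : P.EndPair U) (hZ : κ.η.VanishesOn Z)
    (hU : U ≤ N ⊔ Z) (hV : V ≤ U) {a b : P.F.obj V}
    (h : P.F.res (inf_le_left : V ⊓ N ≤ V) a = P.F.res (inf_le_left : V ⊓ N ≤ V) b) :
    κ.θ.app V hV a = κ.θ.app V hV b := by
  refine P.F.isSheaf.eq_of_sup (inf_le_left : V ⊓ N ≤ V) (inf_le_left : V ⊓ Z ≤ V)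
    (by rw [← inf_sup_left]; exact le_inf le_rfl (hV.trans hU)) ?_ ?_
  · rw [κ.θ.app_res, κ.θ.app_res, h]
  · rw [(κ.θ_vanishesOn hZ).res_app hV _ inf_le_right,
      (κ.θ_vanishesOn hZ).res_app hV _ inf_le_right]

section

variable [T2Space X] [LocallyCompactSpace X]

/-- Extension by cut-off of moderate local maps from `V` to `U`. -/
theorem exists_extension_Mloc (G : P.GlocPresheaf S)
    (hTO : ∀ U : Opens X, (P.TOloc S U).Nonempty) {U V Z : Opens X} (hV : V ≤ U) (hZ : Z ≤ U)
    (hU : U ≤ V ⊔ Z) (κ : P.EndPair U) (hκ : κ.η.VanishesOn Z) (R : P.Mloc S V) :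
    ∃ T : P.Mloc S U, (∀ Φ, P.F.res hZ (T.1 Φ) = 0) ∧
      G.res hV (cls T) = endG κ.contF hV (cls R) := by
  obtain ⟨f⟩ := κ.exists_extension hV hZ hU hκ
  -- `χ` is supported in `V` and is the identity on `N`, where `N` and `Z` cover `U`; `κ₂` is
  -- supported in `N` and is the identity on `N'`, where `N'` and `Z` cover `U`. Thus both are the
  -- identity off `Z`, so wherever `κ` can be nonzero.
  obtain ⟨χ, N, Z₁, hN, hZ₁, hNU, hVU, hid, hvan⟩ := exists_cutoff (P := P) hV hZ hU
  obtain ⟨e⟩ := χ.exists_extension hV hZ₁ hVU hvan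
  obtain ⟨κ₂, N', Z₂, hN', hZ₂, hNU', hVU', hid', hvan'⟩ := exists_cutoff (P := P) hN hZ hNU
  -- The extended map is `Φ ↦ κ · R(L Φ)`, where `L Φ` sends `u` to `Φ(χu)|_V`. It is smooth since
  -- `L` is continuous and linear.
  obtain ⟨L, hL⟩ : ∃ L : P.RO U →L[ℂ] P.RO V, ∀ Φ u, L Φ u = P.F.res hV (Φ (e.E u)) :=
    ⟨(ContinuousLinearMap.postcomp _ (P.F.resL hV)).comp (ContinuousLinearMap.precomp _ e.E),
      fun _ _ => rfl⟩
  have hsm : IsSmoothMap fun Φ => f.F (R.1 (L Φ)) := (R.2.1.smooth.comp_clm L).clm_comp f.F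
  have hbasic : IsBasicLocal fun Φ => f.F (R.1 (L Φ)) := by
    refine ⟨hsm, fun O hO Φ₁ Φ₂ hΦ => ?_⟩
    rw [← sub_eq_zero, ← map_sub, ← map_sub]
    refine f.res_F_eq_zero hO (inf_le_right : O ⊓ V ≤ V) le_sup_left ?_
    rw [map_sub, sub_eq_zero]
    refine R.2.1.isLocal _ _ _ _ fun u => ?_
    rw [hL, hL, P.F.res_res, P.F.res_res]
    exact P.F.res_congr hO inf_le_left (hΦ _)
  have hmod : DirBound S (moderateClass S) fun Φ => f.F (R.1 (L Φ)) := by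
    have hRm := (isModerate_iff R.2.1.smooth).1 R.2.2
    refine DirBound.of_locally (isBoundClass_moderateClass S) hsm fun x hx => ?_
    rcases hU hx with hxV | hxZ
    · obtain ⟨Φ₀, hΦ₀⟩ := hTO V
      refine ⟨V, hV, V, R.1, κ.contF.appL hV, hxV, R.2.1.smooth, hRm, fun Φ hΦ Ψ hΨ =>
        ⟨_, (restrictTransfer e hid hvan' hVU').mapAdd_mem_TOloc hΦ hΦ₀, _,
          (restrictTransfer e hid hvan' hVU').map_mem_TOzloc hΨ,
          Eventually.of_forall fun ε t => ?_⟩⟩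
      rw [Transfer.mapAdd_add_smul_map, f.res_F]
      -- `L Φ` itself need not come from a test object, but it agrees on `V ⊓ N'` with the
      -- transported one, and `κ` sees only that part because it vanishes on `Z`.
      refine κ.app_θ_congr hκ hNU' hV (R.2.1.isLocal _ _ _ _ fun u => ?_)
      rw [hL, P.F.res_res, res_restrictTransfer_mapAdd e hid hvan' hVU' (hid'.mono inf_le_right)]
    · refine ⟨Z, hZ, U, fun _ => 0, 0, hxZ, IsBasicLocal.zero.smooth,
        DirBound.zero (isBoundClass_moderateClass S), fun Φ hΦ Ψ hΨ =>
        ⟨Φ, hΦ, Ψ, hΨ, Eventually.of_forall fun ε t => ?_⟩⟩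
      exact f.res_F_zero _
  refine ⟨⟨_, hbasic, (isModerate_iff hsm).2 hmod⟩, fun Φ => f.res_F_zero _, ?_⟩
  obtain ⟨T', hT', he⟩ := G.res_mk hV ⟨_, hbasic, (isModerate_iff hsm).2 hmod⟩
  rw [he, endG_cls, cls_eq_iff, isNegligible_iff (T' - endM κ.contF hV R).2.1.smooth]
  refine DirBound.of_locally (isBoundClass_negligibleClass S)
    (T' - endM κ.contF hV R).2.1.smooth fun x hx => ?_
  have hsub : ∀ (Φ : P.RO V), (T' - endM κ.contF hV R).1 Φ = T'.1 Φ - κ.θ.app V hV (R.1 Φ) :=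
    fun Φ => rfl
  -- The difference is compared with the zero map. Near points of `N` it vanishes for small `ε`,
  -- when the localizing property gives `Φ(χu) = Φ(u)` and `Ψ(χu) = Ψ(u)`; on `Z` both terms are
  -- zero.
  rcases hNU (hV hx) with hxN | hxZ
  · obtain ⟨W, hxW, hW⟩ := exists_relCompact_of_mem (U := V ⊓ N) ⟨hx, hxN⟩
    obtain ⟨W₀, hWW₀, hW₀⟩ := hW.exists_between
    have hWV : RelCompact W V := hW.mono inf_le_left
    have hW₀V : RelCompact W₀ V := hW₀.mono inf_le_left
    obtain ⟨L', hL'⟩ := exists_mapL (P := P) hV hWV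
    refine ⟨W, hWV.le, V, fun _ => 0, 0, hxW, IsBasicLocal.zero.smooth,
      DirBound.zero (isBoundClass_negligibleClass S), fun Φ hΦ Ψ hΨ => ⟨Φ, hΦ, Ψ, hΨ, ?_⟩⟩
    filter_upwards [ROloc_eventually_eq hΦ.2 hWW₀ hW₀V hWV.le,
      ROloc_eventually_eq hΨ.2 hWW₀ hW₀V hWV.le] with ε hε hε' t
    rw [map_zero, hsub, map_sub, hT' W hWV hWV.le _ _ (hL' _), sub_eq_zero,
      ← P.F.res_res hWV.le hV, f.res_F, κ.θ.app_res, κ.θ.app_res]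
    congr 1
    refine R.2.1.isLocal _ _ _ _ fun u => ?_
    have hu : P.E.res hW₀V.le (P.E.res hV (e.E u)) = P.E.res hW₀V.le u := by
      rw [e.res_E]
      exact hid.res_app hV _ (hW₀.le.trans inf_le_right) u
    rw [hL, P.F.res_res, ← hL', add_apply, add_apply, smul_apply, smul_apply, map_add, map_add,
      map_smul, map_smul, hε _ _ hu, hε' _ _ hu]
  · obtain ⟨W, hxW, hW⟩ := exists_relCompact_of_mem (U := V ⊓ Z) ⟨hx, hxZ⟩
    have hWV : RelCompact W V := hW.mono inf_le_left
    have hWZ : W ≤ Z := hW.le.trans inf_le_right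
    obtain ⟨L', hL'⟩ := exists_mapL (P := P) hV hWV
    refine ⟨W, hWV.le, V, fun _ => 0, 0, hxW, IsBasicLocal.zero.smooth,
      DirBound.zero (isBoundClass_negligibleClass S), fun Φ hΦ Ψ hΨ =>
        ⟨Φ, hΦ, Ψ, hΨ, Eventually.of_forall fun ε t => ?_⟩⟩
    rw [map_zero, hsub, map_sub, hT' W hWV hWV.le _ _ (hL' _),
      (κ.θ_vanishesOn hκ).res_app hV _ hWZ, sub_zero, ← P.F.res_res hWZ hZ, f.res_F_zero, map_zero]

end

/-- The sum of a locally finite family of moderate local maps. -/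
theorem exists_locallyFinite_sum {U : Opens X} {ι : Type*} (T : ι → P.Mloc S U)
    (Z : ι → Opens X) (hZ : ∀ i, Z i ≤ U) (hT : ∀ i Φ, P.F.res (hZ i) ((T i).1 Φ) = 0)
    (hfin : ∀ x ∈ U, ∃ W : Opens X, x ∈ W ∧ W ≤ U ∧ ∃ J : Finset ι, ∀ i ∉ J, W ≤ Z i) :
    ∃ R : P.Mloc S U, ∀ (W : Opens X) (hW : W ≤ U) (J : Finset ι), (∀ i ∉ J, W ≤ Z i) →
      ∀ Φ, P.F.res hW (R.1 Φ) = P.F.res hW ((∑ i ∈ J, T i).1 Φ) := by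
  classical
  -- Enlarging an admissible index set adds only terms that vanish on `O`, so two index sets are
  -- compared through their union.
  have hext : ∀ (Φ : P.RO U) (O : Opens X) (hO : O ≤ U) (J J' : Finset ι), (∀ i ∉ J, O ≤ Z i) →
      J ⊆ J' → P.F.res hO ((∑ i ∈ J, T i).1 Φ) = P.F.res hO ((∑ i ∈ J', T i).1 Φ) := by
    intro Φ O hO J J' hJ hJJ'
    rw [Mloc_sum_apply, Mloc_sum_apply, map_sum, map_sum]
    refine Finset.sum_subset hJJ' fun i _ hi => ?_
    rw [← P.F.res_res (hJ i hi) (hZ i), hT, map_zero]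
  have key : ∀ Φ : P.RO U, ∃ a : P.F.obj U, ∀ (W : Opens X) (hW : W ≤ U) (s : P.F.obj W),
      (∃ J : Finset ι, (∀ i ∉ J, W ≤ Z i) ∧ s = P.F.res hW ((∑ i ∈ J, T i).1 Φ)) →
        P.F.res hW a = s := by
    intro Φ
    refine P.F.isSheaf.exists_glue (fun W hW s =>
      ∃ J : Finset ι, (∀ i ∉ J, W ≤ Z i) ∧ s = P.F.res hW ((∑ i ∈ J, T i).1 Φ))
      (fun x hx => ?_) ?_
    · obtain ⟨W, hxW, hW, J, hJ⟩ := hfin x hx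
      exact ⟨W, hW, _, hxW, J, hJ, rfl⟩
    · rintro W W' hW hW' _ _ ⟨J, hJ, rfl⟩ ⟨J', hJ', rfl⟩
      rw [P.F.res_res, P.F.res_res,
        hext Φ _ _ J (J ∪ J') (fun i hi => inf_le_left.trans (hJ i hi)) Finset.subset_union_left,
        hext Φ _ _ J' (J ∪ J') (fun i hi => inf_le_right.trans (hJ' i hi))
          Finset.subset_union_right]
  choose R hR using key
  have hR' : ∀ (W : Opens X) (hW : W ≤ U) (J : Finset ι), (∀ i ∉ J, W ≤ Z i) →
      ∀ Φ, P.F.res hW (R Φ) = P.F.res hW ((∑ i ∈ J, T i).1 Φ) :=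
    fun W hW J hJ Φ => hR Φ W hW _ ⟨J, hJ, rfl⟩
  have hsm : IsSmoothMap R := by
    intro c hc
    refine P.F.isSmoothCurve_of_locally fun x hx => ?_
    obtain ⟨W, hxW, hW, J, hJ⟩ := hfin x hx
    refine ⟨W, hW, hxW, ?_⟩
    simp_rw [hR' W hW J hJ]
    exact ((∑ i ∈ J, T i).2.1.smooth c hc).map (P.F.resL hW)
  refine ⟨⟨R, ⟨hsm, fun O hO Φ₁ Φ₂ hΦ => ?_⟩, (isModerate_iff hsm).2 ?_⟩, hR'⟩
  · refine P.F.isSheaf.eq_of_locally fun x hx => ?_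
    obtain ⟨W, hxW, hW, J, hJ⟩ := hfin x (hO hx)
    refine ⟨O ⊓ W, inf_le_left, ⟨hx, hxW⟩, ?_⟩
    have hJ' : ∀ i ∉ J, O ⊓ W ≤ Z i := fun i hi => inf_le_right.trans (hJ i hi)
    rw [P.F.res_res, P.F.res_res, hR' _ _ J hJ', hR' _ _ J hJ']
    exact (∑ i ∈ J, T i).2.1.isLocal _ _ _ _ fun u => P.F.res_congr hO inf_le_left (hΦ u)
  · refine DirBound.of_locally (isBoundClass_moderateClass S) hsm fun x hx => ?_
    obtain ⟨W, hxW, hW, J, hJ⟩ := hfin x hx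
    refine ⟨W, hW, U, (∑ i ∈ J, T i).1, P.F.resL hW, hxW, (∑ i ∈ J, T i).2.1.smooth,
      (isModerate_iff (∑ i ∈ J, T i).2.1.smooth).1 (∑ i ∈ J, T i).2.2, fun Φ hΦ Ψ hΨ =>
        ⟨Φ, hΦ, Ψ, hΨ, Eventually.of_forall fun ε t => ?_⟩⟩
    exact hR' W hW J hJ _

namespace GlocPresheaf

variable [T2Space X] [LocallyCompactSpace X] (G : P.GlocPresheaf S)

/-- `T i` represents `η_i s_i` extended by zero. Their locally finite sum glues the classes: on
`c_j` each term is `η_i s_j`, and the `η_i` sum to the identity. -/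
theorem exists_gluing (hTO : ∀ U : Opens X, (P.TOloc S U).Nonempty) {U : Opens X} {ι : Type u}
    (c : ι → Opens X) (hc : ∀ i, c i ≤ U) (hcov : U ≤ ⨆ i, c i) (s : ∀ i, P.Gloc S (c i))
    (hs : ∀ i j, G.res (inf_le_left : c i ⊓ c j ≤ c i) (s i)
      = G.res (inf_le_right : c i ⊓ c j ≤ c j) (s j)) :
    ∃ g : P.Gloc S U, ∀ i, G.res (hc i) g = s i := by
  obtain ⟨η, hη, hηc, hθ⟩ := P.exists_partition U ι c hc hcov
  choose θ hθc hθη using hθ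
  let κ : ι → P.EndPair U := fun i => ⟨η i, θ i, hηc i, hθc i, hθη i⟩
  have hvan : ∀ i, (κ i).η.VanishesOn (η i).zeroLocus := fun i =>
    (η i).vanishesOn_zeroLocus P.E.isSheaf
  have hcovZ : ∀ i, U ≤ c i ⊔ (η i).zeroLocus := fun i x hx =>
    ((η i).mem_support_or_mem_zeroLocus hx).imp_left fun h => hη.support_subset i h
  choose r hr using fun i => exists_cls_eq (s i)
  choose T hTZ hT using fun i => exists_extension_Mloc G hTO (hc i) (η i).zeroLocus_le (hcovZ i)
    (κ i) (hvan i) (r i)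
  have hlf : ∀ x ∈ U, ∃ W : Opens X, x ∈ W ∧ W ≤ U ∧
      ∃ J : Finset ι, ∀ i ∉ J, W ≤ (η i).zeroLocus := by
    intro x hx
    obtain ⟨W, hxW, hW, hfin⟩ := hη.locallyFinite x hx
    exact ⟨W, hxW, hW, hfin.toFinset, fun i hi => (η i).le_zeroLocus_of_disjoint hW fun h =>
      hi (hfin.mem_toFinset.2 h)⟩
  obtain ⟨R, hR⟩ := exists_locallyFinite_sum T (fun i => (η i).zeroLocus)
    (fun i => (η i).zeroLocus_le) hTZ hlf
  refine ⟨cls R, fun j => G.eq_of_locally hTO fun x hx => ?_⟩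
  obtain ⟨W₀, hxW₀, hW₀, J, hJ⟩ := hlf x (hc j hx)
  have hWc : c j ⊓ W₀ ≤ c j := inf_le_left
  have hWU : c j ⊓ W₀ ≤ U := hWc.trans (hc j)
  have hJW : ∀ i ∉ J, c j ⊓ W₀ ≤ (η i).zeroLocus := fun i hi => inf_le_right.trans (hJ i hi)
  refine ⟨c j ⊓ W₀, hWc, ⟨hx, hxW₀⟩, ?_⟩
  rw [G.res_res, G.res_cls_congr hWU (hR _ hWU J hJW), cls_sum, map_sum]
  -- On `c i` this is the compatibility of `s i` with `s j`; on the zero locus of `η i` both sides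
  -- vanish. These two sets cover `U`.
  have hterm : ∀ i, G.res hWU (cls (T i)) = (G.endHom (κ i).contF).app _ hWU (G.res hWc (s j)) := by
    intro i
    refine G.eq_of_locally hTO fun y hy => ?_
    rcases hcovZ i (hWU hy) with hyc | hyZ
    · have h1 : c j ⊓ W₀ ⊓ c i ≤ c i := inf_le_right
      have h2 : c j ⊓ W₀ ⊓ c i ≤ c j ⊓ W₀ := inf_le_left
      refine ⟨_, h2, ⟨hy, hyc⟩, ?_⟩
      have e1 : G.res h1 (s i) = G.res h2 (G.res hWc (s j)) := by
        have h3 : c j ⊓ W₀ ⊓ c i ≤ c i ⊓ c j := le_inf h1 (h2.trans hWc)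
        rw [G.res_res, ← G.res_res h3 inf_le_left, hs i j, G.res_res]
      have e2 := (G.endHom (κ i).contF).app_res hWU h2 (G.res hWc (s j))
      have e3 := (G.endHom (κ i).contF).app_res (hc i) h1 (s i)
      refine Eq.trans ?_ e2.symm
      refine Eq.trans ?_ (congrArg ((G.endHom (κ i).contF).app _ (h2.trans hWU)) e1)
      refine Eq.trans ?_ e3
      change _ = G.res h1 (endG (κ i).contF (hc i) (s i))
      rw [G.res_res, ← hr i, ← hT i, G.res_res]
    · have h1 : c j ⊓ W₀ ⊓ (η i).zeroLocus ≤ (η i).zeroLocus := inf_le_right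
      have h2 : c j ⊓ W₀ ⊓ (η i).zeroLocus ≤ c j ⊓ W₀ := inf_le_left
      refine ⟨_, h2, ⟨hy, hyZ⟩, ?_⟩
      have e1 := (G.endHom_vanishesOn (κ i).contF ((κ i).θ_vanishesOn (hvan i))).res_app hWU h2 h1
        (G.res hWc (s j))
      refine Eq.trans ?_ e1.symm
      rw [G.res_res, G.res_cls_congr (h2.trans hWU) (R' := 0)]
      · exact map_zero (G.res _)
      · intro Φ
        rw [← P.F.res_res h1 (η i).zeroLocus_le, hTZ]
        exact (map_zero _).trans (map_zero (P.F.res (h2.trans hWU))).symm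
  simp_rw [hterm]
  refine G.sum_endHom_app (fun i => (κ i).contF) hWU J (fun φ => P.incl_injective _ ?_) _
  rw [map_sum]
  simp_rw [← (κ _).compat]
  exact hη.sum_eq_of_vanishesOn P.E.isSheaf hWU J (fun i hi => (hvan i).mono (hJW i hi)) _

theorem isSheaf (hTO : ∀ U : Opens X, (P.TOloc S U).Nonempty) : G.toVPresheaf.IsSheaf := by
  intro U ι c hc hcov
  refine ⟨fun g hg => G.eq_of_locally hTO fun x hx => ?_, G.exists_gluing hTO c hc hcov⟩
  obtain ⟨i, hi⟩ := Opens.mem_iSup.1 (hcov hx)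
  exact ⟨c i, hc i, hi, (hg i).trans (map_zero (G.res (hc i))).symm⟩

/-- Apply `exists_cutoff` to the covering of `U` by the complements of `B` and `A`: the identity
region then contains `A` and the zero region contains `B`. -/
theorem isFineOn (U : Opens X) : G.toVPresheaf.IsFineOn U := by
  intro A B hA hB hAB
  let V : Opens X := ⟨Subtype.val '' Bᶜ, U.isOpen.isOpenMap_subtype_val _ hB.isOpen_compl⟩
  let Z₀ : Opens X := ⟨Subtype.val '' Aᶜ, U.isOpen.isOpenMap_subtype_val _ hA.isOpen_compl⟩
  have hV : V ≤ U := by rintro _ ⟨x, -, rfl⟩; exact x.2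
  have hZ₀ : Z₀ ≤ U := by rintro _ ⟨x, -, rfl⟩; exact x.2
  have hU : U ≤ V ⊔ Z₀ := by
    intro x hx
    by_cases hxA : (⟨x, hx⟩ : U) ∈ A
    · exact Or.inl ⟨⟨x, hx⟩, hAB.notMem_of_mem_left hxA, rfl⟩
    · exact Or.inr ⟨⟨x, hx⟩, hxA, rfl⟩
  obtain ⟨κ, N, Z, hN, hZ, hNU, hVU, hid, hvan⟩ := exists_cutoff (P := P) hV hZ₀ hU
  refine ⟨G.endHom κ.contF, N, Z, hN, hZ, ?_, ?_, G.endHom_isIdOn _ (κ.θ_isIdOn hid),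
    G.endHom_vanishesOn _ (κ.θ_vanishesOn hvan)⟩
  · rintro _ ⟨x, hx, rfl⟩
    refine (hNU x.2).resolve_right ?_
    rintro ⟨y, hy, he⟩
    exact hy (Subtype.ext he ▸ hx)
  · rintro _ ⟨x, hx, rfl⟩
    refine (hVU x.2).resolve_left ?_
    rintro ⟨y, hy, he⟩
    exact hy (Subtype.ext he ▸ hx)

theorem hasPartitionsOfUnityOn (hTO : ∀ U : Opens X, (P.TOloc S U).Nonempty) (U : Opens X) :
    G.toVPresheaf.HasPartitionsOfUnityOn U := by
  classical
  intro ι c hc hcov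
  obtain ⟨η, hη, hηc, hθ⟩ := P.exists_partition U ι c hc hcov
  choose θ hθc hθη using hθ
  let κ : ι → P.EndPair U := fun i => ⟨η i, θ i, hηc i, hθc i, hθη i⟩
  have hvan : ∀ i, (κ i).η.VanishesOn (η i).zeroLocus := fun i =>
    (η i).vanishesOn_zeroLocus P.E.isSheaf
  have hvanG : ∀ i {W : Opens X}, (η i).VanishesOn W → (G.endHom (hθc i)).VanishesOn W :=
    fun i W h => G.endHom_vanishesOn (hθc i) ((κ i).θ_vanishesOn h)
  have hsupp : ∀ i, (G.endHom (hθc i)).support ⊆ (η i).support := fun i x hx =>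
    ⟨hx.1, fun W hW hxW h => hx.2 W hW hxW (hvanG i h)⟩
  refine ⟨fun i => G.endHom (hθc i), fun x hx => ?_, fun i => (hsupp i).trans (hη.support_subset i),
    fun V hV hfin g => ?_⟩
  · obtain ⟨W, hxW, hW, hf⟩ := hη.locallyFinite x hx
    exact ⟨W, hxW, hW, hf.subset fun i hi => hi.mono (inter_subset_inter_left _ (hsupp i))⟩
  -- `hfin` concerns supports on `𝒢_loc`, whereas local finiteness is known for supports on `E`. On
  -- `V ⊓ W` both finite sums equal the sum over the union of the index sets.
  · refine G.eq_of_locally hTO fun x hx => ?_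
    obtain ⟨W, hxW, hW, hf⟩ := hη.locallyFinite x (hV hx)
    have hO : V ⊓ W ≤ V := inf_le_left
    refine ⟨V ⊓ W, hO, ⟨hx, hxW⟩, ?_⟩
    have hJ : ∀ i ∉ hf.toFinset, (η i).VanishesOn (V ⊓ W) := fun i hi =>
      ((hvan i).mono ((η i).le_zeroLocus_of_disjoint hW fun h =>
        hi (hf.mem_toFinset.2 h))).mono inf_le_right
    have hI : ∀ i ∉ hfin.toFinset, (G.endHom (hθc i)).VanishesOn (V ⊓ W) := fun i hi =>
      (((G.endHom (hθc i)).vanishesOn_zeroLocus (G.isSheaf hTO)).mono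
        ((G.endHom (hθc i)).le_zeroLocus_of_disjoint hV fun h =>
          hi (hfin.mem_toFinset.2 h))).mono inf_le_left
    have e1 : G.res hO (∑ i ∈ hfin.toFinset, (G.endHom (hθc i)).app V hV g)
        = ∑ i ∈ hfin.toFinset, (G.endHom (hθc i)).app (V ⊓ W) (hO.trans hV) (G.res hO g) :=
      (map_sum (G.res hO) _ _).trans
        (Finset.sum_congr rfl fun i _ => (G.endHom (hθc i)).app_res hV hO g)
    have e2 : ∑ i ∈ hf.toFinset, (G.endHom (hθc i)).app (V ⊓ W) (hO.trans hV) (G.res hO g)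
        = G.res hO g := by
      refine G.sum_endHom_app hθc (hO.trans hV) _ (fun φ => P.incl_injective _ ?_) _
      rw [map_sum]
      simp_rw [← hθη]
      exact hη.sum_eq_of_vanishesOn P.E.isSheaf (hO.trans hV) _ hJ _
    refine e1.trans (Eq.trans ?_ e2)
    refine (Finset.sum_subset (Finset.subset_union_left (s₂ := hf.toFinset)) fun i _ hi => ?_).trans
      (Finset.sum_subset Finset.subset_union_right fun i _ hi => ?_).symm
    · exact hI i hi _ _ le_rfl _
    · exact hvanG i (hJ i hi) _ _ le_rfl _

end GlocPresheaf

instance toZero_neBot : NeBot toZero := by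
  refine comap_neBot_iff.2 fun t ht => ?_
  obtain ⟨ε, hε, hεt⟩ := Filter.nonempty_of_mem
    (inter_mem (Ioc_mem_nhdsGT (zero_lt_one : (0 : ℝ) < 1)) ht)
  exact ⟨⟨ε, hε⟩, hεt⟩

/-! ### The embedding of `F` -/

/-- Order `l = 0` suffices: negligibility makes the constant `q φ` bounded by a scale tending to
`0`. Hence every continuous seminorm vanishes at `φ`, and `F(U)` is Hausdorff. -/
theorem sigma_injective {U : Opens X} (hU : (P.TOloc S U).Nonempty) :
    Function.Injective (P.sigma S U) := by
  refine (injective_iff_map_eq_zero _).2 fun φ hφ => eq_zero_of_forall_seminorm fun q hq => ?_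
  obtain ⟨Φ, hΦ⟩ := hU
  have hneg : IsNegligible S (fun _ => φ : P.RO U → P.F.obj U) :=
    ((Submodule.Quotient.mk_eq_zero _).1 hφ).2
  obtain ⟨m, hm, hlim⟩ := S.I_lim
  have hb := (isNegligible_iff (IsBasicLocal.const φ).smooth).1 hneg q hq 0 Φ hΦ 0 TOzloc_zero m hm
  simp only [dirDeriv_zero] at hb
  have hlim' : Tendsto (fun ε => (m ε : ℝ)) toZero (𝓝 0) := by
    simpa using NNReal.tendsto_coe.2 hlim
  exact tendsto_nhds_unique tendsto_const_nhds (IsBigO.trans_tendsto hb hlim')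

theorem GlocPresheaf.res_sigma [T2Space X] [LocallyCompactSpace X] (G : P.GlocPresheaf S)
    {U V : Opens X} (h : V ≤ U) (φ : P.F.obj U) :
    G.res h (P.sigma S U φ) = P.sigma S V (P.F.res h φ) :=
  G.res_cls h (R := ⟨fun _ => φ, IsBasicLocal.const φ, IsModerate.const S φ⟩)
    (R' := ⟨fun _ => P.F.res h φ, IsBasicLocal.const _, IsModerate.const S _⟩)
    fun _ _ hW _ _ _ => P.F.res_res hW h φ

/-! ### Products -/

section Mul

variable {U : Opens X} {B : P.F.obj U →ₗ[ℂ] P.F.obj U →ₗ[ℂ] P.F.obj U}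

/-- Leibniz rule together with `p (B a b) ≤ q a * q b`. The classes are kept general to cover
moderate times moderate as well as moderate times negligible. -/
theorem DirBound.bilinear {C C₁ C₂ : Set (Param → ℝ)} (hC : IsBoundClass C)
    (hmul : ∀ {f g : Param → ℝ}, f ∈ C₁ → g ∈ C₂ → f * g ∈ C)
    (hB : Continuous fun x : P.F.obj U × P.F.obj U => B x.1 x.2) {R₁ R₂ : P.RO U → P.F.obj U}
    (h₁ : IsSmoothMap R₁) (h₂ : IsSmoothMap R₂) (hb₁ : DirBound S C₁ R₁)
    (hb₂ : DirBound S C₂ R₂) : DirBound S C fun Φ => B (R₁ Φ) (R₂ Φ) := by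
  intro p hp l Φ hΦ Ψ hΨ
  obtain ⟨q, hq, hpq⟩ := exists_seminorm_bilinear_le B hB p hp
  have hterm : ∀ ij : ℕ × ℕ, (fun ε => (l.choose ij.1 : ℝ) *
      (q (dirDeriv ij.1 R₁ (Φ ε) (Ψ ε)) * q (dirDeriv ij.2 R₂ (Φ ε) (Ψ ε)))) ∈ C := fun ij =>
    hC.const_mul_mem (hmul (hb₁ q hq ij.1 Φ hΦ Ψ hΨ) (hb₂ q hq ij.2 Φ hΦ Ψ hΨ)) _
  refine hC.of_le (hC.sum_mem (Finset.HasAntidiagonal.antidiagonal l) fun ij _ => hterm ij)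
    (fun _ => apply_nonneg _ _) (Eventually.of_forall fun ε => ?_)
  rw [dirDeriv_bilinear hB h₁ h₂, Finset.sum_apply]
  refine (Finset.le_sum_of_subadditive p (map_zero p).le (map_add_le_add p) _ _).trans
    (Finset.sum_le_sum fun ij _ => ?_)
  rw [← Nat.cast_smul_eq_nsmul ℂ, map_smul_eq_mul]
  simpa using mul_le_mul_of_nonneg_left (hpq _ _) (Nat.cast_nonneg (l.choose ij.1))

theorem moderateClass_mul {f g : Param → ℝ} (hf : f ∈ moderateClass S)
    (hg : g ∈ moderateClass S) : f * g ∈ moderateClass S := by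
  obtain ⟨l, hl, hf⟩ := hf
  obtain ⟨m, hm, hg⟩ := hg
  obtain ⟨n, hn, h⟩ := S.A_mul l hl m hm
  exact ⟨n, hn, (IsBigO.mul hf hg).trans h⟩

theorem moderateClass_mul_negligibleClass {f g : Param → ℝ} (hf : f ∈ moderateClass S)
    (hg : g ∈ negligibleClass S) : f * g ∈ negligibleClass S := by
  obtain ⟨l, hl, hf⟩ := hf
  intro m hm
  obtain ⟨n, hn, h⟩ := S.A_mul_I m hm l hl
  exact (IsBigO.mul hf (hg n hn)).trans h

variable (a : P.F.toVPresheaf.AlgebraStructure) (ha : LCSheaf.IsJointlyContinuous a)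

/-- The pointwise product of moderate local maps. -/
def mulM (U : Opens X) : P.Mloc S U →ₗ[ℂ] P.Mloc S U →ₗ[ℂ] P.Mloc S U :=
  LinearMap.mk₂ ℂ (fun R₁ R₂ => ⟨fun Φ => a.mul U (R₁.1 Φ) (R₂.1 Φ),
    ⟨R₁.2.1.smooth.bilinear (ha U) R₂.2.1.smooth, fun V hV Φ₁ Φ₂ hΦ => by
      rw [a.res_mul, a.res_mul, R₁.2.1.isLocal V hV Φ₁ Φ₂ hΦ, R₂.2.1.isLocal V hV Φ₁ Φ₂ hΦ]⟩,
    (isModerate_iff (R₁.2.1.smooth.bilinear (ha U) R₂.2.1.smooth)).2 <|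
      DirBound.bilinear (isBoundClass_moderateClass S) moderateClass_mul (ha U) R₁.2.1.smooth
        R₂.2.1.smooth ((isModerate_iff R₁.2.1.smooth).1 R₁.2.2)
        ((isModerate_iff R₂.2.1.smooth).1 R₂.2.2)⟩)
    (fun R R' R₂ => Subtype.ext <| funext fun Φ =>
      LinearMap.map_add₂ (a.mul U) (R.1 Φ) (R'.1 Φ) (R₂.1 Φ))
    (fun c R R₂ => Subtype.ext <| funext fun Φ => LinearMap.map_smul₂ (a.mul U) c (R.1 Φ) (R₂.1 Φ))
    (fun R₁ R R' => Subtype.ext <| funext fun Φ => map_add (a.mul U (R₁.1 Φ)) (R.1 Φ) (R'.1 Φ))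
    (fun c R₁ R => Subtype.ext <| funext fun Φ => map_smul (a.mul U (R₁.1 Φ)) c (R.1 Φ))

theorem mulM_apply (R₁ R₂ : P.Mloc S U) (Φ : P.RO U) :
    (mulM a ha U R₁ R₂).1 Φ = a.mul U (R₁.1 Φ) (R₂.1 Φ) := rfl

theorem mulM_comm (R₁ R₂ : P.Mloc S U) : mulM a ha U R₁ R₂ = mulM a ha U R₂ R₁ :=
  Subtype.ext <| funext fun _ => a.mul_comm U _ _

theorem mulM_mem_Nloc (R₁ R₂ : P.Mloc S U) (h : R₂.1 ∈ P.Nloc S U) :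
    (mulM a ha U R₁ R₂).1 ∈ P.Nloc S U :=
  ⟨(mulM a ha U R₁ R₂).2.1, (isNegligible_iff (mulM a ha U R₁ R₂).2.1.smooth).2 <|
    DirBound.bilinear (isBoundClass_negligibleClass S) moderateClass_mul_negligibleClass (ha U)
      R₁.2.1.smooth R₂.2.1.smooth ((isModerate_iff R₁.2.1.smooth).1 R₁.2.2)
      ((isNegligible_iff R₂.2.1.smooth).1 h.2)⟩

/-- The product of `𝒢_loc(U)`. -/
def mulG (U : Opens X) : P.Gloc S U →ₗ[ℂ] P.Gloc S U →ₗ[ℂ] P.Gloc S U :=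
  Submodule.liftQ _
    { toFun := fun R => Submodule.mapQ _ _ (mulM a ha U R) fun R₂ h => mulM_mem_Nloc a ha R R₂ h
      map_add' := fun R R' => LinearMap.ext fun g => by
        obtain ⟨R₂, rfl⟩ := exists_cls_eq g
        exact congrArg cls (LinearMap.map_add₂ (mulM a ha U) R R' R₂)
      map_smul' := fun c R => LinearMap.ext fun g => by
        obtain ⟨R₂, rfl⟩ := exists_cls_eq g
        exact congrArg cls (LinearMap.map_smul₂ (mulM a ha U) c R R₂) }
    fun R hR => LinearMap.ext fun g => by
      obtain ⟨R₂, rfl⟩ := exists_cls_eq g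
      refine (Submodule.Quotient.mk_eq_zero _).2 ?_
      -- Commutativity reduces the ideal property in the first factor to that in the second.
      rw [mulM_comm]
      exact mulM_mem_Nloc a ha R₂ R hR

theorem mulG_cls (R₁ R₂ : P.Mloc S U) :
    mulG a ha U (cls R₁) (cls R₂) = cls (mulM a ha U R₁ R₂) := rfl

variable [T2Space X] [LocallyCompactSpace X]

/-- The algebra structure of `𝒢_loc`. -/
def GlocPresheaf.algebraStructure (G : P.GlocPresheaf S) : G.toVPresheaf.AlgebraStructure where
  mul U := mulG a ha U
  mul_comm U g₁ g₂ := by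
    obtain ⟨R₁, rfl⟩ := exists_cls_eq g₁
    obtain ⟨R₂, rfl⟩ := exists_cls_eq g₂
    exact congrArg cls (mulM_comm a ha R₁ R₂)
  mul_assoc U g₁ g₂ g₃ := by
    obtain ⟨R₁, rfl⟩ := exists_cls_eq g₁
    obtain ⟨R₂, rfl⟩ := exists_cls_eq g₂
    obtain ⟨R₃, rfl⟩ := exists_cls_eq g₃
    exact congrArg cls (Subtype.ext <| funext fun Φ => a.mul_assoc U _ _ _ :
      mulM a ha U (mulM a ha U R₁ R₂) R₃ = mulM a ha U R₁ (mulM a ha U R₂ R₃))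
  res_mul {U V} h g₁ g₂ := by
    obtain ⟨R₁, rfl⟩ := exists_cls_eq g₁
    obtain ⟨R₂, rfl⟩ := exists_cls_eq g₂
    change G.res h (cls _) = mulG a ha V (G.res h (cls R₁)) (G.res h (cls R₂))
    obtain ⟨R₁', h₁, e₁⟩ := G.res_mk h R₁
    obtain ⟨R₂', h₂, e₂⟩ := G.res_mk h R₂
    rw [e₁, e₂, mulG_cls]
    refine G.res_cls h fun W hWc hW Φ Φ' hΦ => ?_
    rw [mulM_apply, mulM_apply, a.res_mul, a.res_mul, h₁ W hWc hW Φ Φ' hΦ, h₂ W hWc hW Φ Φ' hΦ]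

end Mul

end TestPair

end NonlinearExtension

end

theorem mainTheorem6 {X : Type u} [TopologicalSpace X] [T2Space X] [LocallyCompactSpace X]
    [ParacompactSpace X] (P : NonlinearExtension.TestPair.{u, v, w} X)
    (S : NonlinearExtension.ScalePair) (hTO : ∀ U : Opens X, (P.TOloc S U).Nonempty) :
    -- the restriction maps on local elements of the basic space are well defined
    (∀ (U V : Opens X) (h : V ≤ U) (R : P.RO U → P.F.obj U),
      NonlinearExtension.TestPair.IsBasicLocal R →
      ∃! R' : P.RO V → P.F.obj V, NonlinearExtension.TestPair.IsBasicLocal R' ∧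
        NonlinearExtension.TestPair.IsRestriction h R R') ∧
    -- they induce a unique presheaf structure on the quotients
    ∃ G : P.GlocPresheaf S, (∀ G' : P.GlocPresheaf S, G' = G) ∧
      -- which is a sheaf
      G.toVPresheaf.IsSheaf ∧
      -- whose restriction to every open set is fine
      (∀ U : Opens X, G.toVPresheaf.IsFineOn U ∧ G.toVPresheaf.HasPartitionsOfUnityOn U) ∧
      -- morphisms of `F|_U` extend to `G|_U`; cut-off morphisms extend to cut-off morphisms
      (∀ (U : Opens X) (T : P.F.EndOn U), NonlinearExtension.LCSheaf.IsContinuous T →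
        ∃ T' : NonlinearExtension.VPresheaf.Hom G.toVPresheaf G.toVPresheaf U,
          (∀ (V : Opens X) (hV : V ≤ U) (R : P.Mloc S V), ∃ R' : P.Mloc S V,
            (∀ Φ : P.RO V, R'.1 Φ = T.app V hV (R.1 Φ)) ∧
            T'.app V hV (NonlinearExtension.TestPair.cls R) =
              NonlinearExtension.TestPair.cls R') ∧
          (∀ (V : Opens X) (hV : V ≤ U) (φ : P.F.obj V),
            T'.app V hV (P.sigma S V φ) = P.sigma S V (T.app V hV φ)) ∧
          ∀ W : Opens X, W ≤ U →
            (T.IsIdOn W → T'.IsIdOn W) ∧ (T.VanishesOn W → T'.VanishesOn W)) ∧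
      -- `σ` is an injective sheaf morphism
      (∀ U : Opens X, Function.Injective (P.sigma S U)) ∧
      (∀ (U V : Opens X) (h : V ≤ U) (φ : P.F.obj U),
        G.res h (P.sigma S U φ) = P.sigma S V (P.F.res h φ)) ∧
      -- if `F` is a locally convex sheaf of algebras, then `G` is a sheaf of algebras with the
      -- product `[R₁] [R₂] = [R₁ R₂]`, and `σ` is an algebra homomorphism
      ∀ a : P.F.toVPresheaf.AlgebraStructure, NonlinearExtension.LCSheaf.IsJointlyContinuous a →
        ∃ b : G.toVPresheaf.AlgebraStructure,
          (∀ (U : Opens X) (R₁ R₂ : P.Mloc S U), ∃ R : P.Mloc S U,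
            (∀ Φ : P.RO U, R.1 Φ = a.mul U (R₁.1 Φ) (R₂.1 Φ)) ∧
            b.mul U (NonlinearExtension.TestPair.cls R₁) (NonlinearExtension.TestPair.cls R₂) =
              NonlinearExtension.TestPair.cls R) ∧
          (∀ (U : Opens X) (φ ψ : P.F.obj U),
            P.sigma S U (a.mul U φ ψ) = b.mul U (P.sigma S U φ) (P.sigma S U ψ)) ∧
          ∀ (U : Opens X) (e : P.F.obj U), (∀ φ : P.F.obj U, a.mul U e φ = φ) →
            ∀ g : P.Gloc S U, b.mul U (P.sigma S U e) g = g := by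
  obtain ⟨G⟩ : Nonempty (P.GlocPresheaf S) := ⟨NonlinearExtension.TestPair.glocPresheaf hTO⟩
  -- The formulas on classes hold by `rfl`, since the maps on the quotients are induced by explicit
  -- maps on representatives; in particular composing `T` with a constant map gives a constant map.
  refine ⟨fun U V h R hR => ?_, G, fun G' => G'.eq _, ?_, fun U => ⟨?_, ?_⟩,
    fun U T hT => ⟨G.endHom hT, fun V hV R => ⟨_, fun _ => rfl, rfl⟩,
      fun V hV φ => rfl, fun W _ => ⟨?_, ?_⟩⟩, fun U => ?_, fun U V h φ => ?_, fun a ha => ?_⟩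
  · obtain ⟨R', hR', hres⟩ := hR.exists_restriction h
    exact ⟨R', ⟨hR', hres⟩, fun R'' h'' => h''.2.eq hres⟩
  · exact G.isSheaf hTO
  · exact G.isFineOn U
  · exact G.hasPartitionsOfUnityOn hTO U
  · exact G.endHom_isIdOn hT
  · exact G.endHom_vanishesOn hT
  · exact NonlinearExtension.TestPair.sigma_injective (hTO U)
  · exact G.res_sigma h φ
  · refine ⟨G.algebraStructure a ha, fun U R₁ R₂ => ⟨_, fun _ => rfl, rfl⟩,
      fun U φ ψ => rfl, fun U e he g => ?_⟩
    obtain ⟨R, rfl⟩ := NonlinearExtension.TestPair.exists_cls_eq g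
    exact congrArg NonlinearExtension.TestPair.cls (Subtype.ext (funext fun Φ => he _) :
      NonlinearExtension.TestPair.mulM a ha U ⟨fun _ => e, _⟩ R = R)
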